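/- Let $S$ be a set of primes and let $P(S)$ be the set of positive integers all of whose prime divisors lie in $S$ (so $1\in P(S)$). For $n\ge 1$ let $Q_n=\prod_{q\in S}q^{a_q(n)}$, where $q^{a_q(n)}$ is the exact power of $q$ dividing $n$, let $C_n\le S_n$ be the cyclic group generated by an $n$-cycle, and let $L_n^S$ be the Frobenius characteristic of the $S_n$-representation induced from the one-dimensional representation of $C_n$ in which the generator acts as $\exp\left(\frac{2\pi i}{n}Q_n\right)$. Put $L^S(t)=\sum_{n\ge1}t^nL_n^S$. For a series $F(t)=\sum_{n\ge 1}t^nf_n$ with $f_n$ a symmetric function homogeneous of degree $n$, put $H[F](t)=\sum_{r\ge0}h_r[F(t)]$ and $E[F](t)=\sum_{r\ge0}e_r[F(t)]$ (plethysm, where $p_k[F(t)]=\sum_n t^{kn}p_k[f_n]$), so that the coefficient of $t^n$ is the homogeneous component of degree $n$. For a partition $\lambda$ let $p_\lambda=\prod_i p_{\lambda_i}$. A symmetric function is called Schur-positive if it is a linear combination of Schur functions with nonnegative integer coefficients. (1) If $2\in S$, then for every $n\ge0$ the symmetric function $\sum_{\lambda}p_\lambda$, summed over all partitions $\lambda$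 of $n$ whose parts are all odd and lie in $P(S)$, is Schur-positive; moreover $$H[L^{S\setminus\{2\}}](t)=E[L^S](t)=\sum_{n\ge0}t^n\sum_{\substack{\lambda\vdash n\\ \lambda_i\text{ odd},\ \lambda_i\in P(S)}}p_\lambda=\sum_{n\ge0}t^n\sum_{\substack{\lambda\vdash n\\ \lambda_i\in P(S\setminus\{2\})}}p_\lambda .$$ (2) If $2\notin S$, then all elements of $P(S)$ are odd, and for every $n\ge0$ the symmetric function $\sum_\lambda p_\lambda$ is Schur-positive, where $\lambda$ runs over all partitions of $n$ each of whose parts lies in $P(S)$ or is twice an odd element of $P(S)$, and in which each even part occurs at most once. -/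

import Mathlib

noncomputable section

open scoped Classical

namespace PrimeLie

/-! ### Symmetric functions -/

/-- A symmetric function `f` (over `ℂ`) is recorded by all its specialisations
`f(x_1, …, x_N)`, `N = 0, 1, 2, …`; this is the ring of families of polynomials, in which the
ring of symmetric functions embeds, with componentwise operations. -/
abbrev SymFn : Type := (N : ℕ) → MvPolynomial (Fin N) ℂ

/-- The complete homogeneous symmetric function `h_k`. -/
def h (k : ℕ) : SymFn := fun N => MvPolynomial.hsymm (Fin N) ℂ k

/-- The power sum `p_λ = ∏ p_{λ_i}`, where `p_k = ∑ x_i ^ k`. -/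
def p {n : ℕ} (lam : n.Partition) : SymFn := fun N => MvPolynomial.psumPart (Fin N) ℂ lam

/-- The `i`-th largest part of `λ` (indexed from `0`), and `0` if `i` is at least the length. -/
def rowLength {n : ℕ} (lam : n.Partition) (i : ℕ) : ℕ :=
  (lam.parts.sort (fun a b => b ≤ a)).getD i 0

/-- The Schur function `s_λ = det (h_{λ_i - i + j})` (Jacobi--Trudi), with `h_k = 0` for `k < 0`.
The partition is padded by zeros to `n = |λ|` rows. -/
def schur {n : ℕ} (lam : n.Partition) : SymFn :=
  Matrix.det (Matrix.of fun i j : Fin n =>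
    if (i : ℕ) ≤ rowLength lam i + j then h (rowLength lam i + j - i) else 0)

/-- `f` is a symmetric function of degree `n` all of whose coefficients in the Schur basis are
nonnegative integers. -/
def SchurPositive (n : ℕ) (f : SymFn) : Prop :=
  ∃ c : n.Partition → ℕ, f = ∑ lam : n.Partition, c lam • schur lam

/-! ### Plethysm -/

/-- `p_k[f]`: every variable `x_i` is replaced by `x_i ^ k`. -/
def adams (k : ℕ) (f : SymFn) : SymFn := fun N => MvPolynomial.expand k (f N)

/-- `p_k[F(t)]` for a formal power series `F(t) = ∑ t ^ n f_n` (used for `k ≥ 1`):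
the series `∑ t ^ (k n) p_k[f_n]`. -/
def adamsSeries (k : ℕ) (F : PowerSeries SymFn) : PowerSeries SymFn :=
  PowerSeries.mk fun n => if k ∣ n then adams k (PowerSeries.coeff (n / k) F) else 0

/-- `z_λ = ∏ i ^ {m_i} m_i !`, where `m_i` is the multiplicity of `i` as a part of `λ`. -/
def zee {n : ℕ} (lam : n.Partition) : ℕ :=
  ∏ i ∈ lam.parts.toFinset, i ^ lam.parts.count i * (lam.parts.count i).factorial

/-- The plethysm `h_r[F(t)]`, from `h_r = ∑_{λ ⊢ r} z_λ⁻¹ p_λ`. -/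
def hPleth (r : ℕ) (F : PowerSeries SymFn) : PowerSeries SymFn :=
  ∑ lam : r.Partition, ((zee lam : ℂ)⁻¹) • (lam.parts.map fun k => adamsSeries k F).prod

/-- The plethysm `e_r[F(t)]`, from `e_r = ∑_{λ ⊢ r} (-1) ^ (r - ℓ(λ)) z_λ⁻¹ p_λ`. -/
def ePleth (r : ℕ) (F : PowerSeries SymFn) : PowerSeries SymFn :=
  ∑ lam : r.Partition, ((-1 : ℂ) ^ (r - lam.parts.card) * (zee lam : ℂ)⁻¹) •
    (lam.parts.map fun k => adamsSeries k F).prod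

/-- `H[F](t) = ∑_{r ≥ 0} h_r[F(t)]` for a series `F(t)` without constant term: the terms with
`r > n` do not contribute to the coefficient of `t ^ n`. -/
def HPleth (F : PowerSeries SymFn) : PowerSeries SymFn :=
  PowerSeries.mk fun n => ∑ r ∈ Finset.range (n + 1), PowerSeries.coeff n (hPleth r F)

/-- `E[F](t) = ∑_{r ≥ 0} e_r[F(t)]` for a series `F(t)` without constant term. -/
def EPleth (F : PowerSeries SymFn) : PowerSeries SymFn :=
  PowerSeries.mk fun n => ∑ r ∈ Finset.range (n + 1), PowerSeries.coeff n (ePleth r F)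

/-! ### Frobenius characteristic and the representations `L_n^S` -/

/-- The Frobenius characteristic `(1 / n!) ∑_σ χ(σ) p_{type σ}` of a representation of the
symmetric group on the `n`-element set `X`, with character `χ`. -/
def frobeniusChar {X V : Type} [Fintype X] [DecidableEq X] [AddCommGroup V] [Module ℂ V]
    (ρ : Representation ℂ (Equiv.Perm X) V) : SymFn :=
  (((Fintype.card X).factorial : ℂ)⁻¹) • ∑ σ : Equiv.Perm X, ρ.character σ • p σ.partition

/-- The cyclic group `C_n = ℤ/n` as a group of permutations of the `n`-element set `ℤ/n`: its
generator `1` acts as the `n`-cycle `x ↦ 1 + x`. -/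
def cyclicHom (n : ℕ) : Multiplicative (ZMod n) →* Equiv.Perm (ZMod n) :=
  MulAction.toPermHom (Multiplicative (ZMod n)) (ZMod n)

/-- The one-dimensional representation of `C_n` in which the generator acts as multiplication by
`exp (2 π i r / n)`. -/
def cyclicRep (n : ℕ) [NeZero n] (r : ℕ) : Representation ℂ (Multiplicative (ZMod n)) ℂ :=
  (Algebra.lmul ℂ ℂ : ℂ →* Module.End ℂ ℂ).comp
    ((ZMod.stdAddChar (N := n)).mulShift (r : ZMod n)).toMonoidHom

/-- The part `Q_n = ∏_{q ∈ S} q ^ {a_q(n)}` of `n` supported on the primes in `S`. -/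
def Qpart (S : Set ℕ) (n : ℕ) : ℕ :=
  ∏ q ∈ n.primeFactors with q ∈ S, q ^ n.factorization q

/-- `P(S)`: the positive integers all of whose prime divisors lie in `S`. -/
def P (S : Set ℕ) : Set ℕ := {n | 1 ≤ n ∧ ∀ q : ℕ, q.Prime → q ∣ n → q ∈ S}

/-- `L_n^S`, the Frobenius characteristic of the representation `exp (2 π i Q_n / n)` of `C_n`
induced to the symmetric group, for `n ≥ 1`. -/
def L (S : Set ℕ) (n : ℕ) [NeZero n] : SymFn :=
  frobeniusChar (Representation.ind (cyclicHom n) (cyclicRep n (Qpart S n)))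

/-- The series `L^S(t) = ∑_{n ≥ 1} t ^ n L_n^S`. -/
def LSeries (S : Set ℕ) : PowerSeries SymFn :=
  PowerSeries.mk fun n => if hn : n = 0 then 0 else haveI : NeZero n := ⟨hn⟩; L S n

/-! ### Sums of power sums -/

/-- `P_T = ∑_{λ ∈ T} p_λ` for a set `T` of partitions of `n`. -/
def powerSumOver {n : ℕ} (T : Set n.Partition) : SymFn := ∑ lam : n.Partition with lam ∈ T, p lam

/-- The partitions of `n` all of whose parts are odd and lie in `P(S)`. -/
def oddParts (S : Set ℕ) (n : ℕ) : Set n.Partition :=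
  {lam | ∀ i ∈ lam.parts, Odd i ∧ i ∈ P S}

/-- The partitions of `n` all of whose parts lie in `P(S)`. -/
def partsIn (S : Set ℕ) (n : ℕ) : Set n.Partition :=
  {lam | ∀ i ∈ lam.parts, i ∈ P S}

/-- The partitions of `n` each of whose parts lies in `P(S)` or is twice an odd element of `P(S)`,
and in which every even part occurs at most once. -/
def partsInOrTwice (S : Set ℕ) (n : ℕ) : Set n.Partition :=
  {lam | (∀ i ∈ lam.parts, i ∈ P S ∨ ∃ m, Odd m ∧ m ∈ P S ∧ i = 2 * m) ∧
    ∀ i, Even i → lam.parts.count i ≤ 1}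

end PrimeLie

end

noncomputable section

open scoped Classical

namespace PrimeLie

open Equiv

/-! ### Traces along the cycles of a permutation -/

/-! The power sum expansions come from logarithmic derivatives, the positivity from wreath products.

Expansion. In `t d/dt log H[F]` the coefficient of `t ^ n` is the sum over `k ∣ n` of `p_k[(n/k)
f_{n/k}]`; for `E[F]` the term `k` carries the sign `(-1) ^ (k - 1)` (`eulerDeriv_HPleth`,
`eulerDeriv_EPleth`). Grouping the elements of `C_n` by their order gives `n L_n = ∑_{d ∣ n} c(d)
p_d ^ (n/d)`. For `e ∣ n`, the sum of `c(d)` over `d ∣ e` is a character sum over the `e`-torsion of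
`ℤ/n`, hence `e` if `e ∣ Q_n`, that is if `e ∈ P(S)`, and `0` otherwise. So `c` is the Möbius
transform of `w(e) = e · [e ∈ P(S)]` and does not depend on `n` (`ramanujanSum_Qpart`). Since
`p_k[p_d] = p_{kd}`, the coefficient becomes `∑_{e ∣ n} w(e) p_e ^ (n/e)` for `H`, and for `E` the
same sum with `w(e) - 2 w(e/2)` in place of `w(e)` when `e` is even (`sum_sign_primeWeight`). These
are logarithmic derivatives of products of factors `(1 - t^e p_e)^{±1}`. If `2 ∈ S`, the even `e`
cancel. If `2 ∉ S`, then `E[L^S]` is the product of `(1 - t^{2m} p_{2m}) / (1 - t^m p_m)` over `m ∈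
P(S)`, whose coefficients are the sums of `(-1)^{n - ℓ(λ)} p_λ`, the `ω`-images of the sums in the
statement.

Positivity. The coefficients of `E[L^S]` are sums of products of plethysms `e_m[L_i]`. Each
`e_m[L_i]` is induced from a linear character of the wreath product of `C_i` with `S_m`
(`exteriorPleth_inducedFrob`); this rests on the identity `sum_prod_perm` between sums over
colourings and traces along cycles. By Frobenius reciprocity an induced linear character pairs with
every character to a natural number (`exists_frob_eq_inducedFrob`), and this survives a twist by the
sign.

It remains that Schur functions are irreducible characters. The Jacobi--Trudi determinant makes
`s_λ` an integral combination of permutation characters, and the bialternant formula gives it norm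
one, so it is irreducible up to sign. The sign is fixed by evaluating at `1, 2, 4, …`, where `s_λ`
is a positive ratio of Vandermonde products. -/

theorem parts_eq_add_subtypePerm {X : Type*} [Fintype X] [DecidableEq X] (σ : Perm X) (q : X → Prop)
    [DecidablePred q] (hq : ∀ x, q (σ x) ↔ q x) :
    σ.partition.parts = (σ.subtypePerm hq).partition.parts +
      (σ.subtypePerm (p := fun x => ¬ q x) fun x => not_congr (hq x)).partition.parts := by
  set a := σ.subtypePerm hq
  set b := σ.subtypePerm (p := fun x => ¬ q x) fun x => not_congr (hq x)
  -- `σ` is the product of its two restrictions extended by the identity. These are disjoint, so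
  -- cycle types add; fixed points, absent from `cycleType`, are counted separately below.
  have hab : σ = Perm.ofSubtype a * Perm.ofSubtype b := by
    ext x
    by_cases hx : q x
    · have h1 : Perm.ofSubtype b x = x := Perm.ofSubtype_apply_of_not_mem b (by simpa using hx)
      rw [Perm.mul_apply, h1, Perm.ofSubtype_apply_of_mem a hx]
      rfl
    · have h1 : Perm.ofSubtype b x = σ x := by
        rw [Perm.ofSubtype_apply_of_mem b hx]; rfl
      rw [Perm.mul_apply, h1, Perm.ofSubtype_apply_of_not_mem a (by rwa [hq])]
  have hdis : Perm.Disjoint (Perm.ofSubtype a) (Perm.ofSubtype b) := by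
    intro x
    by_cases hx : q x
    · exact Or.inr (Perm.ofSubtype_apply_of_not_mem b (by simpa using hx))
    · exact Or.inl (Perm.ofSubtype_apply_of_not_mem a hx)
  have hct : σ.cycleType = a.cycleType + b.cycleType := by
    conv_lhs => rw [hab]
    rw [hdis.cycleType_mul, Perm.cycleType_ofSubtype, Perm.cycleType_ofSubtype]
  have hcard := Fintype.card_subtype_compl q
  have hle := Fintype.card_subtype_le q
  rw [Perm.parts_partition, Perm.parts_partition, Perm.parts_partition, ← Perm.sum_cycleType,
    ← Perm.sum_cycleType, ← Perm.sum_cycleType, hct, Multiset.sum_add]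
  have h1 : a.cycleType.sum ≤ Fintype.card {x // q x} := by
    rw [Perm.sum_cycleType]; exact Finset.card_le_univ _
  have h2 : b.cycleType.sum ≤ Fintype.card {x // ¬ q x} := by
    rw [Perm.sum_cycleType]; exact Finset.card_le_univ _
  have h3 : Fintype.card X - (a.cycleType.sum + b.cycleType.sum) =
      (Fintype.card {x // q x} - a.cycleType.sum) +
      (Fintype.card {x // ¬ q x} - b.cycleType.sum) := by omega
  rw [h3, Multiset.replicate_add]
  abel

theorem parts_permCongr {X Y : Type*} [Fintype X] [DecidableEq X] [Fintype Y] [DecidableEq Y]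
    (e : X ≃ Y) (σ : Perm X) : (e.permCongr σ).partition.parts = σ.partition.parts := by
  have h : (e.permCongr σ).cycleType = σ.cycleType := by
    -- Transport along `e` is extension to the subtype cut out by the always true predicate, and
    -- `extendDomain` preserves the cycle type.
    have h1 : e.permCongr σ = σ.extendDomain (p := fun _ : Y => True)
        (e.trans (Equiv.subtypeUnivEquiv fun _ => trivial).symm) := by
      ext y
      rw [Perm.extendDomain_apply_subtype _ _ trivial]
      simp [Equiv.permCongr_apply]
    rw [h1, Perm.cycleType_extendDomain]
  rw [Perm.parts_partition, Perm.parts_partition, ← Perm.sum_cycleType, ← Perm.sum_cycleType, h,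
    Fintype.card_congr e]

theorem parts_of_sameCycle {X : Type*} [Fintype X] [DecidableEq X] (σ : Perm X) (x₀ : X)
    (h : ∀ x, σ.SameCycle x₀ x) : σ.partition.parts = {Fintype.card X} := by
  -- A one-point orbit is separated because the identity is not an `IsCycle`.
  by_cases h1 : σ x₀ = x₀
  · have hx : ∀ x, x = x₀ := by
      intro x
      obtain ⟨k, hk⟩ := h x
      rw [← hk, Perm.zpow_apply_eq_self_of_apply_eq_self h1]
    have hσ : σ = 1 := by
      ext x; rw [hx x, h1]; rfl
    have hc : Fintype.card X = 1 := Fintype.card_eq_one_iff.mpr ⟨x₀, hx⟩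
    rw [Perm.parts_partition, hσ, Perm.cycleType_one]
    simp [hc]
  · have hc : σ.IsCycle := ⟨x₀, h1, fun y _ => h y⟩
    have hs : σ.support = Finset.univ := by
      ext x
      simp only [Perm.mem_support, Finset.mem_univ, iff_true]
      intro hx
      exact h1 ((h x).apply_eq_self_iff.mpr hx)
    rw [Perm.parts_partition, hc.cycleType, hs]
    simp

section Trace

variable {A Y : Type*} [CommRing A] [Fintype Y] [DecidableEq Y]

/-- Transfer matrices: summing out the interior vertices of a walk multiplies copies of the matrix.
The kernel `K` on the endpoints is arbitrary so that the induction can absorb the last step of the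
walk into it. -/
theorem sum_path (t : Y → Y → A) (m : ℕ) : ∀ K : Y → Y → A,
    ∑ c : Fin (m + 1) → Y, (∏ i : Fin m, t (c i.castSucc) (c i.succ)) * K (c 0) (c (Fin.last m)) =
      ∑ a, ∑ b, (Matrix.of t ^ m) a b * K a b := by
  induction m with
  | zero =>
    intro K
    rw [← (Equiv.funUnique (Fin 1) Y).symm.sum_comp]
    simp [Matrix.one_apply, ite_mul]
  | succ m ih =>
    intro K
    rw [← (Fin.snocEquiv (fun _ : Fin (m + 1 + 1) => Y)).sum_comp, Fintype.sum_prod_type_right]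
    have h1 : ∀ c : Fin (m + 1) → Y, ∑ y : Y,
        (∏ i : Fin (m + 1), t ((Fin.snocEquiv (fun _ : Fin (m + 1 + 1) => Y)) (y, c) i.castSucc)
          ((Fin.snocEquiv (fun _ : Fin (m + 1 + 1) => Y)) (y, c) i.succ)) *
          K ((Fin.snocEquiv (fun _ : Fin (m + 1 + 1) => Y)) (y, c) 0)
            ((Fin.snocEquiv (fun _ : Fin (m + 1 + 1) => Y)) (y, c) (Fin.last (m + 1))) =
        (∏ i : Fin m, t (c i.castSucc) (c i.succ)) *
          (∑ y, t (c (Fin.last m)) y * K (c 0) y) := by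
      intro c
      simp only [Finset.mul_sum]
      refine Finset.sum_congr rfl fun y _ => ?_
      simp only [Fin.snocEquiv, Equiv.coe_fn_mk]
      rw [Fin.prod_univ_castSucc]
      have h0 : (Fin.snoc c y : Fin (m + 1 + 1) → Y) 0 = c 0 := by
        rw [← Fin.castSucc_zero, Fin.snoc_castSucc (α := fun _ => Y)]
      have h2 : ∀ i : Fin m, (Fin.snoc c y : Fin (m + 1 + 1) → Y) i.castSucc.succ = c i.succ := by
        intro i
        rw [Fin.succ_castSucc, Fin.snoc_castSucc (α := fun _ => Y)]
      have h3 : (Fin.snoc c y : Fin (m + 1 + 1) → Y) (Fin.last m).succ = y := by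
        rw [Fin.succ_last, Fin.snoc_last (α := fun _ => Y)]
      simp only [h0, h2, h3, Fin.snoc_castSucc (α := fun _ => Y), Fin.snoc_last (α := fun _ => Y)]
      ring
    rw [Finset.sum_congr rfl fun c _ => h1 c, ih fun a b => ∑ y, t b y * K a y]
    refine Finset.sum_congr rfl fun a _ => ?_
    simp only [pow_succ, Matrix.mul_apply, Matrix.of_apply, Finset.mul_sum, Finset.sum_mul]
    rw [Finset.sum_comm]
    exact Finset.sum_congr rfl fun y _ => Finset.sum_congr rfl fun b _ => by ring

/-- A colouring of a single cycle is a closed walk: the kernel of `sum_path` is taken to be the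
arrow that closes it. -/
theorem sum_finRotate (t : Y → Y → A) (m : ℕ) :
    ∑ c : Fin (m + 1) → Y, ∏ i, t (c i) (c (finRotate (m + 1) i)) = (Matrix.of t ^ (m + 1)).trace := by
  have h := sum_path t m fun a b => t b a
  simp only [pow_succ, Matrix.trace, Matrix.diag_apply, Matrix.mul_apply, Matrix.of_apply]
  rw [← h]
  refine Finset.sum_congr rfl fun c _ => ?_
  rw [Fin.prod_univ_castSucc]
  simp

omit [DecidableEq Y] in
theorem sum_perm_congr {X X' : Type*} [Fintype X] [DecidableEq X] [Fintype X'] [DecidableEq X']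
    (e : X ≃ X') (σ : Perm X)
    (t : Y → Y → A) :
    ∑ c : X' → Y, ∏ x, t (c x) (c (e.permCongr σ x)) = ∑ c : X → Y, ∏ x, t (c x) (c (σ x)) := by
  rw [← (Equiv.arrowCongr e (Equiv.refl Y)).sum_comp]
  refine Finset.sum_congr rfl fun c _ => ?_
  rw [← e.prod_comp]
  simp [Equiv.permCongr_apply, Equiv.arrowCongr]

theorem parts_finRotate (m : ℕ) : (finRotate (m + 1)).partition.parts = {m + 1} := by
  cases m with
  | zero =>
    rw [Perm.parts_partition, Subsingleton.elim (α := Perm (Fin 1)) (finRotate (0 + 1)) 1]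
    simp
  | succ m =>
    rw [Perm.parts_partition, cycleType_finRotate, support_finRotate]
    simp

/-- The sum over all colourings of the product of the entries of `t` along the arrows of `σ` is
the product over the cycles of `σ` of the traces of the powers of `T`. -/
theorem sum_prod_perm (t : Y → Y → A) : ∀ (n : ℕ) {X : Type*} [Fintype X] [DecidableEq X]
    (_ : Fintype.card X = n) (σ : Perm X),
    ∑ c : X → Y, ∏ x, t (c x) (c (σ x)) =
      (σ.partition.parts.map fun k => (Matrix.of t ^ k).trace).prod := by
  intro n
  induction n using Nat.strong_induction_on with
  | _ n ih =>
  intro X _ _ hX σ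
  by_cases hne : IsEmpty X
  · rw [Perm.parts_partition, Subsingleton.elim σ 1, Perm.cycleType_one]
    simp
  rw [not_isEmpty_iff] at hne
  obtain ⟨x₀⟩ := hne
  by_cases htr : ∀ x, σ.SameCycle x₀ x
  · obtain ⟨m, hm⟩ : ∃ m, Fintype.card X = m + 1 :=
      ⟨Fintype.card X - 1, by have := Fintype.card_pos_iff.mpr ⟨x₀⟩; omega⟩
    have hp := parts_of_sameCycle σ x₀ htr
    let e : X ≃ Fin (m + 1) := Fintype.equivFinOfCardEq hm
    have hconj : IsConj (finRotate (m + 1)) (e.permCongr σ) := by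
      rw [Perm.partition_eq_of_isConj]
      ext1
      rw [parts_finRotate, parts_permCongr, hp, hm]
    -- A transitive `σ` is conjugate to the standard rotation, and the sum over colourings is
    -- invariant under relabelling the points.
    obtain ⟨g, hg⟩ := isConj_iff.mp hconj
    rw [hp, Multiset.map_singleton, Multiset.prod_singleton, hm, ← sum_finRotate,
      ← sum_perm_congr e σ t, ← hg,
      ← sum_perm_congr g (finRotate (m + 1)) t]
    rfl
  · push Not at htr
    obtain ⟨x₁, hx₁⟩ := htr
    -- Otherwise the cycle through `x₀` and its complement are both invariant and strictly smaller,
    -- and a colouring of `X` is a pair of colourings of the two.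
    have hq : ∀ x, σ.SameCycle x₀ (σ x) ↔ σ.SameCycle x₀ x := fun x => Perm.sameCycle_apply_right
    rw [parts_eq_add_subtypePerm σ (fun x => σ.SameCycle x₀ x) hq, Multiset.map_add,
      Multiset.prod_add]
    have hc := Fintype.card_subtype_compl fun x => σ.SameCycle x₀ x
    have hl1 : Fintype.card {x // σ.SameCycle x₀ x} < Fintype.card X :=
      Fintype.card_subtype_lt hx₁
    have hl2 : Fintype.card {x // ¬ σ.SameCycle x₀ x} < Fintype.card X :=
      Fintype.card_subtype_lt (x := x₀) (by simp [Perm.SameCycle.refl])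
    rw [← ih _ (hX ▸ hl1) rfl, ← ih _ (hX ▸ hl2) rfl]
    rw [← (Equiv.piEquivPiSubtypeProd (fun x => σ.SameCycle x₀ x) fun _ => Y).symm.sum_comp,
      Fintype.sum_prod_type, Finset.sum_mul_sum]
    refine Finset.sum_congr rfl fun c₁ _ => Finset.sum_congr rfl fun c₂ _ => ?_
    rw [← Fintype.prod_subtype_mul_prod_subtype fun x => σ.SameCycle x₀ x]
    congr 1
    · refine Finset.prod_congr rfl fun x _ => ?_
      have h1 := x.2
      have h2 := (hq x).mpr x.2
      simp only [Equiv.piEquivPiSubtypeProd, Equiv.coe_fn_symm_mk, dif_pos h1, dif_pos h2]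
      rfl
    · refine Finset.prod_congr rfl fun x _ => ?_
      have h1 := x.2
      have h2 := (not_congr (hq x)).mpr x.2
      simp only [Equiv.piEquivPiSubtypeProd, Equiv.coe_fn_symm_mk, dif_neg h1, dif_neg h2]
      rfl

/-- With a diagonal matrix in `sum_prod_perm`, only colourings constant along every arrow survive
and the traces are power sums. This reads `p` of a cycle type as a sum over fixed words. -/
theorem sum_fixed_colourings {X : Type*} [Fintype X] [DecidableEq X] (σ : Perm X) (a : Y → A) :
    ∑ c : X → Y, (if ∀ x, c (σ x) = c x then ∏ x, a (c x) else 0) =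
      (σ.partition.parts.map fun k => ∑ y, a y ^ k).prod := by
  have h := sum_prod_perm (fun u v => if u = v then a u else 0) _ rfl σ
  have hd : Matrix.of (fun u v => if u = v then a u else 0) = Matrix.diagonal a := rfl
  rw [hd] at h
  simp only [Matrix.diagonal_pow, Matrix.trace_diagonal, Pi.pow_apply] at h
  rw [← h]
  refine Finset.sum_congr rfl fun c _ => ?_
  split_ifs with hc
  · exact Finset.prod_congr rfl fun x _ => by rw [hc, if_pos rfl]
  · push Not at hc
    obtain ⟨x, hx⟩ := hc
    exact (Finset.prod_eq_zero (Finset.mem_univ x) (if_neg (Ne.symm hx))).symm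

end Trace

/-! ### Sums over the symmetric group and sums over partitions -/

theorem zee_pos {n : ℕ} (lam : n.Partition) : 0 < zee lam := by
  refine Finset.prod_pos fun i hi => ?_
  have := lam.parts_pos (Multiset.mem_toFinset.mp hi)
  positivity

theorem zee_ne_zero {n : ℕ} (lam : n.Partition) : (zee lam : ℂ) ≠ 0 :=
  Nat.cast_ne_zero.mpr (zee_pos lam).ne'

/-- A conjugacy class has `n! / z_λ` elements. As `cycleType` omits fixed points, the parts equal to
`1` are split off; their contribution `1 ^ r * r!` to `zee` is the factorial in
`Perm.card_of_cycleType_mul_eq`. -/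
theorem card_filter_parts_mul_zee {X : Type*} [Fintype X] [DecidableEq X] {n : ℕ}
    (hX : Fintype.card X = n) (lam : n.Partition) :
    (Finset.univ.filter fun σ : Perm X => σ.partition.parts = lam.parts).card * zee lam =
      n.factorial := by
  set m := lam.parts.filter (2 ≤ ·) with hm
  set r := lam.parts.count 1 with hr
  have hsplit : lam.parts = m + Multiset.replicate r 1 := by
    ext i
    rw [Multiset.count_add, hm, Multiset.count_filter, Multiset.count_replicate]
    rcases Nat.lt_or_ge i 2 with hi | hi
    · interval_cases i
      · have : (0 : ℕ) ∉ lam.parts := fun h => absurd (lam.parts_pos h) (lt_irrefl 0)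
        simp [Multiset.count_eq_zero_of_notMem this]
      · simp [hr]
    · rw [if_pos hi, if_neg (by omega), add_zero]
  have hsum : m.sum + r = n := by
    rw [← lam.parts_sum, hsplit]; simp
  have hiff : ∀ σ : Perm X, σ.partition.parts = lam.parts ↔ σ.cycleType = m := by
    intro σ
    constructor
    · intro h
      rw [← Perm.filter_parts_partition_eq_cycleType, h]
    · intro h
      rw [Perm.parts_partition, ← Perm.sum_cycleType, h, hX, hsplit]
      congr 2
      omega
  have hz : zee lam = (Fintype.card X - m.sum).factorial * m.prod *
      ∏ i ∈ m.toFinset, (m.count i).factorial := by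
    have hp : lam.parts.prod = m.prod := by rw [hsplit]; simp
    rw [zee, Finset.prod_mul_distrib, ← Finset.prod_multiset_count, hp]
    have h1 : ∏ i ∈ lam.parts.toFinset, (lam.parts.count i).factorial =
        r.factorial * ∏ i ∈ m.toFinset, (m.count i).factorial := by
      have hsub : lam.parts.toFinset ⊆ insert 1 m.toFinset := by
        intro i hi
        rw [Multiset.mem_toFinset, hsplit, Multiset.mem_add] at hi
        rw [Finset.mem_insert, Multiset.mem_toFinset]
        rcases hi with hi | hi
        · exact Or.inr hi
        · exact Or.inl (Multiset.eq_of_mem_replicate hi)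
      rw [Finset.prod_subset hsub, Finset.prod_insert]
      · congr 1
        refine Finset.prod_congr rfl fun i hi => ?_
        rw [Multiset.mem_toFinset, hm, Multiset.mem_filter] at hi
        rw [hm, Multiset.count_filter_of_pos hi.2]
      · simp [hm]
      · intro i _ hi
        rw [Multiset.mem_toFinset] at hi
        rw [Multiset.count_eq_zero_of_notMem hi, Nat.factorial_zero]
    rw [h1, hX, show n - m.sum = r by omega]
    ring
  rw [Finset.filter_congr fun σ _ => hiff σ, hz, Perm.card_of_cycleType_mul_eq, if_pos, hX]
  refine ⟨by omega, fun a ha => ?_⟩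
  rw [hm, Multiset.mem_filter] at ha
  exact ha.2

/-- The cycle type of a permutation of an `n`-element set, as a partition of `n`. -/
def cyclePartition {X : Type*} [Fintype X] [DecidableEq X] {n : ℕ} (hX : Fintype.card X = n)
    (σ : Perm X) : n.Partition :=
  ⟨σ.partition.parts, σ.partition.parts_pos, σ.partition.parts_sum.trans hX⟩

theorem sum_perm_eq_sum_partition {X : Type*} [Fintype X] [DecidableEq X] {n : ℕ}
    (hX : Fintype.card X = n) {M : Type*} [AddCommGroup M] [Module ℂ M] (F : n.Partition → M) :
    ∑ σ : Perm X, F (cyclePartition hX σ) =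
      (n.factorial : ℂ) • ∑ lam : n.Partition, ((zee lam : ℂ)⁻¹) • F lam := by
  rw [← Finset.sum_fiberwise Finset.univ (cyclePartition hX), Finset.smul_sum]
  refine Finset.sum_congr rfl fun lam _ => ?_
  have hf : (Finset.univ.filter fun σ : Perm X => cyclePartition hX σ = lam) =
      Finset.univ.filter fun σ : Perm X => σ.partition.parts = lam.parts :=
    Finset.filter_congr fun σ _ => Nat.Partition.ext_iff
  have h := card_filter_parts_mul_zee hX lam
  rw [Finset.sum_congr rfl fun σ hσ => by rw [(Finset.mem_filter.mp hσ).2], Finset.sum_const, hf,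
    ← h, smul_smul, Nat.cast_mul, mul_assoc, mul_inv_cancel₀ (zee_ne_zero lam), mul_one,
    Nat.cast_smul_eq_nsmul]

/-! ### Complete homogeneous symmetric functions -/

section Complete

variable {A Y : Type*} [CommRing A] [Fintype Y]

theorem mem_piAntidiag_univ {n : ℕ} {f : Y → ℕ} :
    f ∈ Finset.piAntidiag (Finset.univ : Finset Y) n ↔ ∑ y, f y = n := by
  simp [Finset.mem_piAntidiag]

/-- The complete homogeneous symmetric function of the alphabet `a`. -/
def complete (a : Y → A) (n : ℕ) : A := ∑ f ∈ Finset.piAntidiag Finset.univ n, ∏ y, a y ^ f y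

/-- The coefficient of `X ^ f` in `(∑ X_y) ^ n` is computed twice: by expanding the power as a
product indexed by `X`, and by the multinomial theorem. -/
theorem card_colourings (n : ℕ) (f : Y → ℕ) (hf : ∑ y, f y = n) {X : Type*} [Fintype X]
    [DecidableEq X] (hX : Fintype.card X = n) :
    (Finset.univ.filter fun c : X → Y => ∀ y, Fintype.card {x // c x = y} = f y).card =
      Nat.multinomial Finset.univ f := by
  have h1 : (∑ y, (MvPolynomial.X y : MvPolynomial Y ℕ)) ^ n =
      ∑ c : X → Y, MvPolynomial.monomial
        (Finsupp.equivFunOnFinite.symm fun y => Fintype.card {x // c x = y}) 1 := by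
    rw [← hX, ← Finset.card_univ, ← Finset.prod_const, Finset.prod_univ_sum]
    rw [Fintype.piFinset_univ]
    refine Finset.sum_congr rfl fun c _ => ?_
    rw [MvPolynomial.monomial_eq, map_one, one_mul,
      Finsupp.prod_fintype _ _ fun i => pow_zero _,
      ← Finset.prod_fiberwise Finset.univ c]
    refine Finset.prod_congr rfl fun y _ => ?_
    rw [Finset.prod_congr rfl fun x hx => by rw [(Finset.mem_filter.mp hx).2], Finset.prod_const,
      Finsupp.equivFunOnFinite_symm_apply_apply, Fintype.card_subtype]
  have h2 := Finset.sum_pow_eq_sum_piAntidiag Finset.univ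
    (fun y => (MvPolynomial.X y : MvPolynomial Y ℕ)) n
  rw [h1] at h2
  have h3 := congrArg (MvPolynomial.coeff (Finsupp.equivFunOnFinite.symm f)) h2
  rw [MvPolynomial.coeff_sum, MvPolynomial.coeff_sum] at h3
  simp only [MvPolynomial.coeff_monomial] at h3
  rw [Finset.card_filter]
  convert h3 using 1
  · refine Finset.sum_congr rfl fun c _ => ?_
    congr 1
    rw [EmbeddingLike.apply_eq_iff_eq, funext_iff]
  · have h4 : ∀ g : Y → ℕ, (∏ y, (MvPolynomial.X y : MvPolynomial Y ℕ) ^ g y) =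
        MvPolynomial.monomial (Finsupp.equivFunOnFinite.symm g) 1 := by
      intro g
      rw [MvPolynomial.monomial_eq, map_one, one_mul, Finsupp.prod_fintype _ _ fun i => pow_zero _]
      rfl
    rw [Finset.sum_eq_single f]
    · rw [h4, ← map_natCast (MvPolynomial.C (σ := Y) (R := ℕ)), MvPolynomial.coeff_C_mul,
        MvPolynomial.coeff_monomial, if_pos rfl, mul_one, Nat.cast_id]
    · intro g _ hg
      rw [h4, ← map_natCast (MvPolynomial.C (σ := Y) (R := ℕ)), MvPolynomial.coeff_C_mul,
        MvPolynomial.coeff_monomial, if_neg (fun h => hg (Finsupp.equivFunOnFinite.symm.injective h)),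
        mul_zero]
    · intro h
      exact absurd (Finset.mem_piAntidiag.mpr ⟨hf, fun i _ => Finset.mem_univ i⟩) h

/-- Double counting of the pairs `(σ, c)` with `c ∘ σ = c`. A colouring of content `f` has
stabiliser of order `∏ f_y!`, and there are `n! / ∏ f_y!` such colourings, so every monomial of
degree `n` receives the coefficient `n!`. -/
theorem sum_perm_psum {X : Type*} [Fintype X] [DecidableEq X] {n : ℕ} (hX : Fintype.card X = n)
    (a : Y → A) :
    ∑ σ : Perm X, (σ.partition.parts.map fun k => ∑ y, a y ^ k).prod =
      (n.factorial : A) * complete a n := by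
  have h1 : ∀ c : X → Y, ∑ σ : Perm X, (if ∀ x, c (σ x) = c x then ∏ x, a (c x) else 0) =
      ((∏ y, (Fintype.card {x // c x = y}).factorial : ℕ) : A) *
        ∏ y, a y ^ Fintype.card {x // c x = y} := by
    intro c
    have h2 : (Finset.univ.filter fun σ : Perm X => ∀ x, c (σ x) = c x).card =
        ∏ y, (Fintype.card {x // c x = y}).factorial := by
      have h3 := DomMulAct.stabilizer_card c
      rw [Fintype.card_subtype] at h3
      convert h3 using 2
      exact Finset.filter_congr fun σ _ => by rw [funext_iff]; rfl
    rw [← Finset.sum_filter, Finset.sum_const, h2, nsmul_eq_mul]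
    congr 1
    rw [← Finset.prod_fiberwise Finset.univ c]
    refine Finset.prod_congr rfl fun y _ => ?_
    rw [Finset.prod_congr rfl fun x hx => by rw [(Finset.mem_filter.mp hx).2], Finset.prod_const,
      Fintype.card_subtype]
  rw [Finset.sum_congr rfl fun σ _ => (sum_fixed_colourings σ a).symm, Finset.sum_comm,
    Finset.sum_congr rfl fun c _ => h1 c, complete, Finset.mul_sum]
  have hmaps : ∀ c ∈ (Finset.univ : Finset (X → Y)),
      (fun y => Fintype.card {x // c x = y}) ∈ Finset.piAntidiag (Finset.univ : Finset Y) n := by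
    intro c _
    refine Finset.mem_piAntidiag.mpr ⟨?_, fun i _ => Finset.mem_univ i⟩
    rw [← Fintype.card_sigma, ← hX]
    exact Fintype.card_congr (Equiv.sigmaFiberEquiv c)
  rw [← Finset.sum_fiberwise_of_maps_to hmaps]
  refine Finset.sum_congr rfl fun f hf => ?_
  have hfs : ∑ y, f y = n := (Finset.mem_piAntidiag.mp hf).1
  have h3 : ∀ c ∈ Finset.univ.filter
      (fun c : X → Y => (fun y => Fintype.card {x // c x = y}) = f),
      ((∏ y, (Fintype.card {x // c x = y}).factorial : ℕ) : A) *
        ∏ y, a y ^ Fintype.card {x // c x = y} =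
      ((∏ y, (f y).factorial : ℕ) : A) * ∏ y, a y ^ f y := by
    intro c hc
    have := (Finset.mem_filter.mp hc).2
    simp only [← this]
  rw [Finset.sum_congr rfl h3, Finset.sum_const, Finset.filter_congr fun c _ => funext_iff,
    card_colourings n f hfs hX, nsmul_eq_mul, ← mul_assoc, ← Nat.cast_mul, mul_comm (Nat.multinomial _ _),
    Nat.multinomial_spec, hfs]

theorem hsymm_eq_complete [inst : DecidableEq Y] (k : ℕ) :
    MvPolynomial.hsymm Y A k = complete (fun y => MvPolynomial.X y) k := by
  obtain rfl : inst = fun a b => Classical.propDecidable (a = b) := Subsingleton.elim _ _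
  rw [complete, ← Finset.map_sym_eq_piAntidiag, Finset.sum_map, MvPolynomial.hsymm, Finset.sym_univ]
  refine Finset.sum_congr rfl fun s _ => ?_
  rw [Finset.prod_multiset_map_count]
  refine Finset.prod_subset (Finset.subset_univ _) fun y _ hy => ?_
  rw [Multiset.mem_toFinset] at hy
  rw [Multiset.count_eq_zero_of_notMem hy, pow_zero]

/-- The Cauchy identity: the coefficient of `y ^ α` in `h_n` of the alphabet `x_j y_i`. -/
theorem coeff_complete_mul {I : Type*} [Fintype I] (x : Y → A) (n : ℕ) (α : I →₀ ℕ)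
    (hα : ∑ i, α i = n) :
    (complete (fun ij : I × Y => MvPolynomial.C (x ij.2) * MvPolynomial.X ij.1) n).coeff α =
      ∏ i, complete x (α i) := by
  have h1 : ∀ F : I × Y → ℕ,
      (∏ ij : I × Y, (MvPolynomial.C (x ij.2) * MvPolynomial.X ij.1) ^ F ij).coeff α =
      if ∀ i, ∑ j, F (i, j) = α i then ∏ i, ∏ j, x j ^ F (i, j) else 0 := by
    intro F
    -- An exponent on pairs `(i, j)` is a matrix: its row sums give the monomial in `y`, and the
    -- product of the rows gives the coefficient.
    have h2 : (∏ ij : I × Y, (MvPolynomial.C (x ij.2) * MvPolynomial.X ij.1) ^ F ij) =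
        MvPolynomial.monomial (Finsupp.equivFunOnFinite.symm fun i => ∑ j, F (i, j))
          (∏ i, ∏ j, x j ^ F (i, j)) := by
      rw [MvPolynomial.monomial_eq, Finsupp.prod_fintype _ _ fun i => pow_zero _,
        Fintype.prod_prod_type, map_prod, ← Finset.prod_mul_distrib]
      refine Finset.prod_congr rfl fun i _ => ?_
      rw [map_prod, Finsupp.equivFunOnFinite_symm_apply_apply, ← Finset.prod_pow_eq_pow_sum,
        ← Finset.prod_mul_distrib]
      exact Finset.prod_congr rfl fun j _ => by rw [mul_pow, map_pow]
    rw [h2, MvPolynomial.coeff_monomial]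
    congr 1
    rw [eq_iff_iff, DFunLike.ext_iff]
    rfl
  rw [complete, MvPolynomial.coeff_sum, Finset.sum_congr rfl fun F _ => h1 F, ← Finset.sum_filter]
  simp only [complete]
  rw [Finset.prod_univ_sum]
  refine Finset.sum_bij' (fun F _ i j => F (i, j)) (fun F _ ij => F ij.1 ij.2) ?_ ?_ ?_ ?_ ?_
  · intro F hF
    rw [Fintype.mem_piFinset]
    intro i
    exact Finset.mem_piAntidiag.mpr ⟨(Finset.mem_filter.mp hF).2 i, fun j _ => Finset.mem_univ j⟩
  · intro F hF
    rw [Fintype.mem_piFinset] at hF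
    have hF' : ∀ i, ∑ j, F i j = α i := fun i => (Finset.mem_piAntidiag.mp (hF i)).1
    refine Finset.mem_filter.mpr ⟨?_, hF'⟩
    rw [mem_piAntidiag_univ, Fintype.sum_prod_type, ← hα]
    exact Finset.sum_congr rfl fun i _ => hF' i
  · intro F _; rfl
  · intro F _; rfl
  · intro F _; rfl

end Complete

theorem complete_eq_sum_partition {A Y : Type*} [CommRing A] [Algebra ℂ A] [Fintype Y] (a : Y → A)
    (n : ℕ) :
    complete a n = ∑ lam : n.Partition,
      ((zee lam : ℂ)⁻¹) • (lam.parts.map fun k => ∑ y, a y ^ k).prod := by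
  have h1 := sum_perm_psum (Fintype.card_fin n) a
  have h2 := sum_perm_eq_sum_partition (Fintype.card_fin n)
    (fun lam => (lam.parts.map fun k => ∑ y, a y ^ k).prod)
  have h3 : ((n.factorial : ℂ)) ≠ 0 := Nat.cast_ne_zero.mpr n.factorial_ne_zero
  simp only [cyclePartition] at h2
  rw [h1, ← nsmul_eq_mul, ← Nat.cast_smul_eq_nsmul ℂ] at h2
  exact smul_right_injective A h3 h2

/-! ### Class functions and their Frobenius characteristic -/

section ClassFunctions

variable {n : ℕ}

/-- The Frobenius characteristic of a class function of the symmetric group. -/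
def frob (χ : n.Partition → ℂ) : SymFn := ∑ lam, (χ lam * (zee lam : ℂ)⁻¹) • p lam

/-- The standard bilinear form on class functions of the symmetric group. -/
def pairing (χ ψ : n.Partition → ℂ) : ℂ := ∑ lam, χ lam * ψ lam * (zee lam : ℂ)⁻¹

theorem frob_apply (χ : n.Partition → ℂ) (N : ℕ) :
    frob χ N = ∑ lam, (χ lam * (zee lam : ℂ)⁻¹) • p lam N := by
  simp [frob, Finset.sum_apply]

theorem frob_add (χ ψ : n.Partition → ℂ) : frob (χ + ψ) = frob χ + frob ψ := by
  simp [frob, add_mul, add_smul, Finset.sum_add_distrib]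

theorem frob_smul (c : ℂ) (χ : n.Partition → ℂ) : frob (c • χ) = c • frob χ := by
  simp [frob, Finset.smul_sum, smul_smul, mul_assoc]

/-- The Frobenius characteristic as a linear map. -/
def frobLin (n : ℕ) : (n.Partition → ℂ) →ₗ[ℂ] SymFn where
  toFun := frob
  map_add' := frob_add
  map_smul' := frob_smul

/-- The standard bilinear form on class functions as a linear map of its second argument. -/
def pairingLin (χ : n.Partition → ℂ) : (n.Partition → ℂ) →ₗ[ℂ] ℂ where
  toFun := pairing χ
  map_add' ψ ψ' := by simp [pairing, mul_add, add_mul, Finset.sum_add_distrib]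
  map_smul' c ψ := by
    simp only [pairing, Pi.smul_apply, smul_eq_mul, Finset.mul_sum, RingHom.id_apply]
    exact Finset.sum_congr rfl fun _ _ => by ring

theorem pairing_comm (χ ψ : n.Partition → ℂ) : pairing χ ψ = pairing ψ χ :=
  Finset.sum_congr rfl fun _ _ => by ring

/-- The character of the permutation module of content `α`: the coefficient of `x ^ α` in the power
sums. -/
def contentChar (α : Fin n →₀ ℕ) (lam : n.Partition) : ℂ := (p lam n).coeff α

/-- The duality between `h_α` and monomials: by linearity, pairing with the permutation character
reads off the coefficient of `x ^ α`. -/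
theorem pairing_contentChar (α : Fin n →₀ ℕ) (χ : n.Partition → ℂ) :
    pairing (contentChar α) χ = (frob χ n).coeff α := by
  rw [frob_apply, MvPolynomial.coeff_sum]
  refine Finset.sum_congr rfl fun lam _ => ?_
  rw [MvPolynomial.coeff_smul, contentChar, smul_eq_mul]
  ring

/-- Power sums of the alphabet `x_j y_i` factor as `p_k(x) p_k(y)`, so `h_n` of it is `∑ z_λ⁻¹
p_λ(x) p_λ(y)`. The coefficient of `y ^ α` in this is the left side, and by `coeff_complete_mul` it
is also `∏ h_{α_i}(x)`. -/
theorem frob_contentChar (α : Fin n →₀ ℕ) (hα : ∑ i, α i = n) :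
    frob (contentChar α) = ∏ i, h (α i) := by
  funext N
  rw [Finset.prod_apply, frob_apply]
  have h1 := coeff_complete_mul (fun j : Fin N => (MvPolynomial.X j : MvPolynomial (Fin N) ℂ)) n α hα
  rw [complete_eq_sum_partition, MvPolynomial.coeff_sum] at h1
  simp only [h, hsymm_eq_complete]
  rw [← h1]
  refine Finset.sum_congr rfl fun lam _ => ?_
  have h2 : (lam.parts.map fun k => ∑ y : Fin n × Fin N,
      (MvPolynomial.C (MvPolynomial.X y.2) * MvPolynomial.X y.1 :
        MvPolynomial (Fin n) (MvPolynomial (Fin N) ℂ)) ^ k).prod =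
      MvPolynomial.C (p lam N) * MvPolynomial.map MvPolynomial.C (p lam n) := by
    rw [p, p, MvPolynomial.psumPart, MvPolynomial.psumPart, map_multiset_prod, map_multiset_prod,
      Multiset.map_map, Multiset.map_map, ← Multiset.prod_map_mul]
    congr 1
    refine Multiset.map_congr rfl fun k _ => ?_
    simp only [Function.comp_apply, MvPolynomial.psum, map_sum, map_pow, MvPolynomial.map_X]
    rw [Finset.sum_mul_sum, Finset.sum_comm, Fintype.sum_prod_type]
    refine Finset.sum_congr rfl fun i _ => Finset.sum_congr rfl fun j _ => ?_
    rw [mul_pow]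
  rw [h2, MvPolynomial.coeff_smul, MvPolynomial.coeff_C_mul, MvPolynomial.coeff_map, contentChar,
    mul_comm (MvPolynomial.coeff α (p lam n)), mul_comm (p lam N), ← MvPolynomial.smul_eq_C_mul, smul_smul]

end ClassFunctions

/-! ### Generating function of the complete symmetric functions -/

section Generating

variable {A Y : Type*} [CommRing A] [Fintype Y]

theorem mk_complete (a : Y → A) :
    PowerSeries.mk (complete a) = ∏ y, PowerSeries.mk fun m => a y ^ m := by
  ext m
  rw [PowerSeries.coeff_mk, PowerSeries.coeff_prod, complete]
  refine Finset.sum_bij' (fun f _ => Finsupp.equivFunOnFinite.symm f) (fun f _ => f)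
    ?_ ?_ ?_ ?_ ?_
  · intro f hf
    rw [Finset.mem_finsuppAntidiag]
    exact ⟨mem_piAntidiag_univ.mp hf, Finset.subset_univ _⟩
  · intro f hf
    rw [mem_piAntidiag_univ]
    exact (Finset.mem_finsuppAntidiag.mp hf).1
  · intro f _; rfl
  · intro f _; ext; rfl
  · intro f _
    exact Finset.prod_congr rfl fun y _ => by rw [PowerSeries.coeff_mk]; rfl

theorem mk_pow_mul_one_sub (a : A) :
    (PowerSeries.mk fun m => a ^ m) * (1 - PowerSeries.C a * PowerSeries.X) = 1 := by
  ext m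
  rw [mul_sub, mul_one, ← mul_assoc, mul_comm _ (PowerSeries.C a), mul_assoc, map_sub,
    PowerSeries.coeff_C_mul, PowerSeries.coeff_mk]
  cases m with
  | zero => simp
  | succ m =>
    rw [PowerSeries.coeff_succ_mul_X, PowerSeries.coeff_mk, PowerSeries.coeff_one, if_neg (by omega)]
    ring

omit [Fintype Y] in
theorem coeff_prod_one_sub_eq_zero (a : Y → A) (s : Finset Y) : ∀ m, s.card < m →
    PowerSeries.coeff m (∏ y ∈ s, (1 - PowerSeries.C (a y) * PowerSeries.X)) = 0 := by
  induction s using Finset.induction_on with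
  | empty =>
    intro m hm
    rw [Finset.prod_empty, PowerSeries.coeff_one, if_neg]
    simp at hm; omega
  | insert y s hy ih =>
    intro m hm
    rw [Finset.card_insert_of_notMem hy] at hm
    obtain ⟨m, rfl⟩ : ∃ k, m = k + 1 := ⟨m - 1, by omega⟩
    rw [Finset.prod_insert hy, sub_mul, one_mul, mul_assoc, map_sub, PowerSeries.coeff_C_mul,
      mul_comm PowerSeries.X, PowerSeries.coeff_succ_mul_X, ih _ (by omega), ih _ (by omega)]
    simp

/-- The coefficients of the product of `1 - a_y t` over all `y` other than `k`. -/
def coElem (a : Y → A) (k : Y) (v : ℕ) : A :=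
  PowerSeries.coeff v (∏ y ∈ Finset.univ.erase k, (1 - PowerSeries.C (a y) * PowerSeries.X))

/-- Multiplying `∑ h_m t ^ m = ∏ (1 - a_y t)⁻¹` by all factors `1 - a_y t` with `y ≠ k` leaves the
geometric series `(1 - a_k t)⁻¹`. -/
theorem sum_complete_mul_coElem (a : Y → A) (k : Y) (m : ℕ) :
    ∑ v ∈ Finset.range (Fintype.card Y),
      (if v ≤ m then complete a (m - v) else 0) * coElem a k v = a k ^ m := by
  have h1 : PowerSeries.mk (complete a) *
      ∏ y ∈ Finset.univ.erase k, (1 - PowerSeries.C (a y) * PowerSeries.X) =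
      PowerSeries.mk fun m => a k ^ m := by
    rw [mk_complete, ← Finset.mul_prod_erase _ _ (Finset.mem_univ k), mul_assoc,
      ← Finset.prod_mul_distrib, Finset.prod_congr rfl fun y _ => mk_pow_mul_one_sub (a y),
      Finset.prod_const_one, mul_one]
  have h2 := congrArg (PowerSeries.coeff m) h1
  rw [PowerSeries.coeff_mk, PowerSeries.coeff_mul, ← Finset.Nat.sum_antidiagonal_swap,
    Finset.Nat.sum_antidiagonal_eq_sum_range_succ_mk] at h2
  rw [← h2]
  have h0 : ∀ v, Fintype.card Y ≤ v → coElem a k v = 0 := by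
    intro v hv
    refine coeff_prod_one_sub_eq_zero a _ v ?_
    rw [Finset.card_erase_of_mem (Finset.mem_univ k), Finset.card_univ]
    have := Fintype.card_pos_iff.mpr ⟨k⟩
    omega
  -- Both ranges are truncations of one longer sum: beyond `Fintype.card Y` the factor `coElem`
  -- vanishes by degree, and beyond `m` the conditional does.
  have h3 : ∀ M, Fintype.card Y ≤ M → m + 1 ≤ M →
      (∑ v ∈ Finset.range M, (if v ≤ m then complete a (m - v) else 0) * coElem a k v =
        ∑ v ∈ Finset.range (Fintype.card Y),
          (if v ≤ m then complete a (m - v) else 0) * coElem a k v) ∧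
      (∑ v ∈ Finset.range M, (if v ≤ m then complete a (m - v) else 0) * coElem a k v =
        ∑ v ∈ Finset.range (m + 1), complete a (m - v) * coElem a k v) := by
    intro M h4 h5
    constructor
    · refine (Finset.sum_subset (Finset.range_mono h4) fun v _ hv => ?_).symm
      rw [h0 v (by simpa using hv), mul_zero]
    · rw [← Finset.sum_subset (Finset.range_mono h5) fun v _ hv => by
        rw [if_neg (by simpa using hv), zero_mul]]
      refine Finset.sum_congr rfl fun v hv => ?_
      rw [if_pos (by have := Finset.mem_range.mp hv; omega)]
  obtain ⟨h6, h7⟩ := h3 (max (Fintype.card Y) (m + 1)) (le_max_left _ _) (le_max_right _ _)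
  rw [← h6, h7]
  refine Finset.sum_congr rfl fun v _ => ?_
  simp [coElem]

end Generating

/-! ### Bialternants -/

section Bialternant

variable {n : ℕ}

/-- The alternant `det (x_j ^ {β_i})`. -/
def alternant (β : Fin n → ℕ) : MvPolynomial (Fin n) ℂ :=
  (Matrix.of fun i j : Fin n => (MvPolynomial.X j : MvPolynomial (Fin n) ℂ) ^ β i).det

/-- The staircase `(n - 1, n - 2, …, 0)`. -/
def staircase (n : ℕ) (i : Fin n) : ℕ := n - 1 - i

/-- The Jacobi--Trudi matrix in finitely many variables. -/
def jacobiTrudi (mu : Fin n → ℕ) : Matrix (Fin n) (Fin n) (MvPolynomial (Fin n) ℂ) :=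
  Matrix.of fun i j => if (i : ℕ) ≤ mu i + j then
    complete (fun k : Fin n => (MvPolynomial.X k : MvPolynomial (Fin n) ℂ)) (mu i + j - i) else 0

/-- By `sum_complete_mul_coElem`, the matrix of powers `x_k ^ (μ_i + n - 1 - i)` is the
Jacobi--Trudi matrix times a matrix independent of `μ`. Summing over `v = n - 1 - j` turns the index
`μ_i + n - 1 - i - v` into `μ_i + j - i`. -/
theorem alternant_add_staircase (mu : Fin n → ℕ) :
    alternant (fun i => mu i + staircase n i) = (jacobiTrudi mu).det *
      (Matrix.of fun j k : Fin n => coElem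
        (fun k : Fin n => (MvPolynomial.X k : MvPolynomial (Fin n) ℂ)) k (n - 1 - j)).det := by
  rw [← Matrix.det_mul, alternant]
  congr 1
  ext1 i k
  rw [Matrix.mul_apply, Matrix.of_apply, ← sum_complete_mul_coElem _ k, Fintype.card_fin,
    Finset.sum_range, ← Equiv.sum_comp Fin.revPerm]
  refine Finset.sum_congr rfl fun j _ => ?_
  simp only [jacobiTrudi, Matrix.of_apply, Fin.revPerm_apply, Fin.val_rev, staircase]
  have hi := i.2
  have hj := j.2
  congr 1
  · by_cases hc : (i : ℕ) ≤ mu i + j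
    · rw [if_pos hc, if_pos (by omega)]
      congr 1
      omega
    · rw [if_neg hc, if_neg (by omega)]
  · congr 1
    omega

/-- For `μ = 0` the Jacobi--Trudi matrix is upper unitriangular, which identifies the second factor
of `alternant_add_staircase` as the Vandermonde alternant. -/
theorem alternant_staircase :
    alternant (staircase n) =
      (Matrix.of fun j k : Fin n => coElem
        (fun k : Fin n => (MvPolynomial.X k : MvPolynomial (Fin n) ℂ)) k (n - 1 - j)).det := by
  have h1 := alternant_add_staircase (n := n) 0
  have h2 : (jacobiTrudi (n := n) 0).det = 1 := by
    rw [Matrix.det_of_isUpperTriangular]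
    · refine Finset.prod_eq_one fun i _ => ?_
      simp [jacobiTrudi, complete]
    · intro i j hij
      have : (j : ℕ) < i := hij
      exact if_neg (by simpa using this)
  rw [h2, one_mul] at h1
  rw [← h1]
  simp

theorem schur_apply (lam : n.Partition) :
    schur lam n = (jacobiTrudi fun i => rowLength lam i).det := by
  have h1 : schur lam n = Pi.evalRingHom (fun N => MvPolynomial (Fin N) ℂ) n (schur lam) := rfl
  rw [h1, schur, RingHom.map_det]
  congr 1
  ext1 i j
  simp only [RingHom.mapMatrix_apply, Matrix.map_apply, Matrix.of_apply, jacobiTrudi]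
  split_ifs with hc
  · rw [Pi.evalRingHom_apply, h, hsymm_eq_complete]
  · rfl

/-- The bialternant formula for Schur functions. -/
theorem alternant_staircase_mul_schur (lam : n.Partition) :
    alternant (staircase n) * schur lam n =
      alternant (fun i => rowLength lam i + staircase n i) := by
  rw [alternant_add_staircase, schur_apply, alternant_staircase, mul_comm]

end Bialternant

/-! ### Rows of a partition -/

section Rows

variable {n : ℕ}

theorem sortedGE_parts (lam : n.Partition) : (lam.parts.sort (fun a b => b ≤ a)).Pairwise (fun a b => b ≤ a) :=
  Multiset.pairwise_sort _ _

theorem length_sort_le (lam : n.Partition) : (lam.parts.sort (fun a b => b ≤ a)).length ≤ n := by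
  rw [Multiset.length_sort]
  have h1 : lam.parts.card • 1 ≤ lam.parts.sum :=
    Multiset.card_nsmul_le_sum fun x hx => lam.parts_pos hx
  rw [lam.parts_sum] at h1
  simpa using h1

theorem rowLength_antitone (lam : n.Partition) {i j : ℕ} (hij : i ≤ j) :
    rowLength lam j ≤ rowLength lam i := by
  rcases hij.eq_or_lt with rfl | hij
  · exact le_rfl
  unfold rowLength
  by_cases hj : j < (lam.parts.sort (fun a b => b ≤ a)).length
  · rw [List.getD_eq_getElem _ _ hj, List.getD_eq_getElem _ _ (hij.trans hj)]
    exact List.pairwise_iff_getElem.mp (sortedGE_parts lam) i j _ _ hij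
  · rw [List.getD_eq_default _ _ (by omega)]
    exact Nat.zero_le _

theorem sum_rowLength (lam : n.Partition) : ∑ i : Fin n, rowLength lam i = n := by
  have h1 : ∀ (l : List ℕ) (N : ℕ), l.length ≤ N → ∑ i ∈ Finset.range N, l.getD i 0 = l.sum := by
    intro l
    induction l with
    | nil => intro N _; simp
    | cons a l ih =>
      intro N hN
      obtain ⟨N, rfl⟩ : ∃ k, N = k + 1 := ⟨N - 1, by simp at hN; omega⟩
      rw [Finset.sum_range_succ', List.sum_cons]
      simp only [List.getD_cons_succ, List.getD_cons_zero]
      rw [ih N (by simpa using hN), add_comm]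
  have h2 := h1 _ n (length_sort_le lam)
  rw [Finset.sum_range] at h2
  unfold rowLength
  rw [h2, ← Multiset.sum_coe, Multiset.sort_eq, lam.parts_sum]

theorem rowLength_injective {lam mu : n.Partition} (h : ∀ i : Fin n, rowLength lam i = rowLength mu i) :
    lam = mu := by
  have h0 : ∀ (nu : n.Partition) (i : ℕ), n ≤ i → rowLength nu i = 0 := fun nu i hi =>
    List.getD_eq_default _ _ ((length_sort_le nu).trans hi)
  have hall : ∀ i, rowLength lam i = rowLength mu i := by
    intro i
    by_cases hi : i < n
    · exact h ⟨i, hi⟩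
    · rw [h0 _ _ (by omega), h0 _ _ (by omega)]
  -- The zero padding is harmless because parts are positive: the number of parts is recovered as
  -- the number of nonzero rows.
  have hpos : ∀ (nu : n.Partition) (i : ℕ),
      i < (nu.parts.sort (fun a b => b ≤ a)).length ↔ 0 < rowLength nu i := by
    intro nu i
    unfold rowLength
    constructor
    · intro hi
      rw [List.getD_eq_getElem _ _ hi]
      refine nu.parts_pos ?_
      rw [← Multiset.mem_sort (fun a b => b ≤ a)]
      exact List.getElem_mem hi
    · intro hi
      by_contra hc
      rw [List.getD_eq_default _ _ (by omega)] at hi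
      exact lt_irrefl _ hi
  have hlen : (lam.parts.sort (fun a b => b ≤ a)).length = (mu.parts.sort (fun a b => b ≤ a)).length := by
    have h3 : ∀ i, i < (lam.parts.sort (fun a b => b ≤ a)).length ↔
        i < (mu.parts.sort (fun a b => b ≤ a)).length := by
      intro i; rw [hpos, hpos, hall]
    exact le_antisymm (not_lt.mp fun hc => lt_irrefl _ ((h3 _).mp hc))
      (not_lt.mp fun hc => lt_irrefl _ ((h3 _).mpr hc))
  have hl : lam.parts.sort (fun a b => b ≤ a) = mu.parts.sort (fun a b => b ≤ a) := by
    refine List.ext_getElem hlen fun i hi hi' => ?_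
    have := hall i
    unfold rowLength at this
    rwa [List.getD_eq_getElem _ _ hi, List.getD_eq_getElem _ _ hi'] at this
  ext1
  rw [← Multiset.sort_eq lam.parts (fun a b => b ≤ a), hl, Multiset.sort_eq]

/-- The strictly decreasing exponents `λ_i + n - 1 - i`. -/
def shiftedRows (lam : n.Partition) (i : Fin n) : ℕ := rowLength lam i + staircase n i

theorem shiftedRows_strictAnti (lam : n.Partition) : StrictAnti (shiftedRows lam) := by
  intro i j hij
  have h1 := rowLength_antitone lam (le_of_lt hij)
  have h2 : (i : ℕ) < j := hij
  have := j.2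
  unfold shiftedRows staircase
  omega

end Rows

/-! ### The class functions of Schur functions -/

section SchurChar

variable {n : ℕ}

theorem alternant_eq_sum (β : Fin n → ℕ) : alternant β =
    ∑ σ : Perm (Fin n), ((Perm.sign σ : ℤ) : ℂ) •
      MvPolynomial.monomial (Finsupp.equivFunOnFinite.symm fun i => β (σ i)) (1 : ℂ) := by
  rw [alternant, Matrix.det_apply']
  refine Finset.sum_congr rfl fun σ _ => ?_
  rw [MvPolynomial.monomial_eq, map_one, one_mul, Finsupp.prod_fintype _ _ fun i => pow_zero _,
    MvPolynomial.smul_eq_C_mul]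
  simp

/-- A permutation carrying one strictly decreasing sequence to another is monotone, hence the
identity; so only one term of the signed sum can meet the monomial `x ^ γ`. -/
theorem coeff_alternant {β γ : Fin n → ℕ} (hβ : StrictAnti β) (hγ : StrictAnti γ) :
    (alternant β).coeff (Finsupp.equivFunOnFinite.symm γ) = if β = γ then 1 else 0 := by
  rw [alternant_eq_sum, MvPolynomial.coeff_sum]
  have h1 : ∀ σ : Perm (Fin n), (fun i => β (σ i)) = γ → σ = 1 := by
    intro σ hσ
    have hm : StrictMono σ := by
      intro i j hij
      have := hγ hij
      rw [← hσ] at this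
      exact hβ.lt_iff_gt.mp this
    have h2 : (hm.orderIsoOfSurjective σ σ.surjective) = OrderIso.refl _ := Subsingleton.elim _ _
    ext i
    have := congrArg (fun e : Fin n ≃o Fin n => ((e i : Fin n) : ℕ)) h2
    simpa using this
  rw [Finset.sum_eq_single 1]
  · rw [MvPolynomial.coeff_smul, MvPolynomial.coeff_monomial]
    simp [Finsupp.equivFunOnFinite.symm.injective.eq_iff]
  · intro σ _ hσ
    rw [MvPolynomial.coeff_smul, MvPolynomial.coeff_monomial, if_neg, smul_zero]
    intro h2
    exact hσ (h1 σ (Finsupp.equivFunOnFinite.symm.injective h2))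
  · intro h2; exact absurd (Finset.mem_univ _) h2

/-- The class function with Frobenius characteristic `s_λ`. -/
def schurChar (lam rho : n.Partition) : ℂ :=
  (alternant (staircase n) * p rho n).coeff (Finsupp.equivFunOnFinite.symm (shiftedRows lam))

theorem pairing_schurChar (lam : n.Partition) (χ : n.Partition → ℂ) :
    pairing (schurChar lam) χ = (alternant (staircase n) * frob χ n).coeff
      (Finsupp.equivFunOnFinite.symm (shiftedRows lam)) := by
  rw [frob_apply, Finset.mul_sum, MvPolynomial.coeff_sum]
  refine Finset.sum_congr rfl fun rho _ => ?_
  rw [mul_smul_comm, MvPolynomial.coeff_smul, schurChar, smul_eq_mul]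
  ring

/-- The exponent `λ_i + σ(i) - i` in the expansion of the Jacobi--Trudi determinant. -/
def trudiExponent (lam : n.Partition) (σ : Perm (Fin n)) : Fin n →₀ ℕ :=
  Finsupp.equivFunOnFinite.symm fun i => rowLength lam i + σ i - i

/-- Expanding the Vandermonde alternant leaves exponents `λ_i + (n - 1 - i) - (n - 1 - σ i) = λ_i +
σ i - i`; the condition says that none of them is negative, so that truncated subtraction is the
true one. -/
theorem coeff_alternant_mul (lam : n.Partition) (f : MvPolynomial (Fin n) ℂ) :
    (alternant (staircase n) * f).coeff (Finsupp.equivFunOnFinite.symm (shiftedRows lam)) =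
      ∑ σ : Perm (Fin n), ((Perm.sign σ : ℤ) : ℂ) *
        if ∀ i : Fin n, (i : ℕ) ≤ rowLength lam i + σ i then f.coeff (trudiExponent lam σ) else 0 := by
  rw [alternant_eq_sum, Finset.sum_mul, MvPolynomial.coeff_sum]
  refine Finset.sum_congr rfl fun σ _ => ?_
  rw [smul_mul_assoc, MvPolynomial.coeff_smul, MvPolynomial.coeff_monomial_mul', smul_eq_mul, one_mul]
  congr 1
  have h1 : ((Finsupp.equivFunOnFinite.symm fun i => staircase n (σ i)) ≤
      Finsupp.equivFunOnFinite.symm (shiftedRows lam)) ↔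
      ∀ i : Fin n, (i : ℕ) ≤ rowLength lam i + σ i := by
    rw [Finsupp.le_def]
    refine forall_congr' fun i => ?_
    simp only [Finsupp.equivFunOnFinite_symm_apply_apply, shiftedRows, staircase]
    have := i.2
    have := (σ i).2
    omega
  by_cases hc : ∀ i : Fin n, (i : ℕ) ≤ rowLength lam i + σ i
  · rw [if_pos hc, if_pos (h1.mpr hc)]
    congr 1
    ext i
    simp only [Finsupp.tsub_apply, Finsupp.equivFunOnFinite_symm_apply_apply, shiftedRows, staircase,
      trudiExponent]
    have := i.2
    have := (σ i).2
    have := hc i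
    omega
  · rw [if_neg hc, if_neg (mt h1.mp hc)]

/-- This exhibits the class function as an integral combination of permutation characters, hence as
a virtual character. -/
theorem schurChar_eq_sum (lam : n.Partition) :
    schurChar lam = ∑ σ : Perm (Fin n), ((Perm.sign σ : ℤ) : ℂ) •
      if ∀ i : Fin n, (i : ℕ) ≤ rowLength lam i + σ i then contentChar (trudiExponent lam σ) else 0 := by
  funext rho
  rw [schurChar, coeff_alternant_mul, Finset.sum_apply]
  refine Finset.sum_congr rfl fun σ _ => ?_
  rw [Pi.smul_apply, smul_eq_mul]
  split_ifs <;> rfl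

theorem sum_trudiExponent (lam : n.Partition) (σ : Perm (Fin n))
    (hc : ∀ i : Fin n, (i : ℕ) ≤ rowLength lam i + σ i) : ∑ i, trudiExponent lam σ i = n := by
  have h1 : ∑ i, (trudiExponent lam σ i + (i : ℕ)) = ∑ i : Fin n, (rowLength lam i + (σ i : ℕ)) := by
    refine Finset.sum_congr rfl fun i _ => ?_
    have := hc i
    simp only [trudiExponent, Finsupp.equivFunOnFinite_symm_apply_apply]
    omega
  rw [Finset.sum_add_distrib, Finset.sum_add_distrib, sum_rowLength,
    Equiv.sum_comp σ fun i : Fin n => (i : ℕ)] at h1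
  omega

/-- Under `frob_contentChar`, the signed sum of `schurChar_eq_sum` becomes term by term the
expansion of the Jacobi--Trudi determinant. -/
theorem frob_schurChar (lam : n.Partition) : frob (schurChar lam) = schur lam := by
  have h1 : frob (schurChar lam) = ∑ σ : Perm (Fin n), ((Perm.sign σ : ℤ) : ℂ) •
      if ∀ i : Fin n, (i : ℕ) ≤ rowLength lam i + σ i then
        frob (contentChar (trudiExponent lam σ)) else 0 := by
    change frobLin n (schurChar lam) = _
    rw [schurChar_eq_sum, map_sum]
    refine Finset.sum_congr rfl fun σ _ => ?_
    rw [map_smul]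
    split_ifs
    · rfl
    · rw [map_zero]
  rw [h1, schur, ← Matrix.det_transpose, Matrix.det_apply]
  refine Finset.sum_congr rfl fun σ _ => ?_
  have h2 : ∀ x : SymFn, (Perm.sign σ) • x = ((Perm.sign σ : ℤ) : ℂ) • x := by
    intro x
    rw [Units.smul_def, Int.cast_smul_eq_zsmul]
  rw [h2]
  congr 1
  simp only [Matrix.transpose_apply, Matrix.of_apply]
  rw [Finset.prod_ite_zero]
  simp only [Finset.mem_univ, true_implies]
  by_cases hc : ∀ i : Fin n, (i : ℕ) ≤ rowLength lam i + σ i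
  · rw [if_pos hc, if_pos hc, frob_contentChar _ (sum_trudiExponent lam σ hc)]
    rfl
  · rw [if_neg hc, if_neg hc]

/-- The pairing is the coefficient of `x ^ (λ + δ)` in `a_δ s_μ`, and `a_δ s_μ = a_{μ + δ}` by the
bialternant formula. -/
theorem pairing_schurChar_schurChar (lam mu : n.Partition) :
    pairing (schurChar lam) (schurChar mu) = if lam = mu then 1 else 0 := by
  rw [pairing_schurChar, frob_schurChar, alternant_staircase_mul_schur]
  refine (coeff_alternant (shiftedRows_strictAnti mu) (shiftedRows_strictAnti lam)).trans ?_
  refine if_congr ?_ rfl rfl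
  constructor
  · intro h1
    refine rowLength_injective fun i => ?_
    have := congrFun h1 i
    simp only [shiftedRows] at this
    omega
  · rintro rfl; rfl

theorem eq_sum_pairing_schurChar (χ : n.Partition → ℂ) :
    χ = ∑ mu, pairing (schurChar mu) χ • schurChar mu := by
  let M : Matrix n.Partition n.Partition ℂ := Matrix.of schurChar
  let W : Matrix n.Partition n.Partition ℂ := Matrix.of fun lam mu =>
    schurChar mu lam * (zee lam : ℂ)⁻¹
  have h1 : M * W = 1 := by
    ext lam mu
    rw [Matrix.mul_apply, Matrix.one_apply, ← pairing_schurChar_schurChar]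
    exact Finset.sum_congr rfl fun _ _ => (mul_assoc _ _ _).symm
  -- Both matrices are square, with rows and columns indexed by partitions, so orthogonality of rows
  -- gives orthogonality of columns.
  have h2 : W * M = 1 := mul_eq_one_comm.mp h1
  funext rho
  have h3 : ∀ nu, (if nu = rho then (1 : ℂ) else 0) =
      ∑ mu, schurChar mu nu * (zee nu : ℂ)⁻¹ * schurChar mu rho := by
    intro nu
    have := congrFun (congrFun h2 nu) rho
    rw [Matrix.mul_apply, Matrix.one_apply] at this
    exact this.symm
  rw [Finset.sum_apply]
  calc χ rho = ∑ nu, χ nu * (if nu = rho then (1 : ℂ) else 0) := by simp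
    _ = ∑ nu, ∑ mu, schurChar mu nu * χ nu * (zee nu : ℂ)⁻¹ * schurChar mu rho := by
      refine Finset.sum_congr rfl fun nu _ => ?_
      rw [h3, Finset.mul_sum]
      exact Finset.sum_congr rfl fun mu _ => by ring
    _ = _ := by
      rw [Finset.sum_comm]
      refine Finset.sum_congr rfl fun mu _ => ?_
      rw [Pi.smul_apply, pairing, smul_eq_mul, Finset.sum_mul]

theorem frob_eq_sum_schur (χ : n.Partition → ℂ) :
    frob χ = ∑ mu, pairing (schurChar mu) χ • schur mu := by
  conv_lhs => rw [eq_sum_pairing_schurChar χ]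
  change frobLin n _ = _
  rw [map_sum]
  refine Finset.sum_congr rfl fun mu _ => ?_
  rw [map_smul, ← frob_schurChar]
  rfl

/-- The coordinates of `χ` in the basis of Schur characters are coefficients of a multiple of `frob
χ`, so they depend on `frob χ` alone. -/
theorem frob_injective {χ ψ : n.Partition → ℂ} (h : frob χ = frob ψ) : χ = ψ := by
  rw [eq_sum_pairing_schurChar χ, eq_sum_pairing_schurChar ψ]
  refine Finset.sum_congr rfl fun mu _ => ?_
  rw [pairing_schurChar, pairing_schurChar, h]

end SchurChar

/-! ### Characters of the symmetric group -/

section Characters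

variable {n : ℕ}

theorem cyclePartition_surjective {X : Type*} [Fintype X] [DecidableEq X]
    (hX : Fintype.card X = n) : Function.Surjective (cyclePartition hX) := by
  intro lam
  have h1 := card_filter_parts_mul_zee hX lam
  have h2 : (Finset.univ.filter fun σ : Perm X => σ.partition.parts = lam.parts).Nonempty := by
    rw [← Finset.card_pos]
    exact Nat.pos_of_mul_pos_right (h1 ▸ n.factorial_pos)
  obtain ⟨σ, hσ⟩ := h2
  exact ⟨σ, Nat.Partition.ext (Finset.mem_filter.mp hσ).2⟩

theorem cyclePartition_inv {X : Type*} [Fintype X] [DecidableEq X] (hX : Fintype.card X = n)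
    (σ : Perm X) : cyclePartition hX σ⁻¹ = cyclePartition hX σ := by
  ext1
  simp only [cyclePartition]
  rw [Perm.parts_partition, Perm.parts_partition, Perm.cycleType_inv, Perm.support_inv]

/-- `ψ`, viewed as a function of permutations, is the character of `ρ`. -/
def HasCharacter {V : Type} [AddCommGroup V] [Module ℂ V]
    (ρ : Representation ℂ (Perm (Fin n)) V) (χ : n.Partition → ℂ) : Prop :=
  ∀ σ, ρ.character σ = χ (cyclePartition (Fintype.card_fin n) σ)

/-- The characters of the finite-dimensional representations of the symmetric group. -/
def IsCharacter (χ : n.Partition → ℂ) : Prop :=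
  ∃ (V : Type) (_ : AddCommGroup V) (_ : Module ℂ V) (_ : FiniteDimensional ℂ V)
    (ρ : Representation ℂ (Perm (Fin n)) V), HasCharacter ρ χ

/-- The irreducible characters of the symmetric group. -/
def IsIrreducibleCharacter (χ : n.Partition → ℂ) : Prop :=
  ∃ (V : Type) (_ : AddCommGroup V) (_ : Module ℂ V) (_ : FiniteDimensional ℂ V)
    (ρ : Representation ℂ (Perm (Fin n)) V), ρ.IsIrreducible ∧ HasCharacter ρ χ

theorem IsIrreducibleCharacter.isCharacter {χ : n.Partition → ℂ} (h : IsIrreducibleCharacter χ) :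
    IsCharacter χ := by
  obtain ⟨V, i1, i2, i3, ρ, _, h⟩ := h
  exact ⟨V, i1, i2, i3, ρ, h⟩

theorem HasCharacter.unique {V : Type} [AddCommGroup V] [Module ℂ V]
    {ρ : Representation ℂ (Perm (Fin n)) V} {χ ψ : n.Partition → ℂ} (h1 : HasCharacter ρ χ)
    (h2 : HasCharacter ρ ψ) : χ = ψ := by
  funext lam
  obtain ⟨σ, rfl⟩ := cyclePartition_surjective (Fintype.card_fin n) lam
  rw [← h1, ← h2]

/-- Permutations of equal cycle type are conjugate, so the value on one chosen permutation of each
type determines the character. -/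
theorem exists_hasCharacter {V : Type} [AddCommGroup V] [Module ℂ V]
    (ρ : Representation ℂ (Perm (Fin n)) V) : ∃ χ : n.Partition → ℂ, HasCharacter ρ χ := by
  refine ⟨fun lam => ρ.character (cyclePartition_surjective (Fintype.card_fin n) lam).choose,
    fun σ => ?_⟩
  have h1 := (cyclePartition_surjective (Fintype.card_fin n)
    (cyclePartition (Fintype.card_fin n) σ)).choose_spec
  change ρ.character σ = ρ.character (cyclePartition_surjective (Fintype.card_fin n)
    (cyclePartition (Fintype.card_fin n) σ)).choose
  generalize (cyclePartition_surjective (Fintype.card_fin n)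
    (cyclePartition (Fintype.card_fin n) σ)).choose = τ at h1
  have h2 : IsConj τ σ := by
    rw [Perm.partition_eq_of_isConj]
    exact Nat.Partition.ext (congrArg (fun lam : n.Partition => lam.parts) h1)
  obtain ⟨g, rfl⟩ := isConj_iff.mp h2
  rw [Representation.char_conj]

theorem pairing_eq_sum_perm (χ ψ : n.Partition → ℂ) :
    pairing χ ψ = (n.factorial : ℂ)⁻¹ * ∑ σ : Perm (Fin n),
      χ (cyclePartition (Fintype.card_fin n) σ) * ψ (cyclePartition (Fintype.card_fin n) σ) := by
  rw [sum_perm_eq_sum_partition (Fintype.card_fin n) fun lam => χ lam * ψ lam, smul_eq_mul,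
    ← mul_assoc, inv_mul_cancel₀ (Nat.cast_ne_zero.mpr n.factorial_ne_zero), one_mul, pairing]
  exact Finset.sum_congr rfl fun _ _ => by rw [smul_eq_mul, mul_comm]

/-- Schur orthogonality; the bilinear form needs no conjugation because `σ` and `σ⁻¹` have the same
cycle type. Orthogonality itself shows that equal characters come from isomorphic representations:
otherwise `pairing χ χ` would be both `0` and `1`. -/
theorem pairing_irreducible {χ ψ : n.Partition → ℂ} (hχ : IsIrreducibleCharacter χ)
    (hψ : IsIrreducibleCharacter ψ) : pairing χ ψ = if χ = ψ then 1 else 0 := by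
  obtain ⟨V, _, _, _, ρ, hρ, h1⟩ := hχ
  obtain ⟨W, _, _, _, τ, hτ, h2⟩ := hψ
  have hc : (Nat.card (Perm (Fin n)) : ℂ) = n.factorial := by
    rw [Nat.card_eq_fintype_card, Fintype.card_perm, Fintype.card_fin]
  have : Invertible (Nat.card (Perm (Fin n)) : ℂ) := invertibleOfNonzero (by
    rw [hc]; exact Nat.cast_ne_zero.mpr n.factorial_ne_zero)
  have key : ∀ {V W : Type} [AddCommGroup V] [Module ℂ V] [FiniteDimensional ℂ V]
      [AddCommGroup W] [Module ℂ W] [FiniteDimensional ℂ W]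
      (ρ : Representation ℂ (Perm (Fin n)) V) (τ : Representation ℂ (Perm (Fin n)) W)
      {χ ψ : n.Partition → ℂ} (_ : ρ.IsIrreducible) (_ : τ.IsIrreducible)
      (_ : HasCharacter ρ χ) (_ : HasCharacter τ ψ),
      pairing χ ψ = if Nonempty (Representation.Equiv τ ρ) then 1 else 0 := by
    intro V W _ _ _ _ _ _ ρ τ χ ψ hρ hτ h1 h2
    rw [pairing_eq_sum_perm, ← Representation.char_orthonormal ρ τ, hc]
    congr 1
    refine Finset.sum_congr rfl fun σ _ => ?_
    rw [h1, h2, cyclePartition_inv]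
  rw [key ρ τ hρ hτ h1 h2]
  refine if_congr ⟨?_, ?_⟩ rfl rfl
  · rintro ⟨e⟩
    funext lam
    obtain ⟨σ, rfl⟩ := cyclePartition_surjective (Fintype.card_fin n) lam
    rw [← h1, ← h2, Representation.char_iso e]
  · rintro rfl
    by_contra hne
    have h3 := key ρ τ hρ hτ h1 h2
    have h4 := key ρ ρ hρ hρ h1 h1
    rw [if_neg hne] at h3
    rw [h3, if_pos ⟨Representation.Equiv.refl ρ⟩] at h4
    exact zero_ne_one h4

/-- Maschke's theorem and induction on the dimension: a reducible representation has an invariant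
complement to a proper nonzero subrepresentation, and traces add over the two summands. -/
theorem mem_closure_irreducible_of_finrank : ∀ (d : ℕ) {V : Type} [AddCommGroup V] [Module ℂ V]
    [FiniteDimensional ℂ V] (ρ : Representation ℂ (Perm (Fin n)) V) (_ : Module.finrank ℂ V = d)
    {χ : n.Partition → ℂ} (_ : HasCharacter ρ χ),
    χ ∈ AddSubmonoid.closure {ψ : n.Partition → ℂ | IsIrreducibleCharacter ψ} := by
  intro d
  induction d using Nat.strong_induction_on with
  | _ d ih =>
  intro V _ _ _ ρ hd χ hχ
  by_cases hirr : ρ.IsIrreducible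
  · exact AddSubmonoid.subset_closure ⟨V, _, _, inferInstance, ρ, hirr, hχ⟩
  by_cases hsub : Subsingleton V
  · have h0 : χ = 0 := by
      refine HasCharacter.unique hχ fun σ => ?_
      rw [Representation.character, Subsingleton.elim (ρ σ) 0, map_zero]
      rfl
    rw [h0]
    exact zero_mem _
  rw [not_subsingleton_iff_nontrivial] at hsub
  obtain ⟨W, hWb, hWt⟩ : ∃ W : Subrepresentation ρ, W ≠ ⊥ ∧ W ≠ ⊤ := by
    by_contra hcon
    push Not at hcon
    have hnt : Nontrivial (Subrepresentation ρ) := ⟨⊥, ⊤, fun h =>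
      bot_ne_top (α := Submodule ℂ V) (congrArg Subrepresentation.toSubmodule h)⟩
    exact hirr { eq_bot_or_eq_top := fun W => or_iff_not_imp_left.mpr (hcon W) }
  obtain ⟨W', hW'⟩ := exists_isCompl W
  have hcompl : IsCompl W.toSubmodule W'.toSubmodule := by
    refine IsCompl.of_eq ?_ ?_
    · rw [← Subrepresentation.toSubmodule_inf, hW'.inf_eq_bot]; rfl
    · rw [← Subrepresentation.toSubmodule_sup, hW'.sup_eq_top]; rfl
  have hWb' : W.toSubmodule ≠ ⊥ := fun h => hWb (Subrepresentation.toSubmodule_injective h)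
  have hWt' : W.toSubmodule ≠ ⊤ := fun h => hWt (Subrepresentation.toSubmodule_injective h)
  have hlt := Submodule.finrank_lt hWt'
  have hpos := Submodule.one_le_finrank_iff.mpr hWb'
  have hadd := Submodule.finrank_add_eq_of_isCompl hcompl
  obtain ⟨χ₁, h1⟩ := exists_hasCharacter W.toRepresentation
  obtain ⟨χ₂, h2⟩ := exists_hasCharacter W'.toRepresentation
  have hsum : χ = χ₁ + χ₂ := by
    refine HasCharacter.unique hχ fun σ => ?_
    rw [Pi.add_apply, ← h1, ← h2]
    let N : Bool → Submodule ℂ V := fun b => cond b W.toSubmodule W'.toSubmodule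
    have hint : DirectSum.IsInternal N := by
      rw [DirectSum.isInternal_submodule_iff_isCompl N (i := true) (j := false) (by decide)]
      · exact hcompl
      · ext b; cases b <;> simp
    have hmaps : ∀ b, Set.MapsTo (ρ σ) (N b) (N b) := by
      intro b
      cases b
      · exact fun v hv => W'.apply_mem_toSubmodule σ hv
      · exact fun v hv => W.apply_mem_toSubmodule σ hv
    have := LinearMap.trace_eq_sum_trace_restrict hint hmaps
    rw [Fintype.sum_bool] at this
    exact this
  rw [hsum]
  exact add_mem (ih _ (by omega) W.toRepresentation rfl h1)
    (ih _ (by omega) W'.toRepresentation rfl h2)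

theorem IsCharacter.mem_closure_irreducible {χ : n.Partition → ℂ} (h : IsCharacter χ) :
    χ ∈ AddSubmonoid.closure {ψ : n.Partition → ℂ | IsIrreducibleCharacter ψ} := by
  obtain ⟨V, _, _, _, ρ, hρ⟩ := h
  exact mem_closure_irreducible_of_finrank _ ρ rfl hρ

theorem pairing_add_left (χ χ' ψ : n.Partition → ℂ) :
    pairing (χ + χ') ψ = pairing χ ψ + pairing χ' ψ := by
  rw [pairing_comm, pairing_comm χ, pairing_comm χ']
  exact (pairingLin ψ).map_add χ χ'

theorem IsCharacter.pairing_irreducible_eq_natCast {χ ψ : n.Partition → ℂ} (h : IsCharacter χ)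
    (hψ : IsIrreducibleCharacter ψ) : ∃ k : ℕ, pairing χ ψ = k := by
  refine AddSubmonoid.closure_induction (motive := fun χ _ => ∃ k : ℕ, pairing χ ψ = k)
    ?_ ?_ ?_ h.mem_closure_irreducible
  · intro χ hχ
    refine ⟨if χ = ψ then 1 else 0, ?_⟩
    rw [pairing_irreducible hχ hψ]
    split_ifs <;> simp
  · exact ⟨0, by simp [pairing]⟩
  · rintro χ χ' _ _ ⟨k, hk⟩ ⟨l, hl⟩
    exact ⟨k + l, by rw [pairing_add_left, hk, hl, Nat.cast_add]⟩

/-- A virtual character of norm one is irreducible up to sign. -/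
theorem irreducible_or_neg_of_pairing_self {χ : n.Partition → ℂ}
    (h : χ ∈ AddSubgroup.closure {ψ : n.Partition → ℂ | IsIrreducibleCharacter ψ})
    (h1 : pairing χ χ = 1) : IsIrreducibleCharacter χ ∨ IsIrreducibleCharacter (-χ) := by
  obtain ⟨a, ha⟩ : ∃ a : {ψ : n.Partition → ℂ // IsIrreducibleCharacter ψ} →₀ ℤ,
      χ = a.sum fun ψ c => (c : ℂ) • ψ.1 := by
    refine AddSubgroup.closure_induction (p := fun χ _ =>
      ∃ a : {ψ : n.Partition → ℂ // IsIrreducibleCharacter ψ} →₀ ℤ,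
        χ = a.sum fun ψ c => (c : ℂ) • ψ.1) ?_ ?_ ?_ ?_ h
    · intro ψ hψ
      refine ⟨Finsupp.single ⟨ψ, hψ⟩ 1, ?_⟩
      rw [Finsupp.sum_single_index] <;> simp
    · exact ⟨0, by simp⟩
    · rintro _ _ _ _ ⟨a, rfl⟩ ⟨b, rfl⟩
      refine ⟨a + b, ?_⟩
      rw [Finsupp.sum_add_index'] <;> simp [add_smul]
    · rintro _ _ ⟨a, rfl⟩
      refine ⟨-a, ?_⟩
      rw [Finsupp.sum_neg_index] <;> simp [Finsupp.sum, Finset.sum_neg_distrib]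
  have hpair : ∀ ψ : {ψ : n.Partition → ℂ // IsIrreducibleCharacter ψ}, pairing ψ.1 χ = a ψ := by
    intro ψ
    have h2 : pairing ψ.1 χ = a.sum fun φ c => (c : ℂ) * pairing ψ.1 φ.1 := by
      change pairingLin ψ.1 χ = _
      rw [ha, Finsupp.sum, map_sum]
      refine Finset.sum_congr rfl fun φ _ => ?_
      rw [map_smul]; rfl
    rw [h2, Finsupp.sum, Finset.sum_congr rfl fun φ _ => by rw [pairing_irreducible ψ.2 φ.2]]
    rw [Finset.sum_eq_single ψ]
    · simp
    · intro φ _ hφ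
      rw [if_neg (fun he => hφ (Subtype.ext he.symm)), mul_zero]
    · intro hψ
      simp [Finsupp.notMem_support_iff.mp hψ]
  -- By orthonormality the norm is the sum of the squares of the integral multiplicities, so a
  -- single one is nonzero and equals `±1`.
  have hsq : ∑ ψ ∈ a.support, a ψ ^ 2 = 1 := by
    have h2 : pairing χ χ = ∑ ψ ∈ a.support, (a ψ : ℂ) ^ 2 := by
      change pairingLin χ χ = _
      have h3 : pairingLin χ χ = ∑ φ ∈ a.support, pairingLin χ ((a φ : ℂ) • φ.1) := by
        rw [← map_sum]
        exact congrArg (pairingLin χ) ha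
      rw [h3]
      refine Finset.sum_congr rfl fun φ _ => ?_
      rw [map_smul, smul_eq_mul, sq]
      congr 1
      exact (pairing_comm _ _).trans (hpair φ)
    rw [h1] at h2
    exact_mod_cast h2.symm
  have hone : a.support.card = 1 := by
    have h3 : ∀ ψ ∈ a.support, 1 ≤ a ψ ^ 2 := by
      intro ψ hψ
      have := Finsupp.mem_support_iff.mp hψ
      have : 0 < a ψ ^ 2 := by positivity
      omega
    have h4 : (a.support.card : ℤ) ≤ 1 := by
      rw [← hsq]
      simpa using Finset.card_nsmul_le_sum _ _ _ h3
    have h5 : a.support.card ≠ 0 := by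
      intro h6
      rw [Finset.card_eq_zero] at h6
      rw [h6, Finset.sum_empty] at hsq
      exact zero_ne_one hsq
    omega
  obtain ⟨ψ, hψ⟩ := Finset.card_eq_one.mp hone
  rw [hψ, Finset.sum_singleton, sq_eq_one_iff] at hsq
  have hχ : χ = (a ψ : ℂ) • ψ.1 := by
    rw [ha, Finsupp.sum, hψ, Finset.sum_singleton]
  rcases hsq with h2 | h2
  · left
    rw [hχ, h2]
    simpa using ψ.2
  · right
    rw [hχ, h2]
    simpa using ψ.2

end Characters

/-! ### Schur functions are irreducible characters -/

section SchurIrreducible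

variable {n : ℕ}

theorem p_partition_apply {X : Type*} [Fintype X] [DecidableEq X] (σ : Perm X) (N : ℕ) :
    p σ.partition N = ∑ c : X → Fin N,
      if ∀ x, c (σ x) = c x then ∏ x, (MvPolynomial.X (c x) : MvPolynomial (Fin N) ℂ) else 0 := by
  rw [sum_fixed_colourings]
  rfl

/-- The exponent of the monomial of a colouring. -/
def content {X Y : Type*} [Fintype X] (c : X → Y) : Y →₀ ℕ := ∑ x, Finsupp.single (c x) 1

theorem content_comp {X Y : Type*} [Fintype X] (c : X → Y) (σ : Perm X) :
    content (c ∘ σ) = content c :=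
  Equiv.sum_comp σ fun x => Finsupp.single (c x) 1

theorem prod_X_eq_monomial {X Y R : Type*} [CommSemiring R] [Fintype X] (c : X → Y) :
    ∏ x, (MvPolynomial.X (c x) : MvPolynomial Y R) = MvPolynomial.monomial (content c) 1 := by
  rw [content, MvPolynomial.monomial_sum_one]
  rfl

/-- The permutation representation on functions of colourings with given content. -/
def contentRep (α : Fin n →₀ ℕ) :
    Representation ℂ (Perm (Fin n)) ({c : Fin n → Fin n // content c = α} → ℂ) where
  toFun σ := LinearMap.funLeft ℂ ℂ fun c => ⟨c.1 ∘ σ, (content_comp _ _).trans c.2⟩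
  map_one' := rfl
  map_mul' _ _ := rfl

/-- The trace of a permutation representation counts fixed points, here the words of content `α`
fixed by `σ`; that is the coefficient of `x ^ α` in the power sum of its cycle type. -/
theorem isCharacter_contentChar (α : Fin n →₀ ℕ) : IsCharacter (contentChar α) := by
  refine ⟨_, _, _, inferInstance, contentRep α, fun σ => ?_⟩
  rw [Representation.character, LinearMap.trace_eq_matrix_trace ℂ (Pi.basisFun ℂ _), Matrix.trace]
  have h1 : contentChar α (cyclePartition (Fintype.card_fin n) σ) =
      (p σ.partition n).coeff α := rfl
  rw [h1, p_partition_apply, MvPolynomial.coeff_sum,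
    ← Finset.sum_subset (Finset.subset_univ (Finset.univ.filter fun c => content c = α)),
    Finset.sum_subtype (Finset.univ.filter fun c : Fin n → Fin n => content c = α)
      (p := fun c => content c = α) (by simp)]
  · refine Finset.sum_congr rfl fun c _ => ?_
    rw [Matrix.diag_apply, LinearMap.toMatrix_apply, Pi.basisFun_apply, Pi.basisFun_repr]
    change (Pi.single c (1 : ℂ) : _ → ℂ) ⟨c.1 ∘ σ, (content_comp _ _).trans c.2⟩ = _
    rw [Pi.single_apply]
    by_cases hc : ∀ x, c.1 (σ x) = c.1 x
    · rw [if_pos hc, if_pos (Subtype.ext (funext hc)), prod_X_eq_monomial,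
        MvPolynomial.coeff_monomial, if_pos c.2]
    · rw [if_neg hc, if_neg, MvPolynomial.coeff_zero]
      exact fun h => hc fun x => congrFun (congrArg Subtype.val h) x
  · intro c _ hc
    split_ifs
    · rw [prod_X_eq_monomial, MvPolynomial.coeff_monomial, if_neg]
      simpa using hc
    · rw [MvPolynomial.coeff_zero]

theorem schurChar_mem_closure_irreducible (lam : n.Partition) :
    schurChar lam ∈ AddSubgroup.closure {ψ : n.Partition → ℂ | IsIrreducibleCharacter ψ} := by
  rw [schurChar_eq_sum]
  refine sum_mem fun σ _ => ?_
  have h1 : ∀ χ : n.Partition → ℂ, χ ∈ AddSubgroup.closure {ψ | IsIrreducibleCharacter ψ} →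
      ((Perm.sign σ : ℤ) : ℂ) • χ ∈ AddSubgroup.closure {ψ | IsIrreducibleCharacter ψ} := by
    intro χ hχ
    rw [Int.cast_smul_eq_zsmul]
    exact zsmul_mem hχ _
  refine h1 _ ?_
  split_ifs
  · exact AddSubgroup.le_closure_toAddSubmonoid _
      (isCharacter_contentChar (trudiExponent lam σ)).mem_closure_irreducible
  · exact zero_mem _

/-- Since `(2 ^ j) ^ β_i = (2 ^ β_i) ^ j`, the specialised alternant is a Vandermonde determinant in
the nodes `2 ^ β_i`. -/
theorem eval_alternant (β : Fin n → ℕ) :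
    MvPolynomial.eval (fun j : Fin n => (2 : ℂ) ^ (j : ℕ)) (alternant β) =
      ((∏ i : Fin n, ∏ j ∈ Finset.Ioi i, ((2 : ℝ) ^ β j - 2 ^ β i) : ℝ) : ℂ) := by
  rw [alternant, RingHom.map_det]
  have h1 := Matrix.det_vandermonde fun i : Fin n => (2 : ℂ) ^ β i
  push_cast
  rw [← h1]
  congr 1
  ext i j
  simp only [RingHom.mapMatrix_apply, Matrix.map_apply, Matrix.of_apply, Matrix.vandermonde_apply,
    map_pow, MvPolynomial.eval_X]
  rw [← pow_mul, ← pow_mul, mul_comm]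

/-- The bialternant formula makes the value a quotient of two Vandermonde products. Both exponent
sequences are strictly decreasing, so corresponding factors are both negative and the quotient is
positive. -/
theorem exists_pos_eval_schur (lam : n.Partition) : ∃ r : ℝ, 0 < r ∧
    MvPolynomial.eval (fun j : Fin n => (2 : ℂ) ^ (j : ℕ)) (schur lam n) = r := by
  have h1 := congrArg (MvPolynomial.eval (fun j : Fin n => (2 : ℂ) ^ (j : ℕ)))
    (alternant_staircase_mul_schur lam)
  rw [map_mul, eval_alternant, eval_alternant] at h1
  set V := ∏ i : Fin n, ∏ j ∈ Finset.Ioi i, ((2 : ℝ) ^ staircase n j - 2 ^ staircase n i)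
  set U := ∏ i : Fin n, ∏ j ∈ Finset.Ioi i, ((2 : ℝ) ^ (rowLength lam j + staircase n j) -
    2 ^ (rowLength lam i + staircase n i))
  have hneg : ∀ {β : Fin n → ℕ} (_ : StrictAnti β) (i j : Fin n), j ∈ Finset.Ioi i →
      (2 : ℝ) ^ β j - 2 ^ β i < 0 := by
    intro β hβ i j hij
    rw [sub_neg]
    exact pow_lt_pow_right₀ one_lt_two (hβ (Finset.mem_Ioi.mp hij))
  have hst : StrictAnti (staircase n) := by
    intro i j hij
    have h2 : (i : ℕ) < j := hij
    have := j.2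
    unfold staircase
    omega
  have hUV : 0 < U * V := by
    rw [← Finset.prod_mul_distrib]
    refine Finset.prod_pos fun i _ => ?_
    rw [← Finset.prod_mul_distrib]
    exact Finset.prod_pos fun j hj =>
      mul_pos_of_neg_of_neg (hneg (shiftedRows_strictAnti lam) i j hj) (hneg hst i j hj)
  have hV : V ≠ 0 := fun h => by rw [h, mul_zero] at hUV; exact lt_irrefl _ hUV
  refine ⟨U / V, ?_, ?_⟩
  · have : U / V = U * V / V ^ 2 := by field_simp
    rw [this]
    positivity
  · rw [Complex.ofReal_div, eq_div_iff (Complex.ofReal_ne_zero.mpr hV), mul_comm]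
    exact h1

/-- Norm one leaves only the sign open. If the negative were irreducible, every coefficient of
`s_λ`, being a pairing with a permutation character, would be nonpositive, against
`exists_pos_eval_schur`. -/
theorem isIrreducibleCharacter_schurChar (lam : n.Partition) :
    IsIrreducibleCharacter (schurChar lam) := by
  rcases irreducible_or_neg_of_pairing_self (schurChar_mem_closure_irreducible lam)
    (by rw [pairing_schurChar_schurChar, if_pos rfl]) with h1 | h1
  · exact h1
  exfalso
  obtain ⟨r, hr, h2⟩ := exists_pos_eval_schur lam
  have h3 : ∀ α, ∃ k : ℕ, (schur lam n).coeff α = -(k : ℂ) := by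
    intro α
    obtain ⟨k, hk⟩ := (isCharacter_contentChar α).pairing_irreducible_eq_natCast h1
    refine ⟨k, ?_⟩
    rw [← frob_schurChar, ← pairing_contentChar, ← hk]
    have := (pairingLin (contentChar α)).map_neg (schurChar lam)
    change pairing _ (-schurChar lam) = -pairing _ (schurChar lam) at this
    rw [this, neg_neg]
  choose k hk using h3
  rw [MvPolynomial.eval_eq'] at h2
  have h4 : (∑ α ∈ (schur lam n).support, (k α : ℝ) * ∏ i : Fin n, ((2 : ℝ) ^ (i : ℕ)) ^ α i) = -r := by
    have h5 : ((∑ α ∈ (schur lam n).support, (k α : ℝ) * ∏ i : Fin n, ((2 : ℝ) ^ (i : ℕ)) ^ α i : ℝ) : ℂ)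
        = ((-r : ℝ) : ℂ) := by
      rw [Complex.ofReal_neg, ← h2]
      push_cast
      rw [← Finset.sum_neg_distrib]
      refine Finset.sum_congr rfl fun α _ => ?_
      rw [hk]
      ring
    exact_mod_cast h5
  have h5 : 0 ≤ ∑ α ∈ (schur lam n).support, (k α : ℝ) * ∏ i : Fin n, ((2 : ℝ) ^ (i : ℕ)) ^ α i :=
    Finset.sum_nonneg fun α _ => by positivity
  linarith

end SchurIrreducible

/-! ### Monomial representations -/

section Monomial

variable {n : ℕ}

/-- The Frobenius characteristic of the representation induced along `ι` from the linear character
`θ`. -/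
def inducedFrob {Γ X : Type} [Group Γ] [Fintype Γ] [Fintype X] [DecidableEq X] (ι : Γ →* Perm X)
    (θ : Γ →* ℂ) : SymFn :=
  ((Fintype.card Γ : ℂ)⁻¹) • ∑ γ, θ γ • p (ι γ).partition

/-- Sums of Frobenius characteristics of monomial representations. -/
def monomialFrob (n : ℕ) : AddSubmonoid SymFn :=
  AddSubmonoid.closure {f | ∃ (Γ X : Type) (_ : Group Γ) (_ : Fintype Γ) (_ : Fintype X)
    (_ : DecidableEq X) (ι : Γ →* Perm X) (θ : Γ →* ℂ), Fintype.card X = n ∧ f = inducedFrob ι θ}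

theorem inducedFrob_mem {Γ X : Type} [Group Γ] [Fintype Γ] [Fintype X] [DecidableEq X]
    (ι : Γ →* Perm X) (θ : Γ →* ℂ) (hX : Fintype.card X = n) : inducedFrob ι θ ∈ monomialFrob n :=
  AddSubmonoid.subset_closure ⟨Γ, X, _, _, _, _, ι, θ, hX, rfl⟩

/-- A fixed colouring of a disjoint union is a pair of fixed colourings. -/
theorem p_sumCongr {X X' : Type} [Fintype X] [DecidableEq X] [Fintype X'] [DecidableEq X']
    (σ : Perm X) (τ : Perm X') :
    p (Perm.sumCongr σ τ).partition = p σ.partition * p τ.partition := by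
  funext N
  rw [Pi.mul_apply, p_partition_apply, p_partition_apply, p_partition_apply,
    ← (Equiv.sumArrowEquivProdArrow X X' (Fin N)).symm.sum_comp, Fintype.sum_prod_type,
    Finset.sum_mul_sum]
  refine Finset.sum_congr rfl fun c _ => Finset.sum_congr rfl fun d _ => ?_
  rw [Fintype.prod_sum_type, ite_zero_mul_ite_zero]
  refine if_congr ?_ rfl rfl
  rw [Sum.forall]
  rfl

theorem inducedFrob_mul {Γ Γ' X X' : Type} [Group Γ] [Fintype Γ] [Fintype X] [DecidableEq X]
    [Group Γ'] [Fintype Γ'] [Fintype X'] [DecidableEq X'] (ι : Γ →* Perm X) (θ : Γ →* ℂ)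
    (ι' : Γ' →* Perm X') (θ' : Γ' →* ℂ) :
    inducedFrob ι θ * inducedFrob ι' θ' =
      inducedFrob ((Perm.sumCongrHom X X').comp (ι.prodMap ι'))
        (θ.comp (MonoidHom.fst Γ Γ') * θ'.comp (MonoidHom.snd Γ Γ')) := by
  rw [inducedFrob, inducedFrob, inducedFrob, smul_mul_smul_comm, Finset.sum_mul_sum,
    Fintype.card_prod, Fintype.sum_prod_type, Nat.cast_mul, mul_inv]
  congr 1
  refine Finset.sum_congr rfl fun γ _ => Finset.sum_congr rfl fun γ' _ => ?_
  rw [smul_mul_smul_comm, ← p_sumCongr]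
  rfl

theorem mul_mem_monomialFrob {a b : ℕ} {f g : SymFn} (hf : f ∈ monomialFrob a)
    (hg : g ∈ monomialFrob b) : f * g ∈ monomialFrob (a + b) := by
  refine AddSubmonoid.closure_induction (motive := fun f _ => f * g ∈ monomialFrob (a + b))
    ?_ ?_ ?_ hf
  · rintro _ ⟨Γ, X, _, _, _, _, ι, θ, hX, rfl⟩
    refine AddSubmonoid.closure_induction
      (motive := fun g _ => inducedFrob ι θ * g ∈ monomialFrob (a + b)) ?_ ?_ ?_ hg
    · rintro _ ⟨Γ', X', _, _, _, _, ι', θ', hX', rfl⟩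
      rw [inducedFrob_mul]
      exact inducedFrob_mem _ _ (by rw [Fintype.card_sum, hX, hX'])
    · rw [mul_zero]; exact zero_mem _
    · intro x y _ _ hx hy
      rw [mul_add]; exact add_mem hx hy
  · rw [zero_mul]; exact zero_mem _
  · intro x y _ _ hx hy
    rw [add_mul]; exact add_mem hx hy

theorem one_mem_monomialFrob : (1 : SymFn) ∈ monomialFrob 0 := by
  have h1 : (1 : SymFn) = inducedFrob (1 : Unit →* Perm (Fin 0)) 1 := by
    funext N
    simp [inducedFrob, p_partition_apply]
  rw [h1]
  exact inducedFrob_mem _ _ (Fintype.card_fin 0)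

/-- Frobenius reciprocity: the pairing with the character of `ρ` is the average over `Γ` of the
character of `θ ⊗ ρ` restricted along `ι`, and such an average is the dimension of a space of
invariants. -/
theorem exists_frob_eq_inducedFrob {Γ X : Type} [Group Γ] [Fintype Γ] [Fintype X] [DecidableEq X]
    (ι : Γ →* Perm X) (θ : Γ →* ℂ) (hX : Fintype.card X = n) :
    ∃ χ : n.Partition → ℂ, frob χ = inducedFrob ι θ ∧
      ∀ ψ, IsCharacter ψ → ∃ k : ℕ, pairing χ ψ = k := by
  -- The average of `θ` over the elements of each cycle type, multiplied by `z_λ` to cancel the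
  -- weight in `frob`.
  let χ : n.Partition → ℂ := fun lam =>
    zee lam * ((Fintype.card Γ : ℂ)⁻¹ * ∑ γ, if cyclePartition hX (ι γ) = lam then θ γ else 0)
  have hsum : ∀ {M : Type} [AddCommGroup M] [Module ℂ M] (F : n.Partition → M),
      ∑ lam, (χ lam * (zee lam : ℂ)⁻¹) • F lam =
        ((Fintype.card Γ : ℂ)⁻¹) • ∑ γ, θ γ • F (cyclePartition hX (ι γ)) := by
    intro M _ _ F
    have h1 : ∀ lam, (χ lam * (zee lam : ℂ)⁻¹) • F lam = ((Fintype.card Γ : ℂ)⁻¹) •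
        ∑ γ, (if cyclePartition hX (ι γ) = lam then θ γ • F lam else 0) := by
      intro lam
      have h2 : χ lam * (zee lam : ℂ)⁻¹ = (Fintype.card Γ : ℂ)⁻¹ *
          ∑ γ, if cyclePartition hX (ι γ) = lam then θ γ else 0 := by
        have := zee_ne_zero lam
        simp only [χ]
        field_simp
      rw [h2, mul_smul, Finset.sum_smul]
      congr 1
      exact Finset.sum_congr rfl fun γ _ => by rw [ite_smul, zero_smul]
    rw [Finset.sum_congr rfl fun lam _ => h1 lam, ← Finset.smul_sum, Finset.sum_comm]
    congr 1
    exact Finset.sum_congr rfl fun γ _ => by simp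
  refine ⟨χ, (hsum p).trans rfl, ?_⟩
  rintro ψ ⟨V, _, _, _, ρ, hρ⟩
  let e : X ≃ Fin n := Fintype.equivFinOfCardEq hX
  let τ : Representation ℂ Γ V :=
    { toFun := fun γ => θ γ • ρ (e.permCongr (ι γ))
      map_one' := by
        rw [map_one, map_one, one_smul]
        have : e.permCongr (1 : Perm X) = 1 := by ext; simp [Equiv.permCongr_apply]
        rw [this, map_one]
      map_mul' := fun γ γ' => by
        have : e.permCongr (ι γ * ι γ') = e.permCongr (ι γ) * e.permCongr (ι γ') := by
          ext; simp [Equiv.permCongr_apply]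
        rw [map_mul, map_mul, this, map_mul, smul_mul_smul_comm] }
  have : Invertible (Nat.card Γ : ℂ) := invertibleOfNonzero (by
    rw [Nat.card_eq_fintype_card]; exact Nat.cast_ne_zero.mpr Fintype.card_ne_zero)
  refine ⟨Module.finrank ℂ τ.invariants, ?_⟩
  rw [← Representation.card_inv_mul_sum_char_eq_finrank τ, Nat.card_eq_fintype_card]
  have h3 := hsum ψ
  simp only [smul_eq_mul] at h3
  have h4 : pairing χ ψ = ∑ lam, χ lam * (zee lam : ℂ)⁻¹ * ψ lam :=
    Finset.sum_congr rfl fun _ _ => by ring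
  rw [h4, h3]
  congr 1
  refine Finset.sum_congr rfl fun γ _ => ?_
  have h5 : cyclePartition hX (ι γ) = cyclePartition (Fintype.card_fin n) (e.permCongr (ι γ)) :=
    Nat.Partition.ext (parts_permCongr e (ι γ)).symm
  rw [h5, ← hρ]
  change _ = LinearMap.trace ℂ V (θ γ • ρ (e.permCongr (ι γ)))
  rw [map_smul]
  rfl

theorem exists_frob_eq_of_mem_monomialFrob {f : SymFn} (hf : f ∈ monomialFrob n) :
    ∃ χ : n.Partition → ℂ, frob χ = f ∧ ∀ ψ, IsCharacter ψ → ∃ k : ℕ, pairing χ ψ = k := by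
  refine AddSubmonoid.closure_induction (motive := fun f _ => ∃ χ : n.Partition → ℂ, frob χ = f ∧
    ∀ ψ, IsCharacter ψ → ∃ k : ℕ, pairing χ ψ = k) ?_ ?_ ?_ hf
  · rintro _ ⟨Γ, X, _, _, _, _, ι, θ, hX, rfl⟩
    exact exists_frob_eq_inducedFrob ι θ hX
  · exact ⟨0, (frobLin n).map_zero, fun ψ _ => ⟨0, by simp [pairing]⟩⟩
  · rintro _ _ _ _ ⟨χ, rfl, h1⟩ ⟨χ', rfl, h2⟩
    refine ⟨χ + χ', frob_add _ _, fun ψ hψ => ?_⟩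
    obtain ⟨k, hk⟩ := h1 ψ hψ
    obtain ⟨l, hl⟩ := h2 ψ hψ
    exact ⟨k + l, by rw [pairing_add_left, hk, hl, Nat.cast_add]⟩

/-- Multiplication of a class function by the sign character. -/
def signTwist (χ : n.Partition → ℂ) (lam : n.Partition) : ℂ :=
  (-1) ^ (n - lam.parts.card) * χ lam

theorem sign_eq_pow {X : Type*} [Fintype X] [DecidableEq X] (hX : Fintype.card X = n)
    (σ : Perm X) : (Perm.sign σ : ℤ) = (-1) ^ (n - (cyclePartition hX σ).parts.card) := by
  subst hX
  change _ = (-1) ^ (Fintype.card X - σ.partition.parts.card)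
  have h1 : σ.cycleType.sum ≤ Fintype.card X := by
    rw [Perm.sum_cycleType]; exact Finset.card_le_univ _
  have h2 : σ.cycleType.card ≤ σ.cycleType.sum := by
    have := Multiset.card_nsmul_le_sum (s := σ.cycleType) (a := 1)
      fun x hx => (Perm.two_le_of_mem_cycleType hx).trans' one_le_two
    simpa using this
  rw [Perm.sign_of_cycleType, Perm.parts_partition, ← Perm.sum_cycleType, Multiset.card_add,
    Multiset.card_replicate]
  push_cast
  rw [show Fintype.card X - (σ.cycleType.card + (Fintype.card X - σ.cycleType.sum)) =
    σ.cycleType.sum - σ.cycleType.card by omega]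
  obtain ⟨d, hd⟩ := Nat.exists_eq_add_of_le h2
  rw [hd, show σ.cycleType.card + d + σ.cycleType.card = 2 * σ.cycleType.card + d by ring,
    pow_add, pow_mul, Nat.add_sub_cancel_left]
  simp

theorem IsCharacter.signTwist {χ : n.Partition → ℂ} (h : IsCharacter χ) :
    IsCharacter (signTwist χ) := by
  obtain ⟨V, i1, i2, i3, ρ, hρ⟩ := h
  refine ⟨V, i1, i2, i3,
    { toFun := fun σ => ((Perm.sign σ : ℤ) : ℂ) • ρ σ
      map_one' := by simp
      map_mul' := fun σ τ => by
        rw [map_mul, map_mul, smul_mul_smul_comm]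
        push_cast
        rfl }, fun σ => ?_⟩
  change LinearMap.trace ℂ V (((Perm.sign σ : ℤ) : ℂ) • ρ σ) = _
  rw [map_smul, sign_eq_pow (Fintype.card_fin n), PrimeLie.signTwist, ← hρ]
  push_cast
  rfl

theorem schurPositive_frob {χ : n.Partition → ℂ}
    (h : ∀ ψ, IsCharacter ψ → ∃ k : ℕ, pairing χ ψ = k) : SchurPositive n (frob χ) := by
  choose c hc using fun lam : n.Partition =>
    h (schurChar lam) (isIrreducibleCharacter_schurChar lam).isCharacter
  refine ⟨c, ?_⟩
  rw [frob_eq_sum_schur]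
  refine Finset.sum_congr rfl fun lam _ => ?_
  rw [pairing_comm, hc, Nat.cast_smul_eq_nsmul]

theorem schurPositive_of_mem_monomialFrob {f : SymFn} (hf : f ∈ monomialFrob n) :
    SchurPositive n f := by
  obtain ⟨χ, rfl, h⟩ := exists_frob_eq_of_mem_monomialFrob hf
  exact schurPositive_frob h

/-- The sign twist moves across the pairing, and the twist of a character is again a character. -/
theorem schurPositive_signTwist {χ : n.Partition → ℂ} (hf : frob χ ∈ monomialFrob n) :
    SchurPositive n (frob (signTwist χ)) := by
  obtain ⟨χ', h1, h⟩ := exists_frob_eq_of_mem_monomialFrob hf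
  obtain rfl := frob_injective h1
  refine schurPositive_frob fun ψ hψ => ?_
  obtain ⟨k, hk⟩ := h _ hψ.signTwist
  refine ⟨k, hk ▸ Finset.sum_congr rfl fun lam _ => ?_⟩
  simp only [signTwist]
  ring

end Monomial

/-! ### The character of an induced representation -/

section Induced

open Representation TensorProduct
open scoped MonoidAlgebra

theorem trace_mapDomain {H : Type*} [Fintype H] [DecidableEq H] (f : H → H) :
    LinearMap.trace ℂ ℂ[H] (MonoidAlgebra.mapDomainLinearMap ℂ ℂ f) =
      ∑ x, if f x = x then 1 else 0 := by
  rw [LinearMap.trace_eq_matrix_trace ℂ (MonoidAlgebra.basis H ℂ), Matrix.trace]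
  refine Finset.sum_congr rfl fun x _ => ?_
  rw [Matrix.diag_apply, LinearMap.toMatrix_apply, MonoidAlgebra.basis_apply]
  have h1 : MonoidAlgebra.mapDomainLinearMap ℂ ℂ f (MonoidAlgebra.single x 1) =
      MonoidAlgebra.basis H ℂ (f x) := by
    rw [MonoidAlgebra.basis_apply]
    exact MonoidAlgebra.mapDomain_single
  rw [h1, Module.Basis.repr_self, Finsupp.single_apply]

/-- The averaging operator descends to a section `s` of the quotient map, so `R' = mk ∘ R ∘ s`.
Cyclicity of the trace turns this into the trace of `R` composed with the average. -/
theorem trace_coinvariants {Γ W : Type*} [Group Γ] [Fintype Γ] [AddCommGroup W] [Module ℂ W]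
    [FiniteDimensional ℂ W] (T : Representation ℂ Γ W) (R : W →ₗ[ℂ] W)
    (R' : Coinvariants T →ₗ[ℂ] Coinvariants T)
    (hR : R' ∘ₗ Coinvariants.mk T = Coinvariants.mk T ∘ₗ R) :
    LinearMap.trace ℂ _ R' = (Fintype.card Γ : ℂ)⁻¹ * ∑ γ, LinearMap.trace ℂ W (R ∘ₗ T γ) := by
  have hfin : FiniteDimensional ℂ (Coinvariants T) :=
    Module.Finite.of_surjective (Coinvariants.mk T) (Coinvariants.mk_surjective T)
  have hc : (Fintype.card Γ : ℂ) ≠ 0 := Nat.cast_ne_zero.mpr Fintype.card_ne_zero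
  let A : W →ₗ[ℂ] W := (Fintype.card Γ : ℂ)⁻¹ • ∑ γ, T γ
  let s : Coinvariants T →ₗ[ℂ] W := Coinvariants.lift T A fun γ => by
    change ((Fintype.card Γ : ℂ)⁻¹ • ∑ γ, T γ) * T γ = _
    rw [smul_mul_assoc, Finset.sum_mul]
    congr 1
    rw [← Equiv.sum_comp (Equiv.mulRight γ) fun γ => T γ]
    exact Finset.sum_congr rfl fun γ' _ => (map_mul T _ _).symm
  have hs : s ∘ₗ Coinvariants.mk T = A := Coinvariants.lift_comp_mk T A _
  have hs' : Coinvariants.mk T ∘ₗ s = LinearMap.id := by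
    refine Coinvariants.hom_ext (LinearMap.ext fun w => ?_)
    have h1 : s (Coinvariants.mk T w) = A w := LinearMap.congr_fun hs w
    rw [LinearMap.comp_apply, LinearMap.comp_apply, h1]
    simp only [A, LinearMap.smul_apply, LinearMap.sum_apply, map_smul, map_sum,
      Coinvariants.mk_self_apply, Finset.sum_const, Finset.card_univ]
    rw [← Nat.cast_smul_eq_nsmul ℂ, smul_smul, inv_mul_cancel₀ hc, one_smul]
    rfl
  have h1 : R' = Coinvariants.mk T ∘ₗ (R ∘ₗ s) := by
    rw [← LinearMap.comp_assoc, ← hR, LinearMap.comp_assoc, hs', LinearMap.comp_id]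
  rw [h1, LinearMap.trace_comp_comm', LinearMap.comp_assoc, hs]
  change LinearMap.trace ℂ W (R * ((Fintype.card Γ : ℂ)⁻¹ • ∑ γ, T γ)) = _
  rw [mul_smul_comm, Finset.mul_sum, map_smul, map_sum, smul_eq_mul]
  rfl

/-- The induced representation is the space of coinvariants of `ℂ[H] ⊗ V`, so `trace_coinvariants`
applies; on the first factor the trace counts fixed points of `x ↦ φ γ * x * g⁻¹`. -/
theorem character_ind {Γ H V : Type*} [Group Γ] [Fintype Γ] [Group H] [Fintype H] [DecidableEq H]
    [AddCommGroup V] [Module ℂ V] [FiniteDimensional ℂ V] (φ : Γ →* H) (ρ : Representation ℂ Γ V)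
    (g : H) : (ind φ ρ).character g =
      (Fintype.card Γ : ℂ)⁻¹ * ∑ γ, (∑ x : H, if φ γ * x * g⁻¹ = x then 1 else 0) * ρ.character γ := by
  rw [Representation.character, trace_coinvariants _
    ((MonoidAlgebra.mapDomainLinearMap ℂ ℂ fun x => x * g⁻¹).rTensor V) (ind φ ρ g) rfl]
  congr 1
  refine Finset.sum_congr rfl fun γ _ => ?_
  have h1 : (MonoidAlgebra.mapDomainLinearMap ℂ ℂ fun x : H => x * g⁻¹).rTensor V ∘ₗ
      (Representation.tprod ((leftRegular ℂ H).comp φ) ρ) γ =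
      TensorProduct.map (MonoidAlgebra.mapDomainLinearMap ℂ ℂ fun x : H => φ γ * x * g⁻¹) (ρ γ) := by
    ext x v
    simp
  rw [h1, LinearMap.trace_tensorProduct', trace_mapDomain]
  rfl

/-- For given `γ` and `x`, the only contributing permutation is `x⁻¹ * φ γ * x`, of the same cycle
type as `φ γ`. The sum over `x` then cancels the factorial. -/
theorem frobeniusChar_ind {Γ X : Type} [Group Γ] [Fintype Γ] [Fintype X] [DecidableEq X]
    (φ : Γ →* Perm X) (ρ : Representation ℂ Γ ℂ) (θ : Γ →* ℂ) (hθ : ∀ γ, ρ.character γ = θ γ) :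
    frobeniusChar (ind φ ρ) = inducedFrob φ θ := by
  have hconj : ∀ σ x : Perm X, p (x⁻¹ * σ * x).partition = p σ.partition := by
    intro σ x
    congr 1
    rw [← Perm.partition_eq_of_isConj]
    exact isConj_iff.mpr ⟨x, by group⟩
  have hX : ((Fintype.card X).factorial : ℂ) ≠ 0 := Nat.cast_ne_zero.mpr (Nat.factorial_ne_zero _)
  have h1 : ∑ σ : Perm X, (ind φ ρ).character σ • p σ.partition =
      (Fintype.card Γ : ℂ)⁻¹ • ∑ γ, ∑ x : Perm X, θ γ • p (φ γ).partition := by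
    simp only [character_ind, hθ, mul_smul, ← Finset.smul_sum, Finset.sum_smul, Finset.sum_mul]
    congr 1
    rw [Finset.sum_comm]
    refine Finset.sum_congr rfl fun γ _ => ?_
    rw [Finset.sum_comm, Finset.smul_sum]
    refine Finset.sum_congr rfl fun x _ => ?_
    rw [Finset.sum_eq_single (x⁻¹ * φ γ * x)]
    · rw [if_pos (by group), one_smul, hconj]
    · intro σ _ hσ
      rw [if_neg, zero_smul]
      intro h2
      refine hσ ?_
      rw [mul_inv_eq_iff_eq_mul] at h2
      rw [mul_assoc, h2, inv_mul_cancel_left]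
    · intro h; exact absurd (Finset.mem_univ _) h
  rw [frobeniusChar, h1, inducedFrob, smul_comm]
  congr 1
  simp only [Finset.sum_const, Finset.card_univ, Fintype.card_perm]
  rw [← Finset.smul_sum, ← Nat.cast_smul_eq_nsmul ℂ, smul_smul, inv_mul_cancel₀ hX, one_smul]

/-- The linear character of the cyclic group with generator acting as `exp (2 π i r / n)`. -/
def cyclicChar (n : ℕ) [NeZero n] (r : ℕ) : Multiplicative (ZMod n) →* ℂ :=
  ((ZMod.stdAddChar (N := n)).mulShift (r : ZMod n)).toMonoidHom

theorem L_eq_inducedFrob (S : Set ℕ) (n : ℕ) [NeZero n] :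
    L S n = inducedFrob (cyclicHom n) (cyclicChar n (Qpart S n)) := by
  refine frobeniusChar_ind _ _ _ fun γ => ?_
  change LinearMap.trace ℂ ℂ (LinearMap.mulLeft ℂ (cyclicChar n (Qpart S n) γ)) = _
  have h1 : ∀ a : ℂ, LinearMap.mulLeft ℂ a = a • LinearMap.id := fun a => by ext; simp
  rw [h1, map_smul, LinearMap.trace_id]
  simp

end Induced

/-! ### Exterior plethysms of monomial representations -/

section Wreath

variable {Γ X : Type} [Group Γ] [Fintype Γ] [Fintype X]

/-- The wreath product of `Γ` with the symmetric group on `m` letters. -/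
abbrev Wreath (Γ : Type) [Group Γ] (m : ℕ) : Type :=
  (Fin m → Γ) ⋊[mulAutArrow (G := Perm (Fin m)) (A := Fin m) (M := Γ)] Perm (Fin m)

instance (m : ℕ) : Fintype (Wreath Γ m) := Fintype.ofEquiv _ SemidirectProduct.equivProd.symm

theorem card_wreath (m : ℕ) : Fintype.card (Wreath Γ m) = Fintype.card Γ ^ m * m.factorial := by
  rw [Fintype.card_congr SemidirectProduct.equivProd, Fintype.card_prod, Fintype.card_fun,
    Fintype.card_perm, Fintype.card_fin]

/-- The action of the wreath product on `m` copies of `X`. -/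
def wreathHom (ι : Γ →* Perm X) (m : ℕ) : Wreath Γ m →* Perm (Fin m × X) where
  toFun g :=
    { toFun := fun jx => (g.right jx.1, ι (g.left (g.right jx.1)) jx.2)
      invFun := fun jx => (g.right.symm jx.1, (ι (g.left jx.1)).symm jx.2)
      left_inv := fun jx => by simp
      right_inv := fun jx => by simp }
  map_one' := by ext jx <;> simp
  map_mul' g g' := by
    ext jx
    · simp
    · change (ι (g.left (g.right (g'.right jx.1)) *
        g'.left (g.right.symm (g.right (g'.right jx.1))))) jx.2 = _
      rw [Equiv.symm_apply_apply, map_mul]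
      rfl

/-- The linear character of the wreath product given by `θ` on the base group and by the sign on
the symmetric group. -/
def wreathChar (θ : Γ →* ℂ) (m : ℕ) : Wreath Γ m →* ℂ where
  toFun g := (∏ j, θ (g.left j)) * ((Perm.sign g.right : ℤ) : ℂ)
  map_one' := by simp
  map_mul' g g' := by
    have h1 : ∏ j, θ ((g * g').left j) = (∏ j, θ (g.left j)) * ∏ j, θ (g'.left j) := by
      rw [← Equiv.prod_comp g.right.symm fun j => θ (g'.left j), ← Finset.prod_mul_distrib]
      refine Finset.prod_congr rfl fun j _ => ?_
      rw [← map_mul]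
      rfl
    rw [h1, SemidirectProduct.mul_right, map_mul]
    push_cast
    ring

/-- The kernel `∑ θ(γ)`, over the `γ` carrying the word `v` to the word `u`. -/
def wordKernel {Y : Type*} (ι : Γ →* Perm X) (θ : Γ →* ℂ) (u v : X → Y) : ℂ :=
  ∑ γ, if ∀ x, v (ι γ x) = u x then θ γ else 0

theorem content_eq_of_wordKernel_ne_zero {Y : Type*} {ι : Γ →* Perm X} {θ : Γ →* ℂ} {u v : X → Y}
    (h : wordKernel ι θ u v ≠ 0) : content u = content v := by
  obtain ⟨γ, _, hγ⟩ := Finset.exists_ne_zero_of_sum_ne_zero h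
  have h1 : ∀ x, v (ι γ x) = u x := by
    by_contra hc
    exact hγ (if_neg hc)
  rw [← content_comp v (ι γ)]
  congr 1
  funext x
  exact (h1 x).symm

variable [DecidableEq X]

/-- Convolution in the group algebra: the kernel is that of the element `∑ θ(γ) γ`, whose square is
`|Γ|` times itself. -/
theorem sum_wordKernel_mul {Y : Type*} [Fintype Y] (ι : Γ →* Perm X) (θ : Γ →* ℂ) (u w : X → Y) :
    ∑ v, wordKernel ι θ u v * wordKernel ι θ v w = Fintype.card Γ * wordKernel ι θ u w := by
  have h1 : ∀ γ γ' : Γ, (∑ v : X → Y, (if ∀ x, v (ι γ x) = u x then θ γ else 0) *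
      (if ∀ x, w (ι γ' x) = v x then θ γ' else 0)) =
      if ∀ x, w (ι (γ' * γ) x) = u x then θ (γ' * γ) else 0 := by
    intro γ γ'
    rw [Finset.sum_eq_single (fun x => w (ι γ' x))]
    · rw [if_pos (c := ∀ x, w (ι γ' x) = w (ι γ' x)) fun x => rfl, ite_mul, zero_mul, map_mul θ,
        mul_comm]
      refine if_congr ?_ rfl rfl
      rw [map_mul]
      rfl
    · intro v _ hv
      rw [if_neg (c := ∀ x, w (ι γ' x) = v x) fun h => hv (funext fun x => (h x).symm), mul_zero]
    · intro h; exact absurd (Finset.mem_univ _) h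
  simp only [wordKernel, Finset.sum_mul_sum]
  rw [Finset.sum_comm]
  have h2 : ∀ γ : Γ, ∑ v : X → Y, ∑ γ' : Γ, (if ∀ x, v (ι γ x) = u x then θ γ else 0) *
      (if ∀ x, w (ι γ' x) = v x then θ γ' else 0) =
      ∑ γ', if ∀ x, w (ι γ' x) = u x then θ γ' else 0 := by
    intro γ
    rw [Finset.sum_comm, Finset.sum_congr rfl fun γ' _ => h1 γ γ']
    exact Equiv.sum_comp (Equiv.mulRight γ) fun γ' => if ∀ x, w (ι γ' x) = u x then θ γ' else 0
  rw [Finset.sum_congr rfl fun γ _ => h2 γ, Finset.sum_const, Finset.card_univ, nsmul_eq_mul]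

/-- The monomial of a word. -/
def wordMonomial {N : ℕ} (u : X → Fin N) : MvPolynomial (Fin N) ℂ := ∏ x, MvPolynomial.X (u x)

/-- The kernel vanishes between words of different content, so all monomials along a nonzero path
agree and can be pulled out; what remains is `sum_wordKernel_mul`. -/
theorem pow_wordMatrix (ι : Γ →* Perm X) (θ : Γ →* ℂ) (N k : ℕ) (u w : X → Fin N) :
    (Matrix.of (fun u v : X → Fin N =>
      wordMonomial u * MvPolynomial.C (wordKernel ι θ u v)) ^ (k + 1)) u w =
      wordMonomial u ^ (k + 1) * MvPolynomial.C (Fintype.card Γ ^ k * wordKernel ι θ u w) := by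
  induction k generalizing w with
  | zero => simp
  | succ k ih =>
    rw [pow_succ, Matrix.mul_apply]
    have h1 : ∀ v : X → Fin N, (Matrix.of (fun u v : X → Fin N =>
        wordMonomial u * MvPolynomial.C (wordKernel ι θ u v)) ^ (k + 1)) u v *
        (wordMonomial v * MvPolynomial.C (wordKernel ι θ v w)) =
        wordMonomial u ^ (k + 1 + 1) *
          MvPolynomial.C (Fintype.card Γ ^ k * (wordKernel ι θ u v * wordKernel ι θ v w)) := by
      intro v
      rw [ih v]
      by_cases h2 : wordKernel ι θ u v = 0
      · simp [h2]
      · have h3 : wordMonomial u = wordMonomial v := by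
          rw [wordMonomial, wordMonomial, prod_X_eq_monomial, prod_X_eq_monomial,
            content_eq_of_wordKernel_ne_zero h2]
        rw [← h3, map_mul, map_mul, map_mul]
        ring
    simp only [Matrix.of_apply]
    rw [Finset.sum_congr rfl fun v _ => h1 v, ← Finset.mul_sum, ← map_sum, ← Finset.mul_sum,
      sum_wordKernel_mul, pow_succ (Fintype.card Γ : ℂ) k]
    ring_nf

theorem inducedFrob_apply (ι : Γ →* Perm X) (θ : Γ →* ℂ) (N : ℕ) :
    inducedFrob ι θ N = (Fintype.card Γ : ℂ)⁻¹ •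
      ∑ u : X → Fin N, wordMonomial u * MvPolynomial.C (wordKernel ι θ u u) := by
  rw [inducedFrob, Pi.smul_apply, Finset.sum_apply]
  congr 1
  simp only [wordKernel, map_sum, Finset.mul_sum]
  rw [Finset.sum_comm]
  refine Finset.sum_congr rfl fun γ _ => ?_
  rw [Pi.smul_apply, p_partition_apply, Finset.smul_sum]
  refine Finset.sum_congr rfl fun u _ => ?_
  split_ifs
  · rw [MvPolynomial.smul_eq_C_mul, mul_comm]; rfl
  · simp

theorem trace_pow_wordMatrix (ι : Γ →* Perm X) (θ : Γ →* ℂ) (N k : ℕ) (hk : k ≠ 0) :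
    (Matrix.of (fun u v : X → Fin N =>
      wordMonomial u * MvPolynomial.C (wordKernel ι θ u v)) ^ k).trace =
      (Fintype.card Γ : MvPolynomial (Fin N) ℂ) ^ k * adams k (inducedFrob ι θ) N := by
  obtain ⟨k, rfl⟩ := Nat.exists_eq_succ_of_ne_zero hk
  have hc : (Fintype.card Γ : ℂ) ≠ 0 := Nat.cast_ne_zero.mpr Fintype.card_ne_zero
  rw [Matrix.trace, adams, inducedFrob_apply, map_smul, map_sum, Finset.smul_sum, Finset.mul_sum]
  refine Finset.sum_congr rfl fun u _ => ?_
  rw [Matrix.diag_apply, pow_wordMatrix, map_mul (MvPolynomial.expand _), MvPolynomial.expand_C, wordMonomial, map_prod,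
    ← Finset.prod_pow]
  simp only [MvPolynomial.expand_X]
  rw [MvPolynomial.smul_eq_C_mul, ← map_natCast (MvPolynomial.C (σ := Fin N) (R := ℂ)), ← map_pow]
  rw [mul_left_comm (MvPolynomial.C _ ) (Finset.prod _ _), mul_left_comm (MvPolynomial.C _ ) (Finset.prod _ _),
    ← map_mul, ← map_mul]
  congr 2
  rw [pow_succ]
  field_simp

theorem prod_map_pow_right {R : Type*} [CommMonoid R] (a : R) (s : Multiset ℕ) :
    (s.map fun k => a ^ k).prod = a ^ s.sum := by
  induction s using Multiset.induction_on with
  | empty => simp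
  | cons k s ih => simp [ih, pow_add]

theorem prod_map_apply {R : ℕ → Type*} [∀ N, CommRing (R N)] (f : ℕ → ∀ N, R N) (s : Multiset ℕ)
    (N : ℕ) : (s.map f).prod N = (s.map fun k => f k N).prod := by
  induction s using Multiset.induction_on with
  | empty => simp
  | cons k s ih => simp [ih]

/-- The plethysm `e_m[f]`. -/
def exteriorPleth (m : ℕ) (f : SymFn) : SymFn :=
  ∑ lam : m.Partition, ((-1 : ℂ) ^ (m - lam.parts.card) * (zee lam : ℂ)⁻¹) •
    (lam.parts.map fun k => adams k f).prod

/-- A colouring of `Fin m × X` is a colouring of `Fin m` by words on `X`. Summing over the base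
group makes the weight a product of kernels along the arrows of `τ`, so `sum_prod_perm` yields one
trace for each cycle. -/
theorem sum_wreathChar (ι : Γ →* Perm X) (θ : Γ →* ℂ) (m : ℕ) (τ : Perm (Fin m)) (N : ℕ) :
    ∑ c : Fin m → Γ, (∏ j, θ (c j)) • p (wreathHom ι m ⟨c, τ⟩).partition N =
      (τ.partition.parts.map fun k =>
        (Fintype.card Γ : MvPolynomial (Fin N) ℂ) ^ k * adams k (inducedFrob ι θ) N).prod := by
  have h0 : τ.partition.parts.map (fun k =>
      (Fintype.card Γ : MvPolynomial (Fin N) ℂ) ^ k * adams k (inducedFrob ι θ) N) =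
      τ.partition.parts.map fun k => (Matrix.of (fun u v : X → Fin N =>
        wordMonomial u * MvPolynomial.C (wordKernel ι θ u v)) ^ k).trace :=
    Multiset.map_congr rfl fun k hk =>
      (trace_pow_wordMatrix ι θ N k (τ.partition.parts_pos hk).ne').symm
  rw [h0, ← sum_prod_perm _ _ rfl τ]
  have h1 : ∀ c : Fin m → Γ, (∏ j, θ (c j)) • p (wreathHom ι m ⟨c, τ⟩).partition N =
      ∑ w : Fin m → X → Fin N, (∏ j, wordMonomial (w j)) * MvPolynomial.C
        (∏ j, if ∀ x, w (τ j) (ι (c (τ j)) x) = w j x then θ (c (τ j)) else 0) := by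
    intro c
    rw [p_partition_apply, Finset.smul_sum, ← (Equiv.curry (Fin m) X (Fin N)).symm.sum_comp]
    refine Finset.sum_congr rfl fun w _ => ?_
    rw [Finset.prod_ite_zero, Equiv.prod_comp τ fun j => θ (c j)]
    have h2 : (∀ jx : Fin m × X, (Equiv.curry (Fin m) X (Fin N)).symm w
        (wreathHom ι m ⟨c, τ⟩ jx) = (Equiv.curry (Fin m) X (Fin N)).symm w jx) ↔
        ∀ j ∈ Finset.univ, ∀ x, w (τ j) (ι (c (τ j)) x) = w j x := by
      simp only [Prod.forall, Finset.mem_univ, true_implies]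
      rfl
    by_cases h3 : ∀ j ∈ Finset.univ, ∀ x, w (τ j) (ι (c (τ j)) x) = w j x
    · rw [if_pos h3, if_pos (h2.mpr h3), MvPolynomial.smul_eq_C_mul, mul_comm, Fintype.prod_prod_type]
      rfl
    · rw [if_neg h3, if_neg (mt h2.mp h3), smul_zero, map_zero, mul_zero]
  rw [Finset.sum_congr rfl fun c _ => h1 c, Finset.sum_comm]
  refine Finset.sum_congr rfl fun w _ => ?_
  rw [← Finset.mul_sum, Finset.prod_mul_distrib, ← map_sum, ← map_prod]
  congr 2
  -- The base coordinates are shifted by `τ` so that the factor at `j` involves only the `j`-th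
  -- coordinate and the sum becomes a product.
  rw [← (Equiv.arrowCongr τ (Equiv.refl Γ)).sum_comp]
  simp only [wordKernel]
  rw [Finset.prod_univ_sum, Fintype.piFinset_univ]
  refine Finset.sum_congr rfl fun c _ => Finset.prod_congr rfl fun j _ => ?_
  simp [Equiv.arrowCongr]

/-- Averaging `sum_wreathChar` over `τ` with sign gives `e_m = ∑ ± z_λ⁻¹ p_λ` applied to the induced
characteristic; the order `|Γ| ^ m m!` of the wreath product cancels both normalisations. -/
theorem exteriorPleth_inducedFrob (ι : Γ →* Perm X) (θ : Γ →* ℂ) (m : ℕ) :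
    exteriorPleth m (inducedFrob ι θ) = inducedFrob (wreathHom ι m) (wreathChar θ m) := by
  have hm : (m.factorial : ℂ) ≠ 0 := Nat.cast_ne_zero.mpr m.factorial_ne_zero
  have hc : (Fintype.card Γ : ℂ) ≠ 0 := Nat.cast_ne_zero.mpr Fintype.card_ne_zero
  funext N
  have h1 : ∑ g : Wreath Γ m, (wreathChar θ m g • p (wreathHom ι m g).partition) N =
      ∑ τ : Perm (Fin m), ((Perm.sign τ : ℤ) : ℂ) • ((Fintype.card Γ : ℂ) ^ m •
        (τ.partition.parts.map fun k => adams k (inducedFrob ι θ)).prod N) := by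
    rw [← SemidirectProduct.equivProd.symm.sum_comp, Fintype.sum_prod_type_right]
    refine Finset.sum_congr rfl fun τ _ => ?_
    have h2 := sum_wreathChar ι θ m τ N
    rw [Multiset.prod_map_mul, prod_map_pow_right,
      τ.partition.parts_sum.trans (Fintype.card_fin m)] at h2
    rw [prod_map_apply, MvPolynomial.smul_eq_C_mul (a := (Fintype.card Γ : ℂ) ^ m), map_pow, map_natCast, ← h2, Finset.smul_sum]
    refine Finset.sum_congr rfl fun c _ => ?_
    rw [smul_smul, mul_comm]
    rfl
  have h4 := sum_perm_eq_sum_partition (Fintype.card_fin m) fun lam : m.Partition =>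
    (-1 : ℂ) ^ (m - lam.parts.card) • (lam.parts.map fun k => adams k (inducedFrob ι θ)).prod N
  have h6 : inducedFrob (wreathHom ι m) (wreathChar θ m) N = (Fintype.card (Wreath Γ m) : ℂ)⁻¹ •
      ∑ g : Wreath Γ m, (wreathChar θ m g • p (wreathHom ι m g).partition) N := by
    rw [inducedFrob, Pi.smul_apply, Finset.sum_apply]
  symm
  rw [h6, h1, card_wreath, exteriorPleth, Finset.sum_apply]
  have h5 : ∀ τ : Perm (Fin m), ((Perm.sign τ : ℤ) : ℂ) • ((Fintype.card Γ : ℂ) ^ m •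
        (τ.partition.parts.map fun k => adams k (inducedFrob ι θ)).prod N) =
      (Fintype.card Γ : ℂ) ^ m • ((-1 : ℂ) ^ (m - (cyclePartition (Fintype.card_fin m) τ).parts.card) •
        ((cyclePartition (Fintype.card_fin m) τ).parts.map fun k =>
          adams k (inducedFrob ι θ)).prod N) := by
    intro τ
    rw [smul_comm, sign_eq_pow (Fintype.card_fin m)]
    push_cast
    rfl
  rw [Finset.sum_congr rfl fun τ _ => h5 τ, ← Finset.smul_sum, h4, smul_smul, smul_smul]
  push_cast
  rw [mul_inv_rev, mul_assoc, mul_assoc, ← mul_assoc _ _ (m.factorial : ℂ), inv_mul_cancel₀ (pow_ne_zero m hc), one_mul,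
    inv_mul_cancel₀ hm, one_smul]
  refine Finset.sum_congr rfl fun lam _ => ?_
  rw [Pi.smul_apply, smul_smul, mul_comm]

theorem exteriorPleth_mem_monomialFrob (ι : Γ →* Perm X) (θ : Γ →* ℂ) (m : ℕ) :
    exteriorPleth m (inducedFrob ι θ) ∈ monomialFrob (m * Fintype.card X) := by
  rw [exteriorPleth_inducedFrob]
  exact inducedFrob_mem _ _ (by rw [Fintype.card_prod, Fintype.card_fin])

end Wreath

/-! ### Logarithmic derivatives of generating functions of partitions -/

section GenFun

open PowerSeries
open scoped PowerSeries.WithPiTopology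

variable {R : Type*} [CommRing R]

theorem one_add_tsum_eq_expand [TopologicalSpace R] [T2Space R] (f : ℕ → ℕ → R)
    (hf : ∀ i, f i 0 = 1) (i : ℕ) :
    1 + ∑' j, f (i + 1) (j + 1) • (X : R⟦X⟧) ^ ((i + 1) * (j + 1)) =
      expand (i + 1) i.succ_ne_zero (mk (f (i + 1))) := by
  ext n
  rw [map_add, (Nat.Partition.summable_genFun_term f i).map_tsum _
    (WithPiTopology.continuous_coeff _ _), coeff_expand, coeff_one]
  simp only [map_smul, coeff_X_pow, smul_eq_mul, mul_ite, mul_one, mul_zero, coeff_mk]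
  by_cases h : (i + 1) ∣ n
  · obtain ⟨m, rfl⟩ := h
    rw [if_pos (dvd_mul_right _ _), Nat.mul_div_cancel_left _ i.succ_pos]
    cases m with
    | zero => simp [hf]
    | succ m =>
      rw [tsum_eq_single m, if_pos rfl, if_neg (by positivity), zero_add]
      intro j hj
      refine if_neg fun h => hj ?_
      have := Nat.eq_of_mul_eq_mul_left i.succ_pos h
      omega
  · rw [if_neg h, if_neg (fun h0 : n = 0 => h (h0 ▸ dvd_zero _)), zero_add]
    convert tsum_zero with j
    exact if_neg fun h0 : n = (i + 1) * (j + 1) => h (h0 ▸ dvd_mul_right _ _)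

/-- For the discrete topology on `R`, coefficientwise convergence of the infinite product means that
each coefficient is eventually constant. This reduces identities for `genFun` to finite products. -/
theorem exists_coeff_prod_expand (f : ℕ → ℕ → R) (hf : ∀ i, f i 0 = 1) (n : ℕ) :
    ∃ s₀ : Finset ℕ, ∀ s, s₀ ⊆ s → ∀ k ≤ n,
      coeff k (∏ i ∈ s, expand (i + 1) i.succ_ne_zero (mk (f (i + 1)))) =
        coeff k (Nat.Partition.genFun f) := by
  let _ : TopologicalSpace R := ⊥
  have _ : DiscreteTopology R := ⟨rfl⟩
  have h1 := Nat.Partition.hasProd_genFun f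
  rw [HasProd, WithPiTopology.tendsto_iff_coeff_tendsto] at h1
  have h2 : ∀ k, ∀ᶠ s : Finset ℕ in Filter.atTop,
      coeff k (∏ i ∈ s, expand (i + 1) i.succ_ne_zero (mk (f (i + 1)))) =
        coeff k (Nat.Partition.genFun f) := by
    intro k
    have h3 := h1 k
    rw [SummationFilter.unconditional_filter, nhds_discrete, Filter.tendsto_pure] at h3
    filter_upwards [h3] with s hs
    rw [← hs]
    exact congrArg _ (Finset.prod_congr rfl fun i _ => (one_add_tsum_eq_expand f hf i).symm)
  have h4 : ∀ᶠ s : Finset ℕ in Filter.atTop, ∀ k ∈ Finset.range (n + 1),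
      coeff k (∏ i ∈ s, expand (i + 1) i.succ_ne_zero (mk (f (i + 1)))) =
        coeff k (Nat.Partition.genFun f) :=
    (Filter.eventually_all_finset _).mpr fun k _ => h2 k
  obtain ⟨s₀, hs₀⟩ := Filter.eventually_atTop.mp h4
  exact ⟨s₀, fun s hs k hk => hs₀ s hs k (Finset.mem_range.mpr (Nat.lt_succ_of_le hk))⟩

/-- An additive map is a derivation if it satisfies the Leibniz rule. -/
def IsDerivation {A : Type*} [CommRing A] (δ : A →+ A) : Prop :=
  ∀ a b, δ (a * b) = a * δ b + b * δ a

theorem IsDerivation.map_one {A : Type*} [CommRing A] {δ : A →+ A} (hδ : IsDerivation δ) :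
    δ 1 = 0 := by
  have h1 := hδ 1 1
  rwa [one_mul, one_mul, left_eq_add] at h1

theorem IsDerivation.map_pow {A : Type*} [CommRing A] {δ : A →+ A} (hδ : IsDerivation δ) (a : A)
    (n : ℕ) : δ (a ^ (n + 1)) = (n + 1) * a ^ n * δ a := by
  induction n with
  | zero => simp
  | succ n ih =>
    rw [pow_succ, hδ, ih]
    push_cast
    ring

theorem IsDerivation.map_mul_of_log {A : Type*} [CommRing A] {δ : A →+ A} (hδ : IsDerivation δ)
    {x y b c : A} (hx : δ x = b * x) (hy : δ y = c * y) : δ (x * y) = (b + c) * (x * y) := by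
  rw [hδ, hx, hy]
  ring

theorem IsDerivation.map_prod {A ι : Type*} [CommRing A] {δ : A →+ A} (hδ : IsDerivation δ)
    (s : Finset ι) (g b : ι → A) (h : ∀ i ∈ s, δ (g i) = b i * g i) :
    δ (∏ i ∈ s, g i) = (∑ i ∈ s, b i) * ∏ i ∈ s, g i := by
  induction s using Finset.induction_on with
  | empty => simp [hδ.map_one]
  | insert i s hi ih =>
    rw [Finset.prod_insert hi, Finset.sum_insert hi, hδ,
      ih fun j hj => h j (Finset.mem_insert_of_mem hj), h i (Finset.mem_insert_self i s)]
    ring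

/-- The logarithmic derivative of the generating function of a multiplicative function of
partitions, for a derivation acting coefficientwise. -/
theorem derivation_genFun {δ : R⟦X⟧ →+ R⟦X⟧} (h : IsDerivation δ) (d : ℕ → R → R)
    (hδ : ∀ n f, coeff n (δ f) = d n (coeff n f)) (f : ℕ → ℕ → R) (hf : ∀ i, f i 0 = 1)
    (b : ℕ → R⟦X⟧) (hb : ∀ i : ℕ, δ (expand (i + 1) i.succ_ne_zero (mk (f (i + 1)))) =
      b (i + 1) * expand (i + 1) i.succ_ne_zero (mk (f (i + 1))))
    (hb0 : ∀ i a, a < i → coeff a (b i) = 0) :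
    δ (Nat.Partition.genFun f) =
      (mk fun a => ∑ i ∈ Finset.Icc 1 a, coeff a (b i)) * Nat.Partition.genFun f := by
  ext n
  obtain ⟨s₀, hs₀⟩ := exists_coeff_prod_expand f hf n
  -- Adjoining `range n` includes every part of size at most `n`, so that the sum of the `b i` over
  -- this set is complete up to degree `n`.
  have h1 := hs₀ (s₀ ∪ Finset.range n) Finset.subset_union_left
  have h3 := h.map_prod (s₀ ∪ Finset.range n) _ (fun i => b (i + 1)) fun i _ => hb i
  rw [hδ, ← h1 n le_rfl, ← hδ, h3, coeff_mul, coeff_mul]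
  refine Finset.sum_congr rfl fun x hx => ?_
  have hx' := Finset.HasAntidiagonal.mem_antidiagonal.mp hx
  rw [h1 x.2 (by omega), coeff_mk, map_sum]
  congr 1
  have h2 : Finset.Icc 1 x.1 = (Finset.range x.1).map (addRightEmbedding 1) := by
    rw [Finset.range_eq_Ico, Finset.map_add_right_Ico]
    rfl
  rw [h2, Finset.sum_map]
  symm
  refine Finset.sum_subset (fun i hi => Finset.mem_union_right _ (Finset.mem_range.mpr ?_))
    fun i _ hi => hb0 _ _ ?_
  · have := Finset.mem_range.mp hi
    omega
  · rw [Finset.mem_range] at hi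
    change x.1 < i + 1
    omega

variable (R) in
/-- The derivation `X d/dX`. -/
def eulerDeriv : R⟦X⟧ →+ R⟦X⟧ := AddMonoidHom.mk' (fun f => X * d⁄dX R f) fun f g => by
  rw [map_add, mul_add]

theorem isDerivation_eulerDeriv : IsDerivation (eulerDeriv R) := fun f g => by
  change X * d⁄dX R (f * g) = f * (X * d⁄dX R g) + g * (X * d⁄dX R f)
  rw [Derivation.leibniz, smul_eq_mul, smul_eq_mul]
  ring

theorem coeff_eulerDeriv (n : ℕ) (f : R⟦X⟧) : coeff n (eulerDeriv R f) = n * coeff n f := by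
  change coeff n (X * d⁄dX R f) = _
  cases n with
  | zero => simp
  | succ n => rw [coeff_succ_X_mul, coeff_derivative, mul_comm]; push_cast; rfl

/-- An additive map of the coefficients, acting on power series. -/
def mapCoeff (D : R →+ R) : R⟦X⟧ →+ R⟦X⟧ :=
  AddMonoidHom.mk' (fun f => PowerSeries.mk fun n => D (coeff n f)) fun f g => by ext; simp

theorem coeff_mapCoeff (D : R →+ R) (n : ℕ) (f : R⟦X⟧) :
    coeff n (mapCoeff D f) = D (coeff n f) :=
  coeff_mk n fun n => D (coeff n f)

theorem IsDerivation.mapCoeff {D : R →+ R} (hD : IsDerivation D) : IsDerivation (mapCoeff D) := by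
  intro f g
  ext n
  simp only [coeff_mapCoeff, coeff_mul, map_add, map_sum, hD _ _, Finset.sum_add_distrib]
  congr 1
  rw [← Finset.Nat.sum_antidiagonal_swap]
  rfl

theorem mapCoeff_expand (D : R →+ R) (i : ℕ) (hi : i ≠ 0) (f : R⟦X⟧) :
    mapCoeff D (expand i hi f) = expand i hi (mapCoeff D f) := by
  ext n
  rw [coeff_mapCoeff, coeff_expand, coeff_expand, apply_ite D, map_zero, coeff_mapCoeff]

theorem eulerDeriv_expand (i : ℕ) (hi : i ≠ 0) (f : R⟦X⟧) :
    eulerDeriv R (expand i hi f) = i * expand i hi (eulerDeriv R f) := by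
  ext n
  rw [coeff_eulerDeriv, ← map_natCast (C (R := R)), coeff_C_mul, coeff_expand, coeff_expand]
  split_ifs with h
  · rw [coeff_eulerDeriv, ← mul_assoc, ← Nat.cast_mul, Nat.mul_div_cancel' h]
  · simp

theorem coeff_zero_mul (f g : R⟦X⟧) : coeff 0 (f * g) = coeff 0 f * coeff 0 g := by
  simp only [coeff_zero_eq_constantCoeff_apply, map_mul]

/-- Solutions of `X y' = b y` are determined by their constant term. -/
theorem coeff_eq_of_eulerDeriv [Algebra ℚ R] {y y' b b' : R⟦X⟧} (h : eulerDeriv R y = b * y)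
    (h' : eulerDeriv R y' = b' * y') (h0 : coeff 0 y = coeff 0 y') (n : ℕ)
    (hb : ∀ i ≤ n, coeff i b = coeff i b') (hb0 : coeff 0 b = 0) :
    ∀ j ≤ n, coeff j y = coeff j y' := by
  intro j
  induction j using Nat.strong_induction_on with
  | _ j ih =>
    intro hj
    rcases Nat.eq_zero_or_pos j with rfl | hj0
    · exact h0
    have h1 : (j : R) * coeff j y = j * coeff j y' := by
      -- Since `b` has no constant term, the coefficient `j` of `b * y` involves only earlier
      -- coefficients of `y`; the factor `j` is then cancelled using the rational scalars.
      rw [← coeff_eulerDeriv, ← coeff_eulerDeriv, h, h', coeff_mul, coeff_mul]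
      refine Finset.sum_congr rfl fun x hx => ?_
      have hx' := Finset.HasAntidiagonal.mem_antidiagonal.mp hx
      rw [← hb x.1 (by omega)]
      rcases Nat.eq_zero_or_pos x.1 with h2 | h2
      · rw [h2, hb0, zero_mul, zero_mul]
      · rw [ih x.2 (by omega) (by omega)]
    have h2 : IsUnit (j : R) := by
      have := (IsUnit.mk0 (j : ℚ) (by positivity)).map (algebraMap ℚ R)
      rwa [map_natCast] at this
    exact h2.mul_left_cancel h1

end GenFun

/-! ### The logarithmic derivative of a plethysm -/

section Pleth

open PowerSeries

/-- A nonzero term has `k ≤ i` and `s ≤ j`, hence `k + s ≤ i + j`, so the truncated double sum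
contains the whole rectangle. -/
theorem sum_range_sum_antidiagonal {R : Type*} [CommRing R] (u v : ℕ → R) (i j : ℕ) (hu : ∀ k, i < k → u k = 0)
    (hv : ∀ s, j < s → v s = 0) :
    ∑ r ∈ Finset.range (i + j + 1), ∑ x ∈ Finset.HasAntidiagonal.antidiagonal r, u x.1 * v x.2 =
      (∑ k ∈ Finset.range (i + 1), u k) * ∑ s ∈ Finset.range (j + 1), v s := by
  rw [Finset.sum_mul_sum, ← Finset.sum_product', Finset.sum_sigma']
  symm
  refine Finset.sum_of_injOn (fun x => ⟨x.1 + x.2, x⟩) ?_ ?_ ?_ ?_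
  · intro x _ y _ hxy
    simpa using (Sigma.mk.inj_iff.mp hxy).2
  · intro x hx
    simp only [Finset.coe_product, Set.mem_prod, Finset.mem_coe, Finset.mem_range] at hx
    simp
    omega
  · rintro ⟨r, x⟩ hx hx'
    simp only [Finset.mem_sigma, Finset.mem_range, Finset.HasAntidiagonal.mem_antidiagonal] at hx
    by_cases h1 : i < x.1
    · rw [hu _ h1, zero_mul]
    by_cases h2 : j < x.2
    · rw [hv _ h2, mul_zero]
    refine absurd ?_ hx'
    obtain ⟨h3, rfl⟩ := hx
    refine ⟨x, ?_, rfl⟩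
    simp
    omega
  · intro x _
    rfl

variable {A : Type*} [CommRing A] [Algebra ℂ A]

/-- The complete homogeneous symmetric function `h_r` evaluated at the power sums `a 1, a 2, …`. -/
def powerPleth (a : ℕ → A) (r : ℕ) : A :=
  ∑ lam : r.Partition, ((zee lam : ℂ)⁻¹) • (lam.parts.map a).prod

/-- The weight of a part of given multiplicity in `powerPleth`. -/
def plethWeight (a : ℕ → A) (k m : ℕ) : A := ((k ^ m * m.factorial : ℕ) : ℂ)⁻¹ • a k ^ m

/-- Packs all `h_r` into `∑ h_r u ^ r = ∏_k exp (a_k u ^ k / k)`, a generating function of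
partitions to which `derivation_genFun` applies. -/
theorem genFun_plethWeight (a : ℕ → A) :
    Nat.Partition.genFun (plethWeight a) = PowerSeries.mk (powerPleth a) := by
  ext r
  rw [Nat.Partition.coeff_genFun, coeff_mk, powerPleth]
  refine Finset.sum_congr rfl fun lam _ => ?_
  rw [Finset.prod_multiset_map_count, Finsupp.prod, Multiset.toFinsupp_support]
  simp only [Multiset.toFinsupp_apply, plethWeight, zee]
  rw [Nat.cast_prod, ← Finset.prod_inv_distrib, Finset.prod_smul]

theorem mapCoeff_plethWeight {D : A →+ A} (hD : IsDerivation D) (a : ℕ → A) (k : ℕ) :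
    mapCoeff D (PowerSeries.mk (plethWeight a k)) =
      C ((k : ℂ)⁻¹ • D (a k)) * X * PowerSeries.mk (plethWeight a k) := by
  ext m
  rw [coeff_mapCoeff, coeff_mk, mul_assoc, coeff_C_mul]
  cases m with
  | zero => simp [plethWeight, hD.map_one]
  | succ m =>
    rw [coeff_succ_X_mul, coeff_mk, plethWeight, plethWeight, map_inv_natCast_smul D ℂ ℂ, hD.map_pow,
      smul_mul_smul_comm]
    have h1 : ((m : A) + 1) * a k ^ m * D (a k) = ((m : ℂ) + 1) • (D (a k) * a k ^ m) := by
      rw [Algebra.smul_def, map_add, map_one, map_natCast]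
      ring
    rw [h1, smul_smul]
    congr 1
    have h2 : (m : ℂ) + 1 ≠ 0 := Nat.cast_add_one_ne_zero m
    push_cast [Nat.factorial_succ]
    rw [pow_succ]
    -- For `k = 0` both sides vanish, the inverse of `0` being `0`.
    rcases eq_or_ne (k : ℂ) 0 with h3 | h3
    · simp [h3]
    · have h4 : (m.factorial : ℂ) ≠ 0 := Nat.cast_ne_zero.mpr m.factorial_ne_zero
      field_simp

/-- The logarithmic derivative of `exp (∑ a_k u ^ k / k)` is `∑ D(a_k) u ^ k / k`; this is its
coefficient at `u ^ r`. -/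
theorem derivation_powerPleth {D : A →+ A} (hD : IsDerivation D) (a : ℕ → A) (r : ℕ) :
    D (powerPleth a r) = ∑ x ∈ Finset.HasAntidiagonal.antidiagonal r,
      (if x.1 = 0 then 0 else (x.1 : ℂ)⁻¹ • D (a x.1)) * powerPleth a x.2 := by
  have h1 := derivation_genFun hD.mapCoeff (fun _ => D) (coeff_mapCoeff D) (plethWeight a)
    (fun i => by simp [plethWeight]) (fun i => C ((i : ℂ)⁻¹ • D (a i)) * X ^ i)
    (fun i => by
      rw [mapCoeff_expand, mapCoeff_plethWeight hD, map_mul, map_mul, expand_C, expand_X])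
    fun i b hb => by rw [coeff_C_mul, coeff_X_pow, if_neg hb.ne, mul_zero]
  rw [genFun_plethWeight] at h1
  have h2 := congrArg (coeff r) h1
  rw [coeff_mapCoeff, coeff_mk, coeff_mul] at h2
  rw [h2]
  refine Finset.sum_congr rfl fun x _ => ?_
  rw [coeff_mk, coeff_mk]
  congr 1
  simp only [coeff_C_mul, coeff_X_pow, mul_ite, mul_one, mul_zero]
  rw [Finset.sum_ite_eq]
  by_cases hx : x.1 = 0
  · simp [hx]
  · rw [if_pos (Finset.mem_Icc.mpr ⟨Nat.one_le_iff_ne_zero.mpr hx, le_rfl⟩), if_neg hx]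

variable {R : Type*} [CommRing R] [Algebra ℂ R]

theorem coeff_powerPleth_eq_zero {a : ℕ → R⟦X⟧} (ha : ∀ k j, j < k → coeff j (a k) = 0) {r j : ℕ}
    (hj : j < r) : coeff j (powerPleth a r) = 0 := by
  have h1 : ∀ s : Multiset ℕ, (X : R⟦X⟧) ^ s.sum ∣ (s.map a).prod := by
    intro s
    induction s using Multiset.induction_on with
    | empty => simp
    | cons k s ih =>
      rw [Multiset.sum_cons, Multiset.map_cons, Multiset.prod_cons, pow_add]
      exact mul_dvd_mul (X_pow_dvd_iff.mpr (ha k)) ih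
  rw [powerPleth, map_sum]
  refine Finset.sum_eq_zero fun lam _ => ?_
  have h2 := h1 lam.parts
  rw [lam.parts_sum, X_pow_dvd_iff] at h2
  rw [coeff_smul, h2 j hj, smul_zero]

/-- The sum over `r` of `powerPleth a r`, for series `a k` of order at least `k`. -/
def powerPlethSeries (a : ℕ → R⟦X⟧) : R⟦X⟧ :=
  PowerSeries.mk fun n => ∑ r ∈ Finset.range (n + 1), coeff n (powerPleth a r)

/-- Summation of `derivation_powerPleth` over `r`, with `D = X d/dX`. The order condition on `a`
makes the truncated sums over `r` exact. -/
theorem eulerDeriv_powerPlethSeries {a : ℕ → R⟦X⟧} (ha : ∀ k j, j < k → coeff j (a k) = 0) :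
    eulerDeriv R (powerPlethSeries a) =
      (PowerSeries.mk fun n => ∑ k ∈ Finset.Icc 1 n, ((n : ℂ) / k) • coeff n (a k)) *
        powerPlethSeries a := by
  ext n
  let B : ℕ → R⟦X⟧ := fun k => if k = 0 then 0 else (k : ℂ)⁻¹ • eulerDeriv R (a k)
  have hB : ∀ k j, j < k → coeff j (B k) = 0 := by
    intro k j hj
    simp only [B]
    split_ifs
    · simp
    · rw [coeff_smul, coeff_eulerDeriv, ha k j hj, mul_zero, smul_zero]
  have h1 : ∀ r, coeff n (eulerDeriv R (powerPleth a r)) = ∑ x ∈ Finset.HasAntidiagonal.antidiagonal n,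
      ∑ y ∈ Finset.HasAntidiagonal.antidiagonal r, coeff x.1 (B y.1) * coeff x.2 (powerPleth a y.2) := by
    intro r
    rw [derivation_powerPleth isDerivation_eulerDeriv, map_sum, Finset.sum_comm]
    exact Finset.sum_congr rfl fun y _ => coeff_mul _ _ _
  rw [coeff_eulerDeriv, powerPlethSeries, coeff_mk, Finset.mul_sum, coeff_mul]
  simp only [← coeff_eulerDeriv]
  rw [Finset.sum_congr rfl fun r _ => h1 r, Finset.sum_comm]
  refine Finset.sum_congr rfl fun x hx => ?_
  obtain rfl := Finset.HasAntidiagonal.mem_antidiagonal.mp hx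
  rw [sum_range_sum_antidiagonal (fun k => coeff x.1 (B k)) (fun s => coeff x.2 (powerPleth a s)) x.1
    x.2 (fun k hk => hB k _ hk) fun s hs => coeff_powerPleth_eq_zero ha hs, coeff_mk, coeff_mk]
  congr 1
  rw [Finset.range_eq_Ico, Finset.sum_eq_sum_Ico_succ_bot x.1.succ_pos]
  simp only [B, if_pos, map_zero, zero_add]
  refine Finset.sum_congr rfl fun k hk => ?_
  rw [if_neg (by have := (Finset.mem_Ico.mp hk).1; omega), coeff_smul, coeff_eulerDeriv,
    div_eq_inv_mul, mul_smul, Algebra.smul_def (x.1 : ℂ), map_natCast]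

end Pleth

/-! ### Plethystic exponentials -/

section Exponential

open PowerSeries

variable {F G : PowerSeries SymFn}

theorem coeff_adamsSeries (k n : ℕ) (F : PowerSeries SymFn) :
    coeff n (adamsSeries k F) = if k ∣ n then adams k (coeff (n / k) F) else 0 := coeff_mk _ _

/-- The substitution `p_k[·]` as a ring homomorphism. -/
def adamsHom (k : ℕ) : SymFn →+* SymFn where
  toFun := adams k
  map_zero' := funext fun _ => map_zero _
  map_one' := funext fun _ => map_one _
  map_add' _ _ := funext fun _ => map_add _ _ _
  map_mul' _ _ := funext fun _ => map_mul _ _ _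

theorem adams_add (k : ℕ) (f g : SymFn) : adams k (f + g) = adams k f + adams k g :=
  (adamsHom k).map_add f g

theorem adams_smul (k : ℕ) (c : ℂ) (f : SymFn) : adams k (c • f) = c • adams k f :=
  funext fun N => map_smul (MvPolynomial.expand k) c (f N)

theorem coeff_adamsSeries_eq_zero (hF : coeff 0 F = 0) (k j : ℕ) (hj : j < k) :
    coeff j (adamsSeries k F) = 0 := by
  rw [coeff_adamsSeries]
  split_ifs with h
  · rw [Nat.eq_zero_of_dvd_of_lt h hj, Nat.zero_div, hF]
    exact (adamsHom k).map_zero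
  · rfl

/-- The sign is multiplicative over the parts, so `e_r` is `h_r` with `p_k` replaced by `(-1) ^ (k -
1) p_k`, and one computation serves both plethysms. -/
theorem pow_sub_card_eq_prod (r : ℕ) (lam : r.Partition) :
    (-1 : ℂ) ^ (r - lam.parts.card) = (lam.parts.map fun k => (-1 : ℂ) ^ (k - 1)).prod := by
  have h1 : ∀ s : Multiset ℕ, (∀ k ∈ s, 0 < k) →
      s.card ≤ s.sum ∧ (-1 : ℂ) ^ (s.sum - s.card) = (s.map fun k => (-1 : ℂ) ^ (k - 1)).prod := by
    intro s
    induction s using Multiset.induction_on with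
    | empty => simp
    | cons k s ih =>
      intro hs
      obtain ⟨h1, h2⟩ := ih fun l hl => hs l (Multiset.mem_cons_of_mem hl)
      have h3 := hs k (Multiset.mem_cons_self k s)
      rw [Multiset.sum_cons, Multiset.card_cons, Multiset.map_cons, Multiset.prod_cons, ← h2,
        ← pow_add]
      exact ⟨by omega, by congr 1; omega⟩
  have h2 := (h1 lam.parts fun k hk => lam.parts_pos hk).2
  rwa [lam.parts_sum] at h2

theorem prod_map_smul {R : Type*} [CommRing R] [Algebra ℂ R] (c : ℕ → ℂ) (a : ℕ → R)
    (s : Multiset ℕ) : (s.map fun k => c k • a k).prod = (s.map c).prod • (s.map a).prod := by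
  induction s using Multiset.induction_on with
  | empty => simp
  | cons k s ih => simp only [Multiset.map_cons, Multiset.prod_cons, ih, smul_mul_smul_comm]

theorem ePleth_eq_powerPleth (r : ℕ) (F : PowerSeries SymFn) :
    ePleth r F = powerPleth (fun k => (-1 : ℂ) ^ (k - 1) • adamsSeries k F) r := by
  refine Finset.sum_congr rfl fun lam _ => ?_
  rw [prod_map_smul, smul_smul, ← pow_sub_card_eq_prod, mul_comm]

theorem HPleth_eq_powerPlethSeries (F : PowerSeries SymFn) :
    HPleth F = powerPlethSeries fun k => adamsSeries k F := rfl

theorem EPleth_eq_powerPlethSeries (F : PowerSeries SymFn) :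
    EPleth F = powerPlethSeries fun k => (-1 : ℂ) ^ (k - 1) • adamsSeries k F := by
  simp only [EPleth, ePleth_eq_powerPleth]
  rfl

theorem coeff_zero_powerPlethSeries {R : Type*} [CommRing R] [Algebra ℂ R] (a : ℕ → PowerSeries R) :
    coeff 0 (powerPlethSeries a) = 1 := by
  rw [powerPlethSeries, coeff_mk, zero_add, Finset.sum_range_one, powerPleth]
  simp [zee]

theorem sum_Icc_adamsSeries (c : ℕ → ℂ) (F : PowerSeries SymFn) (n : ℕ) :
    ∑ k ∈ Finset.Icc 1 n, ((n : ℂ) / k) • coeff n (c k • adamsSeries k F) =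
      ∑ k ∈ n.divisors, c k • adams k (((n / k : ℕ) : ℂ) • coeff (n / k) F) := by
  have h1 : n.divisors = (Finset.Icc 1 n).filter (· ∣ n) := by
    ext k
    simp only [Nat.mem_divisors, Finset.mem_filter, Finset.mem_Icc]
    constructor
    · rintro ⟨h1, h2⟩
      exact ⟨⟨Nat.pos_of_dvd_of_pos h1 (Nat.pos_of_ne_zero h2),
        Nat.le_of_dvd (Nat.pos_of_ne_zero h2) h1⟩, h1⟩
    · rintro ⟨h1, h2⟩
      exact ⟨h2, by omega⟩
  rw [h1, Finset.sum_filter]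
  refine Finset.sum_congr rfl fun k hk => ?_
  rw [coeff_smul, coeff_adamsSeries]
  split_ifs with h
  · rw [adams_smul, Nat.cast_div h (Nat.cast_ne_zero.mpr (by
      have := (Finset.mem_Icc.mp hk).1; omega)), smul_comm]
  · rw [smul_zero, smul_zero]

theorem eulerDeriv_HPleth (hF : coeff 0 F = 0) :
    eulerDeriv SymFn (HPleth F) = (PowerSeries.mk fun n => ∑ k ∈ n.divisors,
      adams k (((n / k : ℕ) : ℂ) • coeff (n / k) F)) * HPleth F := by
  rw [HPleth_eq_powerPlethSeries, eulerDeriv_powerPlethSeries (coeff_adamsSeries_eq_zero hF)]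
  congr 2
  funext n
  have h1 := sum_Icc_adamsSeries (fun _ => 1) F n
  simpa only [one_smul] using h1

theorem eulerDeriv_EPleth (hF : coeff 0 F = 0) :
    eulerDeriv SymFn (EPleth F) = (PowerSeries.mk fun n => ∑ k ∈ n.divisors,
      (-1 : ℂ) ^ (k - 1) • adams k (((n / k : ℕ) : ℂ) • coeff (n / k) F)) * EPleth F := by
  rw [EPleth_eq_powerPlethSeries, eulerDeriv_powerPlethSeries fun k j hj => by
    rw [coeff_smul, coeff_adamsSeries_eq_zero hF k j hj, smul_zero]]
  congr 2
  funext n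
  exact sum_Icc_adamsSeries (fun k => (-1 : ℂ) ^ (k - 1)) F n

theorem coeff_zero_HPleth (F : PowerSeries SymFn) : coeff 0 (HPleth F) = 1 :=
  coeff_zero_powerPlethSeries _

theorem coeff_zero_EPleth (F : PowerSeries SymFn) : coeff 0 (EPleth F) = 1 := by
  rw [EPleth_eq_powerPlethSeries, coeff_zero_powerPlethSeries]

/-- Up to degree `n` the logarithmic derivative involves only the `f_i` with `i ≤ n`. -/
theorem coeff_EPleth_congr (hF : coeff 0 F = 0) (n : ℕ) (h : ∀ i ≤ n, coeff i F = coeff i G) :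
    coeff n (EPleth F) = coeff n (EPleth G) := by
  refine coeff_eq_of_eulerDeriv (eulerDeriv_EPleth hF)
    (eulerDeriv_EPleth ((h 0 n.zero_le).symm.trans hF))
    ((coeff_zero_EPleth F).trans (coeff_zero_EPleth G).symm) n (fun i hi => ?_) (by simp) n le_rfl
  rw [coeff_mk, coeff_mk]
  exact Finset.sum_congr rfl fun k _ => by rw [h (i / k) ((Nat.div_le_self i k).trans hi)]

/-- The coefficient of `t ^ n` in the logarithmic derivative `t d/dt log E[F]`. -/
def logCoeff (F : PowerSeries SymFn) (n : ℕ) : SymFn :=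
  ∑ k ∈ n.divisors, (-1 : ℂ) ^ (k - 1) • adams k (((n / k : ℕ) : ℂ) • coeff (n / k) F)

theorem logCoeff_add (F G : PowerSeries SymFn) (n : ℕ) :
    logCoeff (F + G) n = logCoeff F n + logCoeff G n := by
  rw [logCoeff, logCoeff, logCoeff, ← Finset.sum_add_distrib]
  refine Finset.sum_congr rfl fun k _ => ?_
  rw [map_add, smul_add, adams_add, smul_add]

/-- Both sides start with `1` and have the same logarithmic derivative. -/
theorem EPleth_add (hF : coeff 0 F = 0) (hG : coeff 0 G = 0) :
    EPleth (F + G) = EPleth F * EPleth G := by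
  have h1 : eulerDeriv SymFn (EPleth F * EPleth G) =
      (PowerSeries.mk (logCoeff F) + PowerSeries.mk (logCoeff G)) * (EPleth F * EPleth G) :=
    isDerivation_eulerDeriv.map_mul_of_log (eulerDeriv_EPleth hF) (eulerDeriv_EPleth hG)
  have h2 : coeff 0 (EPleth (F + G)) = coeff 0 (EPleth F * EPleth G) := by
    rw [coeff_zero_mul, coeff_zero_EPleth, coeff_zero_EPleth, coeff_zero_EPleth, mul_one]
  have h3 : eulerDeriv SymFn (EPleth (F + G)) = PowerSeries.mk (logCoeff (F + G)) * EPleth (F + G) :=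
    eulerDeriv_EPleth (by rw [map_add, hF, hG, add_zero])
  have h4 : ∀ i, coeff i (PowerSeries.mk (logCoeff (F + G))) =
      coeff i (PowerSeries.mk (logCoeff F) + PowerSeries.mk (logCoeff G)) := fun i => by
    rw [map_add, coeff_mk, coeff_mk, coeff_mk, logCoeff_add]
  have h5 : coeff 0 (PowerSeries.mk (logCoeff (F + G))) = 0 := by
    rw [coeff_mk, logCoeff, Nat.divisors_zero, Finset.sum_empty]
  ext1 n
  exact coeff_eq_of_eulerDeriv h3 h1 h2 n (fun i _ => h4 i) h5 n le_rfl

theorem EPleth_zero : EPleth 0 = 1 := by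
  have h1 : EPleth 0 * EPleth 0 = EPleth 0 * 1 := by
    rw [← EPleth_add (map_zero _) (map_zero _), add_zero, mul_one]
  refine IsUnit.mul_left_cancel ?_ h1
  rw [isUnit_iff_constantCoeff, ← coeff_zero_eq_constantCoeff_apply, coeff_zero_EPleth]
  exact isUnit_one

theorem adamsSeries_monomial (k i : ℕ) (f : SymFn) (hk : k ≠ 0) :
    adamsSeries k (monomial i f) = monomial (k * i) (adams k f) := by
  ext1 n
  rw [coeff_adamsSeries, coeff_monomial, coeff_monomial]
  by_cases h : k ∣ n
  · obtain ⟨m, rfl⟩ := h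
    rw [if_pos (dvd_mul_right k m), Nat.mul_div_cancel_left m (Nat.pos_of_ne_zero hk)]
    by_cases h1 : m = i
    · rw [if_pos h1, if_pos (by rw [h1])]
    · rw [if_neg h1, if_neg fun h2 => h1 (Nat.eq_of_mul_eq_mul_left (Nat.pos_of_ne_zero hk) h2)]
      exact (adamsHom k).map_zero
  · rw [if_neg h, if_neg fun h1 : n = k * i => h (h1 ▸ dvd_mul_right k i)]

theorem ePleth_monomial (r i : ℕ) (f : SymFn) :
    ePleth r (monomial i f) = monomial (r * i) (exteriorPleth r f) := by
  have h1 : ∀ s : Multiset ℕ, (∀ k ∈ s, k ≠ 0) → (s.map fun k => adamsSeries k (monomial i f)).prod =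
      monomial (s.sum * i) (s.map fun k => adams k f).prod := by
    intro s
    induction s using Multiset.induction_on with
    | empty => simp
    | cons k s ih =>
      intro hs
      rw [Multiset.map_cons, Multiset.prod_cons, ih fun l hl => hs l (Multiset.mem_cons_of_mem hl),
        adamsSeries_monomial _ _ _ (hs k (Multiset.mem_cons_self k s)), monomial_mul_monomial,
        Multiset.sum_cons, Multiset.map_cons, Multiset.prod_cons, add_mul]
  rw [ePleth, exteriorPleth, map_sum]
  refine Finset.sum_congr rfl fun lam _ => ?_
  rw [h1 _ fun k hk => (lam.parts_pos hk).ne', lam.parts_sum]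
  ext1 n
  rw [coeff_smul, coeff_monomial, coeff_monomial]
  split_ifs
  · rfl
  · rw [smul_zero]

/-- If every coefficient of `F` is induced from a linear character, then the coefficients of `E[F]`
are sums of Frobenius characteristics of monomial representations. -/
theorem coeff_EPleth_mem_monomialFrob (hF : coeff 0 F = 0)
    (h : ∀ n, n ≠ 0 → ∃ (Γ Y : Type) (_ : Group Γ) (_ : Fintype Γ) (_ : Fintype Y)
      (_ : DecidableEq Y) (ι : Γ →* Perm Y) (θ : Γ →* ℂ), Fintype.card Y = n ∧
        coeff n F = inducedFrob ι θ) (n : ℕ) :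
    coeff n (EPleth F) ∈ monomialFrob n := by
  have h1 : ∀ i, i ≠ 0 → ∀ m, coeff m (EPleth (monomial i (coeff i F))) ∈ monomialFrob m := by
    intro i hi m
    obtain ⟨Γ, Y, _, _, _, _, ι, θ, hY, h2⟩ := h i hi
    rw [EPleth, coeff_mk]
    refine sum_mem fun r _ => ?_
    rw [ePleth_monomial, coeff_monomial]
    split_ifs with h3
    · rw [h3, h2, ← hY]
      exact exteriorPleth_mem_monomialFrob ι θ r
    · exact zero_mem _
  -- A finite truncation of `F` suffices in each degree, and `E` turns it into a product over single
  -- homogeneous terms.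
  have h2 : ∀ N, ∀ m, coeff m (EPleth (∑ i ∈ Finset.range N, monomial (i + 1) (coeff (i + 1) F))) ∈
      monomialFrob m := by
    intro N
    induction N with
    | zero =>
      intro m
      rw [Finset.sum_range_zero, EPleth_zero, coeff_one]
      split_ifs with h3
      · rw [h3]
        exact one_mem_monomialFrob
      · exact zero_mem _
    | succ N ih =>
      intro m
      rw [Finset.sum_range_succ, EPleth_add, coeff_mul]
      · refine sum_mem fun x hx => ?_
        rw [← Finset.HasAntidiagonal.mem_antidiagonal.mp hx]
        exact mul_mem_monomialFrob (ih _) (h1 _ N.succ_ne_zero _)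
      · rw [map_sum]
        exact Finset.sum_eq_zero fun i _ => by rw [coeff_monomial, if_neg i.succ_ne_zero.symm]
      · rw [coeff_monomial, if_neg N.succ_ne_zero.symm]
  rw [coeff_EPleth_congr hF n (G := ∑ i ∈ Finset.range n, monomial (i + 1) (coeff (i + 1) F))]
  · exact h2 n n
  intro i hi
  rw [map_sum]
  simp only [coeff_monomial]
  cases i with
  | zero => simp [hF]
  | succ i =>
    rw [Finset.sum_eq_single i, if_pos rfl]
    · intro j _ hj
      exact if_neg fun h => hj (by omega)
    · intro hi'
      exact absurd (Finset.mem_range.mpr hi) hi'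

end Exponential

/-! ### Signed sums of power sums -/

section SignedSums

open PowerSeries

variable {R : Type*} [CommRing R]

/-- The weight of a part of given multiplicity, when the parts in `A` may be repeated, those in `B`
may not and come with a sign, and there are no other parts. -/
def partWeight (A B : Set ℕ) (w : ℕ → R) (i m : ℕ) : R :=
  if i ∈ A then w i ^ m else
    if m = 0 then 1 else if i ∈ B ∧ m = 1 then -w i else 0

/-- `1` on `A`, `-1` on `B` and `0` elsewhere. -/
def partSign (A B : Set ℕ) (i : ℕ) : ℤ := if i ∈ A then 1 else if i ∈ B then -1 else 0

theorem eulerDeriv_mk_pow (c : R) : eulerDeriv R (PowerSeries.mk fun m => c ^ m) =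
    (PowerSeries.mk fun j => if j = 0 then 0 else c ^ j) * PowerSeries.mk fun m => c ^ m := by
  ext m
  rw [coeff_eulerDeriv, coeff_mk, coeff_mul, Finset.Nat.sum_antidiagonal_eq_sum_range_succ_mk,
    Finset.sum_range_succ']
  simp only [coeff_mk, if_neg (Nat.succ_ne_zero _), if_pos, zero_mul, add_zero]
  rw [Finset.sum_congr rfl fun k hk => (pow_add c (k + 1) (m - (k + 1))).symm.trans
    (congrArg (c ^ ·) (Nat.add_sub_cancel' (Finset.mem_range.mp hk))), Finset.sum_const,
    Finset.card_range, nsmul_eq_mul]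

theorem eulerDeriv_one_sub (c : R) : eulerDeriv R (1 - C c * X) =
    (PowerSeries.mk fun j => if j = 0 then 0 else -c ^ j) * (1 - C c * X) := by
  ext m
  rw [coeff_eulerDeriv, mul_sub, mul_one, mul_comm, mul_left_comm, map_sub, map_sub, coeff_C_mul,
    coeff_C_mul, coeff_X, coeff_one, coeff_mk]
  rcases m with _ | _ | m
  · simp
  · simp
  · rw [mul_comm _ X, coeff_succ_X_mul, coeff_mk]
    simp [pow_succ']

theorem eulerDeriv_mk_partWeight (A B : Set ℕ) (w : ℕ → R) (i : ℕ) :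
    eulerDeriv R (PowerSeries.mk (partWeight A B w i)) =
      (PowerSeries.mk fun j => if j = 0 then 0 else (partSign A B i : R) * w i ^ j) *
        PowerSeries.mk (partWeight A B w i) := by
  by_cases hA : i ∈ A
  · have h1 : partWeight A B w i = fun m => w i ^ m := funext fun m => if_pos hA
    rw [h1, eulerDeriv_mk_pow]
    simp [partSign, hA]
  by_cases hB : i ∈ B
  · have h1 : PowerSeries.mk (partWeight A B w i) = 1 - C (w i) * X := by
      ext m
      rw [coeff_mk, map_sub, coeff_one, coeff_C_mul, coeff_X, partWeight, if_neg hA]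
      rcases m with _ | _ | m <;> simp [hB]
    rw [h1, eulerDeriv_one_sub]
    simp [partSign, hA, hB]
  · have h1 : PowerSeries.mk (partWeight A B w i) = 1 := by
      ext m
      rw [coeff_mk, coeff_one, partWeight, if_neg hA]
      simp [hB]
    rw [h1, isDerivation_eulerDeriv.map_one]
    ext m
    simp [partSign, hA, hB]

/-- For disjoint `A` and `B` the series is the product of `(1 - w_i t ^ i)⁻¹` over `A` and of `1 -
w_i t ^ i` over `B`. Each factor contributes `± i ∑_{m ≥ 1} w_i ^ m t ^ (i m)` to the logarithmic
derivative. -/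
theorem eulerDeriv_genFun_partWeight (A B : Set ℕ) (w : ℕ → R) :
    eulerDeriv R (Nat.Partition.genFun (partWeight A B w)) =
      (PowerSeries.mk fun n => ∑ e ∈ n.divisors, ((e * partSign A B e : ℤ) : R) * w e ^ (n / e)) *
        Nat.Partition.genFun (partWeight A B w) := by
  let b : ℕ → R⟦X⟧ := fun i => PowerSeries.mk fun n =>
    if n = 0 then 0 else if i ∣ n then ((i * partSign A B i : ℤ) : R) * w i ^ (n / i) else 0
  have h1 := derivation_genFun isDerivation_eulerDeriv (fun n x => (n : R) * x) coeff_eulerDeriv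
    (partWeight A B w) (fun i => by simp [partWeight]) b (fun i => by
      rw [eulerDeriv_expand, eulerDeriv_mk_partWeight, map_mul, ← mul_assoc]
      congr 1
      ext n
      have h2 : coeff n (b (i + 1)) = if n = 0 then 0 else if (i + 1) ∣ n then
          (((i + 1 : ℕ) * partSign A B (i + 1) : ℤ) : R) * w (i + 1) ^ (n / (i + 1)) else 0 :=
        coeff_mk _ _
      rw [h2, ← map_natCast (C (R := R)), coeff_C_mul, coeff_expand, coeff_mk]
      clear h2
      by_cases h : (i + 1) ∣ n
      · obtain ⟨m, rfl⟩ := h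
        rw [if_pos (dvd_mul_right _ _), if_pos (dvd_mul_right _ _),
          Nat.mul_div_cancel_left m i.succ_pos]
        by_cases hm : m = 0
        · simp [hm]
        · rw [if_neg hm, if_neg (mul_ne_zero i.succ_ne_zero hm)]
          push_cast
          ring
      · rw [if_neg h, if_neg h, mul_zero, ite_self])
    (fun i a ha => by
      rw [coeff_mk]
      split_ifs with h2 h3
      · rfl
      · exact absurd (Nat.eq_zero_of_dvd_of_lt h3 ha) h2
      · rfl)
  rw [h1]
  congr 2
  funext n
  rcases Nat.eq_zero_or_pos n with rfl | hn
  · simp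
  simp only [b, coeff_mk, if_neg hn.ne']
  rw [← Finset.sum_filter]
  refine Finset.sum_congr ?_ fun _ _ => rfl
  ext k
  simp only [Nat.mem_divisors, Finset.mem_filter, Finset.mem_Icc]
  constructor
  · rintro ⟨h1, h2⟩
    exact ⟨h2, by omega⟩
  · rintro ⟨h1, h2⟩
    exact ⟨⟨Nat.pos_of_dvd_of_pos h1 hn, Nat.le_of_dvd hn h1⟩, h1⟩

/-- The power sum `p_k`. -/
def powerSum (k : ℕ) : SymFn := fun N => MvPolynomial.psum (Fin N) ℂ k

theorem p_eq_prod {n : ℕ} (lam : n.Partition) : p lam = (lam.parts.map powerSum).prod := by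
  funext N
  rw [prod_map_apply]
  rfl

/-- The partitions of `n` with parts in `A` and with distinct parts in `B`. -/
def partsInDistinct (A B : Set ℕ) (n : ℕ) : Set n.Partition :=
  {lam | (∀ i ∈ lam.parts, i ∈ A ∨ i ∈ B) ∧ ∀ i ∈ B, lam.parts.count i ≤ 1}

/-- The sign `(-1) ^ (n - ℓ(λ))` is a product over parts: odd parts contribute `1`, and each even
part contributes the `-1` of its factor `1 - p_i t ^ i`. -/
theorem coeff_genFun_partWeight {A B : Set ℕ} (hA : ∀ i ∈ A, Odd i) (hB : ∀ i ∈ B, Even i) (n : ℕ) :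
    coeff n (Nat.Partition.genFun (partWeight A B powerSum)) =
      ∑ lam : n.Partition with lam ∈ partsInDistinct A B n, (-1 : ℂ) ^ (n - lam.parts.card) • p lam := by
  rw [Nat.Partition.coeff_genFun, Finset.sum_filter]
  refine Finset.sum_congr rfl fun lam _ => ?_
  rw [Finsupp.prod, Multiset.toFinsupp_support]
  simp only [Multiset.toFinsupp_apply]
  have hAB : ∀ i ∈ B, i ∉ A := fun i hi hi' =>
    (Nat.not_even_iff_odd.mpr (hA i hi')) (hB i hi)
  split_ifs with h
  · rw [p_eq_prod, pow_sub_card_eq_prod, ← prod_map_smul, Finset.prod_multiset_map_count]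
    refine Finset.prod_congr rfl fun i hi => ?_
    rw [Multiset.mem_toFinset] at hi
    have hi0 := lam.parts_pos hi
    rw [partWeight]
    rcases h.1 i hi with h1 | h1
    · have h2 : Even (i - 1) := Nat.Odd.sub_odd (hA i h1) odd_one
      rw [if_pos h1, h2.neg_one_pow, one_smul]
    · have h2 : Odd (i - 1) := Nat.Even.sub_odd hi0 (hB i h1) odd_one
      have h3 : lam.parts.count i = 1 :=
        le_antisymm (h.2 i h1) (Multiset.one_le_count_iff_mem.mpr hi)
      rw [if_neg (hAB i h1), h3, if_neg one_ne_zero, if_pos ⟨h1, rfl⟩, h2.neg_one_pow, neg_one_smul,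
        pow_one]
  · have h1 : ∃ i ∈ lam.parts, i ∉ A ∧ ¬(i ∈ B ∧ lam.parts.count i = 1) := by
      by_contra! hc
      refine h ⟨fun i hi => ?_, fun i hi => ?_⟩
      · by_cases h2 : i ∈ A
        · exact Or.inl h2
        · exact Or.inr (hc i hi h2).1
      · by_cases h2 : i ∈ lam.parts
        · exact (hc i h2 (hAB i hi)).2.le
        · rw [Multiset.count_eq_zero_of_notMem h2]
          exact zero_le_one
    obtain ⟨i, hi, h2, h3⟩ := h1
    refine Finset.prod_eq_zero (Multiset.mem_toFinset.mpr hi) ?_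
    rw [partWeight, if_neg h2, if_neg (Multiset.count_ne_zero.mpr hi), if_neg h3]

end SignedSums

/-! ### The representations `L_n^S` in terms of power sums -/

section PrimeL

variable {n : ℕ}

theorem cyclicHom_pow_apply (k x : ZMod n) (j : ℕ) :
    (cyclicHom n (Multiplicative.ofAdd k) ^ j) x = j • k + x := by
  rw [← map_pow, ← ofAdd_nsmul]
  rfl

variable [NeZero n]

/-- All cycles of a translation have the order of `k` as their length; their number then follows
from the sum of the parts. -/
theorem parts_cyclicHom (k : ZMod n) :
    (cyclicHom n (Multiplicative.ofAdd k)).partition.parts =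
      Multiset.replicate (n / addOrderOf k) (addOrderOf k) := by
  set σ := cyclicHom n (Multiplicative.ofAdd k)
  have hd : 0 < addOrderOf k := addOrderOf_pos k
  have h1 : ∀ m ∈ σ.partition.parts, m = addOrderOf k := by
    intro m hm
    rw [Perm.parts_partition, Multiset.mem_add] at hm
    rcases hm with hm | hm
    · have h2 : m ∣ addOrderOf k := by
        refine (Perm.dvd_of_mem_cycleType hm).trans (orderOf_dvd_of_pow_eq_one ?_)
        ext x
        rw [cyclicHom_pow_apply, addOrderOf_nsmul_eq_zero, zero_add, Perm.one_apply]
      refine Nat.dvd_antisymm h2 (addOrderOf_dvd_of_nsmul_eq_zero ?_)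
      -- The power of `σ` by a cycle length fixes a point of that cycle; being a translation, it
      -- forces that multiple of `k` to vanish.
      obtain ⟨c, τ, hστ, hdisj, hc, rfl⟩ := Perm.mem_cycleType_iff.mp hm
      obtain ⟨x, hx⟩ := hc.nonempty_support
      have h3 : τ x = x := (hdisj x).resolve_left (Perm.mem_support.mp hx)
      have h4 : (σ ^ c.support.card) x = x := by
        rw [hστ, hdisj.commute.mul_pow, ← hc.orderOf, pow_orderOf_eq_one, one_mul]
        exact Perm.pow_apply_eq_self_of_apply_eq_self h3 _
      rw [cyclicHom_pow_apply] at h4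
      simpa using h4
    · have h2 := Multiset.eq_of_mem_replicate hm
      have h3 : Fintype.card (ZMod n) - σ.support.card ≠ 0 := by
        intro h
        rw [h, Multiset.replicate_zero] at hm
        exact Multiset.notMem_zero _ hm
      obtain ⟨x, hx⟩ : ∃ x, x ∉ σ.support := by
        by_contra! hc
        rw [Finset.eq_univ_iff_forall.mpr hc, Finset.card_univ, Nat.sub_self] at h3
        exact h3 rfl
      rw [Perm.notMem_support] at hx
      have h4 : k = 0 := by
        have h5 : k + x = x := hx
        simpa using h5
      rw [h2, h4, addOrderOf_zero]
  have h2 := Multiset.eq_replicate_card.mpr h1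
  have h3 := σ.partition.parts_sum
  rw [h2, Multiset.sum_replicate, smul_eq_mul] at h3
  have h4 : n = σ.partition.parts.card * addOrderOf k := (ZMod.card n).symm.trans h3.symm
  have h5 : n / addOrderOf k = σ.partition.parts.card := Nat.div_eq_of_eq_mul_left hd h4
  rw [h5]
  exact h2

/-- The sum of the values of the character `exp (2 π i Q x / n)` over the elements of order `d`. -/
def ramanujanSum (n : ℕ) [NeZero n] (Q d : ℕ) : ℂ :=
  ∑ k : ZMod n with addOrderOf k = d, ZMod.stdAddChar ((Q : ZMod n) * k)

theorem natCast_smul_L (S : Set ℕ) : (n : ℂ) • L S n =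
    ∑ d ∈ n.divisors, ramanujanSum n (Qpart S n) d • powerSum d ^ (n / d) := by
  have hn : (n : ℂ) ≠ 0 := Nat.cast_ne_zero.mpr (NeZero.ne n)
  have h1 : Fintype.card (Multiplicative (ZMod n)) = n :=
    (Fintype.card_multiplicative _).trans (ZMod.card n)
  rw [L_eq_inducedFrob, inducedFrob, h1, smul_smul, mul_inv_cancel₀ hn, one_smul,
    ← Multiplicative.ofAdd.sum_comp,
    ← Finset.sum_fiberwise_of_maps_to (s := Finset.univ) (t := n.divisors)
      (g := fun k : ZMod n => addOrderOf k)]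
  · refine Finset.sum_congr rfl fun d _ => ?_
    rw [ramanujanSum, Finset.sum_smul]
    refine Finset.sum_congr rfl fun k hk => ?_
    rw [p_eq_prod, parts_cyclicHom, (Finset.mem_filter.mp hk).2, Multiset.map_replicate,
      Multiset.prod_replicate]
    rfl
  · intro k _
    rw [Nat.mem_divisors]
    refine ⟨?_, NeZero.ne n⟩
    have := addOrderOf_dvd_card (x := k)
    rwa [ZMod.card] at this

/-- The elements whose order divides `e` form the `e`-torsion subgroup, of order `e`. A character
sums over it to `e` or `0` according to whether it is trivial there. -/
theorem sum_ramanujanSum {e : ℕ} (he : e ∣ n) (Q : ℕ) :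
    ∑ d ∈ e.divisors, ramanujanSum n Q d = if e ∣ Q then (e : ℂ) else 0 := by
  obtain ⟨m, rfl⟩ := he
  have hem := NeZero.ne (e * m)
  have he0 : e ≠ 0 := fun h => hem (by rw [h, zero_mul])
  have hm0 : m ≠ 0 := fun h => hem (by rw [h, mul_zero])
  have h1 : ∑ d ∈ e.divisors, ramanujanSum (e * m) Q d =
      ∑ k : ZMod (e * m) with e • k = 0, ZMod.stdAddChar ((Q : ZMod (e * m)) * k) := by
    rw [← Finset.sum_fiberwise_of_maps_to (t := e.divisors)
      (g := fun k : ZMod (e * m) => addOrderOf k)]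
    · refine Finset.sum_congr rfl fun d hd => Finset.sum_congr ?_ fun _ _ => rfl
      ext k
      simp only [Finset.mem_filter, Finset.mem_univ, true_and]
      refine ⟨fun h => ⟨?_, h⟩, fun h => h.2⟩
      rw [← addOrderOf_dvd_iff_nsmul_eq_zero, h]
      exact Nat.dvd_of_mem_divisors hd
    · intro k hk
      rw [Nat.mem_divisors]
      exact ⟨addOrderOf_dvd_iff_nsmul_eq_zero.mpr (Finset.mem_filter.mp hk).2, he0⟩
  rw [h1]
  have h2 : ∀ a : ℕ, (a : ZMod (e * m)) * (m : ZMod (e * m)) = 0 ↔ e ∣ a := by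
    intro a
    rw [← Nat.cast_mul, ZMod.natCast_eq_zero_iff, Nat.mul_dvd_mul_iff_right (Nat.pos_of_ne_zero hm0)]
  split_ifs with hQ
  · have h3 : ∀ k ∈ Finset.univ.filter (fun k : ZMod (e * m) => e • k = 0),
        ZMod.stdAddChar ((Q : ZMod (e * m)) * k) = 1 := by
      intro k hk
      obtain ⟨c, rfl⟩ := hQ
      have h5 := (Finset.mem_filter.mp hk).2
      rw [nsmul_eq_mul] at h5
      rw [Nat.cast_mul, mul_right_comm, h5, zero_mul, AddChar.map_zero_eq_one]
    rw [Finset.sum_congr rfl h3, Finset.sum_const, nsmul_eq_mul, mul_one]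
    congr 1
    -- The `e`-torsion of `ℤ/(e m)` consists of the multiples of `m`.
    have h4 : (Finset.univ.filter fun k : ZMod (e * m) => e • k = 0) =
        (Finset.range e).image fun j : ℕ => (j : ZMod (e * m)) * m := by
      ext k
      simp only [Finset.mem_filter, Finset.mem_univ, true_and, Finset.mem_image, Finset.mem_range]
      constructor
      · intro hk
        rw [← ZMod.natCast_zmod_val k, nsmul_eq_mul, ← Nat.cast_mul, ZMod.natCast_eq_zero_iff,
          Nat.mul_dvd_mul_iff_left (Nat.pos_of_ne_zero he0)] at hk
        obtain ⟨j, hj⟩ := hk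
        refine ⟨j, ?_, ?_⟩
        · have h5 := ZMod.val_lt k
          rw [hj, mul_comm] at h5
          exact Nat.lt_of_mul_lt_mul_right h5
        · conv_rhs => rw [← ZMod.natCast_zmod_val k, hj, Nat.cast_mul, mul_comm]
      · rintro ⟨j, -, rfl⟩
        rw [nsmul_eq_mul, mul_left_comm, (h2 e).mpr dvd_rfl, mul_zero]
    rw [h4, Finset.card_image_of_injOn, Finset.card_range]
    intro i hi j hj hij
    simp only [Finset.coe_range, Set.mem_Iio] at hi hj
    have hij' : ((i * m : ℕ) : ZMod (e * m)) = ((j * m : ℕ) : ZMod (e * m)) := by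
      push_cast; exact hij
    rw [ZMod.natCast_eq_natCast_iff', Nat.mod_eq_of_lt (Nat.mul_lt_mul_of_pos_right hi (Nat.pos_of_ne_zero hm0)),
      Nat.mod_eq_of_lt (Nat.mul_lt_mul_of_pos_right hj (Nat.pos_of_ne_zero hm0))] at hij'
    exact Nat.eq_of_mul_eq_mul_right (Nat.pos_of_ne_zero hm0) hij'
  · have h3 : ZMod.stdAddChar ((Q : ZMod (e * m)) * (m : ZMod (e * m))) ≠ 1 := by
      intro h
      rw [← (ZMod.stdAddChar (N := e * m)).map_zero_eq_one, ZMod.injective_stdAddChar.eq_iff, h2] at h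
      exact hQ h
    -- Translation by the torsion element `m` permutes the summands and multiplies the sum by a
    -- value different from `1`.
    have h4 : ZMod.stdAddChar ((Q : ZMod (e * m)) * (m : ZMod (e * m))) *
        ∑ k : ZMod (e * m) with e • k = 0, ZMod.stdAddChar ((Q : ZMod (e * m)) * k) =
        ∑ k : ZMod (e * m) with e • k = 0, ZMod.stdAddChar ((Q : ZMod (e * m)) * k) := by
      rw [Finset.mul_sum]
      refine Finset.sum_equiv (Equiv.addLeft (m : ZMod (e * m))) (fun k => ?_) fun k _ => ?_
      · simp only [Finset.mem_filter, Finset.mem_univ, true_and, Equiv.coe_addLeft, nsmul_add]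
        rw [nsmul_eq_mul e (m : ZMod (e * m)), (h2 e).mpr dvd_rfl, zero_add]
      · rw [Equiv.coe_addLeft, mul_add, AddChar.map_add_eq_mul]
    have h5 : (ZMod.stdAddChar ((Q : ZMod (e * m)) * (m : ZMod (e * m))) - 1) *
        ∑ k : ZMod (e * m) with e • k = 0, ZMod.stdAddChar ((Q : ZMod (e * m)) * k) = 0 := by
      rw [sub_mul, h4, one_mul, sub_self]
    exact (mul_eq_zero.mp h5).resolve_left (sub_ne_zero.mpr h3)

theorem dvd_Qpart_iff (S : Set ℕ) {e n : ℕ} (hn : n ≠ 0) (he : e ∣ n) : e ∣ Qpart S n ↔ e ∈ P S := by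
  have he0 : e ≠ 0 := fun h => hn (Nat.eq_zero_of_zero_dvd (h ▸ he))
  constructor
  · refine fun h => ⟨Nat.one_le_iff_ne_zero.mpr he0, fun q hq hqe => ?_⟩
    obtain ⟨r, hr, hqr⟩ := (hq.prime.dvd_finsetProd_iff _).mp (hqe.trans h)
    obtain ⟨hr1, hr2⟩ := Finset.mem_filter.mp hr
    rwa [(Nat.prime_dvd_prime_iff_eq hq (Nat.prime_of_mem_primeFactors hr1)).mp
      (hq.dvd_of_dvd_pow hqr)]
  · intro h
    rw [← Nat.prod_factorization_pow_eq_self he0, Qpart]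
    have h1 : e.primeFactors ⊆ n.primeFactors.filter (· ∈ S) := fun q hq =>
      Finset.mem_filter.mpr ⟨Nat.primeFactors_mono he hn hq,
        h.2 q (Nat.prime_of_mem_primeFactors hq) (Nat.dvd_of_mem_primeFactors hq)⟩
    refine dvd_trans ?_ (Finset.prod_dvd_prod_of_subset _ _ _ h1)
    exact Finset.prod_dvd_prod_of_dvd _ _ fun q _ =>
      pow_dvd_pow q ((Nat.factorization_le_iff_dvd he0 hn).mpr he q)

/-- The function `e ↦ e` on `P(S)`, extended by zero. -/
def weightOn (S : Set ℕ) (e : ℕ) : ℂ := if e ∈ P S then (e : ℂ) else 0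

/-- The Möbius transform of `weightOn S`. -/
def primeWeight (S : Set ℕ) (d : ℕ) : ℂ :=
  ∑ x ∈ d.divisorsAntidiagonal, (ArithmeticFunction.moebius x.1 : ℂ) * weightOn S x.2

theorem sum_primeWeight (S : Set ℕ) {e : ℕ} (he : e ≠ 0) :
    ∑ d ∈ e.divisors, primeWeight S d = weightOn S e :=
  (ArithmeticFunction.sum_eq_iff_sum_mul_moebius_eq (f := primeWeight S) (g := weightOn S)).mpr
    (fun _ _ => rfl) e (Nat.pos_of_ne_zero he)

/-- Möbius inversion on the divisors of `n`. The right side does not involve `n`, which is what lets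
the coefficients of different `L_n` combine. -/
theorem ramanujanSum_Qpart (S : Set ℕ) {d : ℕ} (hd : d ∣ n) :
    ramanujanSum n (Qpart S n) d = primeWeight S d := by
  have h1 := (ArithmeticFunction.sum_eq_iff_sum_mul_moebius_eq_on (f := ramanujanSum n (Qpart S n))
    (g := weightOn S) {e | e ∣ n} fun a b hab hb => hab.trans hb).mp
      fun e _ he => by
        rw [sum_ramanujanSum he]
        exact if_congr (dvd_Qpart_iff S (NeZero.ne n) he) rfl rfl
  exact (h1 d (Nat.pos_of_dvd_of_pos hd (Nat.pos_of_ne_zero (NeZero.ne n))) hd).symm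

theorem natCast_smul_coeff_LSeries (S : Set ℕ) (n : ℕ) :
    (n : ℂ) • PowerSeries.coeff n (LSeries S) =
      ∑ d ∈ n.divisors, primeWeight S d • powerSum d ^ (n / d) := by
  by_cases hn : n = 0
  · simp [hn]
  have : NeZero n := ⟨hn⟩
  rw [LSeries, PowerSeries.coeff_mk, dif_neg hn, natCast_smul_L]
  exact Finset.sum_congr rfl fun d hd => by rw [ramanujanSum_Qpart S (Nat.dvd_of_mem_divisors hd)]

theorem adams_powerSum (k d : ℕ) : adams k (powerSum d) = powerSum (k * d) := by
  funext N
  simp only [adams, powerSum, MvPolynomial.psum, map_sum, map_pow, MvPolynomial.expand_X, pow_mul]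

theorem sum_divisors_divisors {M : Type*} [AddCommMonoid M] (n : ℕ) (F : ℕ → ℕ → M) :
    ∑ k ∈ n.divisors, ∑ d ∈ (n / k).divisors, F k d =
      ∑ e ∈ n.divisors, ∑ d ∈ e.divisors, F (e / d) d := by
  rw [Finset.sum_sigma', Finset.sum_sigma']
  refine Finset.sum_bij' (fun x _ => ⟨x.1 * x.2, x.2⟩) (fun x _ => ⟨x.1 / x.2, x.2⟩) ?_ ?_ ?_ ?_ ?_
  · rintro ⟨k, d⟩ h
    simp only [Finset.mem_sigma, Nat.mem_divisors] at h ⊢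
    obtain ⟨⟨h1, h2⟩, h3, h4⟩ := h
    have h5 : k * d ∣ n := Nat.mul_dvd_of_dvd_div h1 h3
    exact ⟨⟨h5, h2⟩, dvd_mul_left d k, fun h6 => h2 (Nat.eq_zero_of_zero_dvd (h6 ▸ h5))⟩
  · rintro ⟨e, d⟩ h
    simp only [Finset.mem_sigma, Nat.mem_divisors] at h ⊢
    obtain ⟨⟨h1, h2⟩, h3, h4⟩ := h
    have h5 : e / d ∣ n := (Nat.div_dvd_of_dvd h3).trans h1
    refine ⟨⟨h5, h2⟩, ?_, fun h6 => ?_⟩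
    · rw [Nat.dvd_div_iff_mul_dvd h5, Nat.div_mul_cancel h3]
      exact h1
    · have h7 := Nat.div_mul_cancel h5
      rw [h6, zero_mul] at h7
      exact h2 h7.symm
  · rintro ⟨k, d⟩ h
    simp only [Finset.mem_sigma, Nat.mem_divisors] at h
    have hd : 0 < d := Nat.pos_of_ne_zero fun h0 => h.2.2 (Nat.eq_zero_of_zero_dvd (h0 ▸ h.2.1))
    simp only [Nat.mul_div_cancel k hd]
  · rintro ⟨e, d⟩ h
    simp only [Finset.mem_sigma, Nat.mem_divisors] at h
    simp only [Nat.div_mul_cancel h.2.1]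
  · rintro ⟨k, d⟩ h
    simp only [Finset.mem_sigma, Nat.mem_divisors] at h
    have hd : 0 < d := Nat.pos_of_ne_zero fun h0 => h.2.2 (Nat.eq_zero_of_zero_dvd (h0 ▸ h.2.1))
    simp only [Nat.mul_div_cancel k hd]

/-- As `p_k[p_d] = p_{kd}`, the terms are collected by `e = k d`, producing a Dirichlet convolution
of `c` with `primeWeight S`. -/
theorem sum_adams_LSeries (S : Set ℕ) (c : ℕ → ℂ) (n : ℕ) :
    ∑ k ∈ n.divisors, c k • adams k (((n / k : ℕ) : ℂ) • PowerSeries.coeff (n / k) (LSeries S)) =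
      ∑ e ∈ n.divisors, (∑ d ∈ e.divisors, c (e / d) * primeWeight S d) • powerSum e ^ (n / e) := by
  have h1 : ∀ k ∈ n.divisors,
      c k • adams k (((n / k : ℕ) : ℂ) • PowerSeries.coeff (n / k) (LSeries S)) =
      ∑ d ∈ (n / k).divisors, (c k * primeWeight S d) • powerSum (k * d) ^ (n / (k * d)) := by
    intro k _
    have h2 : adams k (∑ d ∈ (n / k).divisors, primeWeight S d • powerSum d ^ (n / k / d)) =
        ∑ d ∈ (n / k).divisors, primeWeight S d • powerSum (k * d) ^ (n / (k * d)) := by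
      refine (map_sum (adamsHom k) _ _).trans (Finset.sum_congr rfl fun d _ => ?_)
      refine (adams_smul k _ _).trans ?_
      rw [← adams_powerSum, Nat.div_div_eq_div_mul]
      congr 1
      exact map_pow (adamsHom k) _ _
    rw [natCast_smul_coeff_LSeries, h2, Finset.smul_sum]
    exact Finset.sum_congr rfl fun d _ => smul_smul _ _ _
  rw [Finset.sum_congr rfl h1, sum_divisors_divisors]
  refine Finset.sum_congr rfl fun e _ => ?_
  rw [Finset.sum_smul]
  refine Finset.sum_congr rfl fun d hd => ?_
  rw [Nat.div_mul_cancel (Nat.dvd_of_mem_divisors hd)]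

/-- The sign at `k = e / d` is `1` minus twice the indicator of `k` even, and `e / d` is even
exactly when `e` is even and `d` divides `e / 2`. Both divisor sums are then given by
`sum_primeWeight`. -/
theorem sum_sign_primeWeight (S : Set ℕ) {e : ℕ} (he : e ≠ 0) :
    ∑ d ∈ e.divisors, (-1 : ℂ) ^ (e / d - 1) * primeWeight S d =
      weightOn S e - if Even e then 2 * weightOn S (e / 2) else 0 := by
  have h1 : ∀ d ∈ e.divisors, (-1 : ℂ) ^ (e / d - 1) * primeWeight S d =
      primeWeight S d - if Even (e / d) then 2 * primeWeight S d else 0 := by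
    intro d hd
    have hd' := Nat.dvd_of_mem_divisors hd
    have h2 : 0 < e / d := Nat.div_pos (Nat.le_of_dvd (Nat.pos_of_ne_zero he) hd')
      (Nat.pos_of_mem_divisors hd)
    split_ifs with h3
    · rw [(Nat.Even.sub_odd h2 h3 odd_one).neg_one_pow]
      ring
    · rw [(Nat.Odd.sub_odd (Nat.not_even_iff_odd.mp h3) odd_one).neg_one_pow]
      ring
  rw [Finset.sum_congr rfl h1, Finset.sum_sub_distrib, sum_primeWeight S he, ← Finset.sum_filter]
  congr 1
  split_ifs with h2
  · obtain ⟨f, rfl⟩ := h2.two_dvd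
    have hf : f ≠ 0 := fun h => he (by rw [h, mul_zero])
    rw [Nat.mul_div_cancel_left f two_pos, ← sum_primeWeight S hf, Finset.mul_sum]
    refine Finset.sum_congr ?_ fun _ _ => rfl
    ext d
    simp only [Finset.mem_filter, Nat.mem_divisors]
    constructor
    · rintro ⟨⟨h3, -⟩, h4⟩
      obtain ⟨g, hg⟩ := h4.two_dvd
      refine ⟨⟨g, ?_⟩, hf⟩
      have h5 := Nat.mul_div_cancel' h3
      rw [hg] at h5
      linarith
    · rintro ⟨⟨g, rfl⟩, -⟩
      refine ⟨⟨⟨2 * g, by ring⟩, he⟩, ?_⟩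
      have hd : 0 < d := Nat.pos_of_ne_zero fun h => hf (by rw [h, zero_mul])
      rw [show 2 * (d * g) = d * (2 * g) by ring, Nat.mul_div_cancel_left _ hd]
      exact even_two_mul g
  · refine Finset.sum_eq_zero fun d hd => ?_
    obtain ⟨h3, h4⟩ := Finset.mem_filter.mp hd
    refine absurd ?_ h2
    rw [← Nat.div_mul_cancel (Nat.dvd_of_mem_divisors h3)]
    exact h4.mul_right d

end PrimeL

/-! ### The plethystic exponentials of `L^S` -/

section Main

open PowerSeries

theorem coeff_zero_LSeries (S : Set ℕ) : coeff 0 (LSeries S) = 0 := by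
  rw [LSeries, coeff_mk, dif_pos rfl]

theorem coeff_LSeries (S : Set ℕ) (n : ℕ) [NeZero n] : coeff n (LSeries S) = L S n := by
  rw [LSeries, coeff_mk, dif_neg (NeZero.ne n)]

theorem coeff_EPleth_LSeries_mem (S : Set ℕ) (n : ℕ) :
    coeff n (EPleth (LSeries S)) ∈ monomialFrob n := by
  refine coeff_EPleth_mem_monomialFrob (coeff_zero_LSeries S) (fun m hm => ?_) n
  have : NeZero m := ⟨hm⟩
  exact ⟨Multiplicative (ZMod m), ZMod m, inferInstance, inferInstance, inferInstance, inferInstance,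
    cyclicHom m, cyclicChar m (Qpart S m), ZMod.card m,
    (coeff_LSeries S m).trans (L_eq_inducedFrob S m)⟩

/-- A series with constant term `1` is determined by its logarithmic derivative, so comparing the
numbers `c e` is enough. -/
theorem eq_genFun_partWeight {A B : Set ℕ} {y : PowerSeries SymFn} {c : ℕ → ℂ}
    (hy : eulerDeriv SymFn y =
      (PowerSeries.mk fun n => ∑ e ∈ n.divisors, c e • powerSum e ^ (n / e)) * y)
    (hy0 : coeff 0 y = 1) (hc : ∀ e, e ≠ 0 → c e = e * partSign A B e) :
    y = Nat.Partition.genFun (partWeight A B powerSum) := by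
  have h0 : coeff 0 (Nat.Partition.genFun (partWeight A B powerSum)) = 1 := by
    rw [Nat.Partition.coeff_genFun]
    simp
  ext1 n
  refine coeff_eq_of_eulerDeriv hy (eulerDeriv_genFun_partWeight A B powerSum) (hy0.trans h0.symm) n
    (fun i _ => ?_) (by rw [coeff_mk, Nat.divisors_zero, Finset.sum_empty]) n le_rfl
  rw [coeff_mk, coeff_mk]
  refine Finset.sum_congr rfl fun e he => ?_
  rw [hc e (Nat.pos_of_mem_divisors he).ne', ← zsmul_eq_mul, ← Int.cast_smul_eq_zsmul ℂ]
  push_cast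
  rfl

theorem HPleth_LSeries (S : Set ℕ) :
    HPleth (LSeries S) = Nat.Partition.genFun (partWeight (P S) ∅ powerSum) := by
  refine eq_genFun_partWeight (c := weightOn S) ?_ (coeff_zero_HPleth _) fun e _ => ?_
  · have h1 : ∀ n, ∑ k ∈ n.divisors, adams k (((n / k : ℕ) : ℂ) • coeff (n / k) (LSeries S)) =
        ∑ e ∈ n.divisors, weightOn S e • powerSum e ^ (n / e) := by
      intro n
      have h2 := sum_adams_LSeries S (fun _ => 1) n
      simp only [one_smul, one_mul] at h2
      rw [h2]
      exact Finset.sum_congr rfl fun e he => by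
        rw [sum_primeWeight S (Nat.pos_of_mem_divisors he).ne']
    rw [eulerDeriv_HPleth (coeff_zero_LSeries S)]
    simp only [h1]
  · simp [weightOn, partSign]

theorem EPleth_LSeries (S : Set ℕ) {A B : Set ℕ}
    (h : ∀ e, e ≠ 0 → weightOn S e - (if Even e then 2 * weightOn S (e / 2) else 0) =
      e * partSign A B e) :
    EPleth (LSeries S) = Nat.Partition.genFun (partWeight A B powerSum) := by
  refine eq_genFun_partWeight (c := fun e => ∑ d ∈ e.divisors, (-1 : ℂ) ^ (e / d - 1) *
    primeWeight S d) ?_ (coeff_zero_EPleth _) fun e he => (sum_sign_primeWeight S he).trans (h e he)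
  have h1 := sum_adams_LSeries S fun k => (-1 : ℂ) ^ (k - 1)
  rw [eulerDeriv_EPleth (coeff_zero_LSeries S)]
  simp only [h1]

theorem two_mul_mem_P {S : Set ℕ} (h2 : 2 ∈ S) {m : ℕ} : 2 * m ∈ P S ↔ m ∈ P S := by
  constructor
  · rintro ⟨h3, h4⟩
    exact ⟨by omega, fun q hq hqm => h4 q hq (hqm.mul_left 2)⟩
  · rintro ⟨h3, h4⟩
    refine ⟨by omega, fun q hq hqm => ?_⟩
    rcases (hq.dvd_mul).mp hqm with h5 | h5
    · rwa [(Nat.prime_dvd_prime_iff_eq hq Nat.prime_two).mp h5]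
    · exact h4 q hq h5

theorem odd_of_mem_P {S : Set ℕ} (h2 : 2 ∉ S) {m : ℕ} (hm : m ∈ P S) : Odd m := by
  rw [← Nat.not_even_iff_odd]
  exact fun h => h2 (hm.2 2 Nat.prime_two h.two_dvd)

theorem mem_P_diff_two {S : Set ℕ} {m : ℕ} : m ∈ P (S \ {2}) ↔ Odd m ∧ m ∈ P S := by
  constructor
  · exact fun h => ⟨odd_of_mem_P (fun h2 => h2.2 rfl) h, h.1, fun q hq hqm => (h.2 q hq hqm).1⟩
  · rintro ⟨h1, h2, h3⟩
    refine ⟨h2, fun q hq hqm => ⟨h3 q hq hqm, ?_⟩⟩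
    rintro rfl
    exact Nat.not_even_iff_odd.mpr h1 (even_iff_two_dvd.mpr hqm)

theorem oddParts_eq_partsIn (S : Set ℕ) (n : ℕ) : oddParts S n = partsIn (S \ {2}) n := by
  ext lam
  exact forall₂_congr fun i _ => mem_P_diff_two.symm

theorem genFun_partWeight_odd (S : Set ℕ) :
    Nat.Partition.genFun (partWeight (P (S \ {2})) ∅ powerSum) =
      PowerSeries.mk fun n => powerSumOver (oddParts S n) := by
  ext1 n
  rw [coeff_genFun_partWeight (fun i hi => (mem_P_diff_two.mp hi).1) fun i hi => hi.elim, coeff_mk,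
    powerSumOver]
  have h1 : partsInDistinct (P (S \ {2})) ∅ n = oddParts S n := by
    rw [oddParts_eq_partsIn]
    ext lam
    simp [partsInDistinct, partsIn]
  rw [h1]
  refine Finset.sum_congr rfl fun lam hlam => ?_
  have h2 : lam ∈ oddParts S n := (Finset.mem_filter.mp hlam).2
  rw [pow_sub_card_eq_prod, Multiset.prod_eq_one, one_smul]
  intro x hx
  obtain ⟨i, hi, rfl⟩ := Multiset.mem_map.mp hx
  exact (Nat.Odd.sub_odd (h2 i hi).1 odd_one).neg_one_pow

/-- For even `e`, membership of `e` and of `e / 2` in `P S` is equivalent, so `e - 2 (e / 2)`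
cancels and only odd parts survive. -/
theorem EPleth_LSeries_of_two_mem {S : Set ℕ} (h2 : 2 ∈ S) : EPleth (LSeries S) =
    Nat.Partition.genFun (partWeight (P (S \ {2})) ∅ powerSum) := by
  refine EPleth_LSeries S fun e _ => ?_
  simp only [partSign, weightOn, mem_P_diff_two, Set.mem_empty_iff_false, if_false]
  rcases Nat.even_or_odd e with h | h
  · obtain ⟨f, rfl⟩ := h.two_dvd
    rw [Nat.mul_div_cancel_left f two_pos, if_pos h, two_mul_mem_P h2,
      if_neg (c := Odd (2 * f) ∧ f ∈ P S) fun h3 => Nat.not_even_iff_odd.mpr h3.1 h]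
    split_ifs <;> simp
  · rw [if_neg (Nat.not_even_iff_odd.mpr h)]
    simp [h]

/-- Now `P S` contains no even number, so an even `e = 2 m` with `m ∈ P S` keeps only `-2 m = -e`: a
numerator factor `1 - p_e t ^ e`, hence a part used at most once. -/
theorem EPleth_LSeries_of_two_notMem {S : Set ℕ} (h2 : 2 ∉ S) : EPleth (LSeries S) =
    Nat.Partition.genFun (partWeight (P S) {i | ∃ m, Odd m ∧ m ∈ P S ∧ i = 2 * m} powerSum) := by
  refine EPleth_LSeries S fun e _ => ?_
  simp only [partSign, weightOn, Set.mem_ofPred_eq]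
  rcases Nat.even_or_odd e with h | h
  · obtain ⟨f, rfl⟩ := h.two_dvd
    have h3 : (∃ m, Odd m ∧ m ∈ P S ∧ 2 * f = 2 * m) ↔ f ∈ P S := by
      constructor
      · rintro ⟨m, -, h4, h5⟩
        rwa [Nat.eq_of_mul_eq_mul_left two_pos h5]
      · exact fun h4 => ⟨f, odd_of_mem_P h2 h4, h4, rfl⟩
    have h4 : 2 * f ∉ P S := fun h4 => Nat.not_even_iff_odd.mpr (odd_of_mem_P h2 h4) h
    rw [Nat.mul_div_cancel_left f two_pos, if_pos h, if_neg h4, if_neg h4]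
    simp only [h3]
    split_ifs <;> simp
  · have h3 : ¬∃ m, Odd m ∧ m ∈ P S ∧ e = 2 * m := by
      rintro ⟨m, -, -, rfl⟩
      exact Nat.not_even_iff_odd.mpr h (even_two_mul m)
    rw [if_neg (Nat.not_even_iff_odd.mpr h), if_neg h3]
    simp

/-- The signed sum is the image of the unsigned one under `ω`, which on class functions is
multiplication by the sign character. -/
theorem schurPositive_powerSumOver {n : ℕ} {T : Set n.Partition}
    (h : ∑ lam : n.Partition with lam ∈ T, (-1 : ℂ) ^ (n - lam.parts.card) • p lam ∈
      monomialFrob n) : SchurPositive n (powerSumOver T) := by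
  let χ : n.Partition → ℂ := fun lam =>
    if lam ∈ T then (-1) ^ (n - lam.parts.card) * zee lam else 0
  have h1 : frob χ = ∑ lam : n.Partition with lam ∈ T, (-1 : ℂ) ^ (n - lam.parts.card) • p lam := by
    rw [frob, Finset.sum_filter]
    refine Finset.sum_congr rfl fun lam _ => ?_
    have := zee_ne_zero lam
    simp only [χ]
    split_ifs
    · congr 1
      field_simp
    · simp
  have h2 : frob (signTwist χ) = powerSumOver T := by
    rw [frob, powerSumOver, Finset.sum_filter]
    refine Finset.sum_congr rfl fun lam _ => ?_
    have h3 := zee_ne_zero lam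
    simp only [χ, signTwist]
    split_ifs
    · rw [← mul_assoc, ← mul_pow, neg_one_mul, neg_neg, one_pow, one_mul, mul_inv_cancel₀ h3, one_smul]
    · simp
  rw [← h2]
  exact schurPositive_signTwist (h1 ▸ h)

end Main

end PrimeLie

end

theorem mainTheorem9 (S : Set ℕ) (hS : ∀ q ∈ S, q.Prime) :
    (2 ∈ S →
      (∀ n : ℕ, PrimeLie.SchurPositive n (PrimeLie.powerSumOver (PrimeLie.oddParts S n))) ∧
      PrimeLie.HPleth (PrimeLie.LSeries (S \ {2})) =
        PowerSeries.mk (fun n => PrimeLie.powerSumOver (PrimeLie.oddParts S n)) ∧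
      PrimeLie.EPleth (PrimeLie.LSeries S) =
        PowerSeries.mk (fun n => PrimeLie.powerSumOver (PrimeLie.oddParts S n)) ∧
      PowerSeries.mk (fun n => PrimeLie.powerSumOver (PrimeLie.oddParts S n)) =
        PowerSeries.mk (fun n => PrimeLie.powerSumOver (PrimeLie.partsIn (S \ {2}) n))) ∧
    (2 ∉ S →
      (∀ m ∈ PrimeLie.P S, Odd m) ∧
      ∀ n : ℕ, PrimeLie.SchurPositive n
        (PrimeLie.powerSumOver (PrimeLie.partsInOrTwice S n))) := by
  constructor
  · intro h2
    have hE : PrimeLie.EPleth (PrimeLie.LSeries S) =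
        PowerSeries.mk fun n => PrimeLie.powerSumOver (PrimeLie.oddParts S n) :=
      (PrimeLie.EPleth_LSeries_of_two_mem h2).trans (PrimeLie.genFun_partWeight_odd S)
    refine ⟨fun n => ?_, (PrimeLie.HPleth_LSeries _).trans (PrimeLie.genFun_partWeight_odd S), hE, ?_⟩
    · have h3 := PrimeLie.coeff_EPleth_LSeries_mem S n
      rw [hE, PowerSeries.coeff_mk] at h3
      -- With all parts odd the signs are trivial, so the coefficient is itself a monomial
      -- characteristic and no twist is needed.
      exact PrimeLie.schurPositive_of_mem_monomialFrob h3
    · simp only [PrimeLie.oddParts_eq_partsIn]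
  · intro h2
    refine ⟨fun m hm => PrimeLie.odd_of_mem_P h2 hm, fun n => ?_⟩
    have h3 := PrimeLie.coeff_EPleth_LSeries_mem S n
    rw [PrimeLie.EPleth_LSeries_of_two_notMem h2, PrimeLie.coeff_genFun_partWeight
      (fun i hi => PrimeLie.odd_of_mem_P h2 hi)
      (by rintro i ⟨m, -, -, rfl⟩; exact even_two_mul m)] at h3
    have h4 : PrimeLie.partsInOrTwice S n = PrimeLie.partsInDistinct (PrimeLie.P S)
        {i | ∃ m, Odd m ∧ m ∈ PrimeLie.P S ∧ i = 2 * m} n := by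
      ext lam
      -- The two multiplicity conditions agree because an even part cannot lie in `P S`, so it must
      -- be twice an odd element of `P S`.
      refine and_congr_right fun h5 => ⟨?_, fun h6 i hi => ?_⟩
      · rintro h6 i ⟨m, -, -, rfl⟩
        exact h6 _ (even_two_mul m)
      · by_cases h7 : i ∈ lam.parts
        · exact (h5 i h7).elim
            (fun h8 => absurd hi (Nat.not_even_iff_odd.mpr (PrimeLie.odd_of_mem_P h2 h8))) (h6 i)
        · rw [Multiset.count_eq_zero_of_notMem h7]
          exact zero_le_one
    rw [h4]
    exact PrimeLie.schurPositive_powerSumOver h3
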